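/- A *graphon* is a symmetric measurable function $g:[0,1]^2\to[0,1]$. Its edge density, triangle density and entropy are $$\varepsilon(g)=\int g(x,y)\,dx\,dy,\qquad \tau(g)=\int g(x,y)g(y,z)g(z,x)\,dx\,dy\,dz,$$ $$S(g)=-\tfrac12\int \big(g\ln g+(1-g)\ln(1-g)\big)\,dx\,dy ,$$ with $0\ln 0=0$. The density of a finite simple graph $H$ with vertices $1,\dots,k$ is $t_H(g)=\int_{[0,1]^k}\prod_{ij\in E(H)}g(x_i,x_j)\,dx$. The cut metric is $d(f,g)=\sup_{S,T}\big|\int_{S\times T}(f-g)\big|$ over measurable $S,T\subseteq[0,1]$. Let $\delta(f,g)$ be the infimum of $d(f\circ(\varphi\times\varphi),g\circ(\psi\times\psi))$ over measure-preserving maps $\varphi,\psi$ of $[0,1]$. Graphons at $\delta$-distance $0$ are called equivalent. An *optimizer* at $(\varepsilon,\tau)$ is a graphon that maximizes $S$ among all graphons with edge density $\varepsilon$ and triangle density $\tau$. A *phase* is a nonempty connected open set $U\subset\mathbb R^2$ such that every $(\varepsilon,\tau)\in U$ has an optimizer $g_{\varepsilon,\tau}$, which is unique up to equivalence and varies analytically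 on $U$ (every $t_H(g_{\varepsilon,\tau})$ is a real-analytic function of $(\varepsilon,\tau)\in U$). Let $m\ge1$ and $r\in\{1,2\}$. Consider graphons $g$ for which $[0,1]$ can be partitioned into $r$ measurable podes of size $c/r$ each and $m$ measurable podes of size $(1-c)/m$ each, for some $0<c<1$, so that $g$ is almost everywhere constant on each product of two podes with the following values: $a_1$ on a pode of the first group, $a_2$ between two different podes of the first group, $d$ between the two groups, $b$ on a pode of the second group, and $p$ between two different podes of the second group. Such a $g$ is called a $B(m,1)$ graphon if $r=1$, and a $C(m,2)$ graphon if $r=2$, provided that no two of the $m+r$ podes have identical edge probabilities (the rows of the matrix of values are pairwise distinct) and that $g$ is not an $A(m+r,0)$ graphon, i.e. not a graphon with $m+r$ podes of size $1/(m+r)$ for which the value between two podes depends only on whether they coincide. A *$B(m,1)$ phase* (respectively *$C(m,2)$ phase*) is a phase contained in $\{\tau<\varepsilon^3\}$ all of whose optimizers are $B(m,1)$ (respectively $C(m,2)$) graphons. There is a *continuous transition* from a $B(m,1)$ phase $U$ to a $C(m,2)$ phase $V$ at $(\varepsilon_0,\tau_0)$ if $(\varepsilon_0,\tau_0)$ is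 a common boundary point of $U$ and $V$ and there is a $B(m,1)$ graphon $g_0$ such that $\delta(g_{\varepsilon,\tau},g_0)\to0$ as $(\varepsilon,\tau)\to(\varepsilon_0,\tau_0)$ within $U\cup V$. **Theorem.** For every $m\ge1$ there is a finite set $F\subset\mathbb R$ such that there is no continuous transition from a $B(m,1)$ phase to a $C(m,2)$ phase at any point $(\varepsilon_0,\tau_0)$ with $\varepsilon_0\notin F$. -/

import Mathlib

open MeasureTheory Set Filter Topology
open scoped unitInterval

noncomputable section

/-- A graphon: a symmetric measurable function on `[0,1]²` with values in `[0,1]`. -/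
structure Graphon where
  toFun : I → I → ℝ
  measurable' : Measurable (Function.uncurry toFun)
  symm' : ∀ x y, toFun x y = toFun y x
  nonneg' : ∀ x y, 0 ≤ toFun x y
  le_one' : ∀ x y, toFun x y ≤ 1

namespace Graphon

/-- The cut metric `sup_{S,T} |∫_{S×T} (f - g)|` on functions on `[0,1]²`. -/
def cutMetric (f g : I → I → ℝ) : ℝ :=
  sSup {r : ℝ | ∃ S T : Set I, MeasurableSet S ∧ MeasurableSet T ∧
    r = |∫ x in S, ∫ y in T, (f x y - g x y)|}

/-- The cut metric on reduced graphons: the infimum of the cut metric over all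
representatives `f(φ x, φ y)` and `g(ψ x, ψ y)`, with `φ`, `ψ` measure preserving
transformations of `[0,1]`. -/
def cutDist (f g : Graphon) : ℝ :=
  sInf {r : ℝ | ∃ φ ψ : I → I, MeasurePreserving φ volume volume ∧
    MeasurePreserving ψ volume volume ∧
    r = cutMetric (fun x y => f.toFun (φ x) (φ y)) (fun x y => g.toFun (ψ x) (ψ y))}

/-- Two graphons are equivalent (define the same reduced graphon) when their distance is `0`. -/
def Equivalent (f g : Graphon) : Prop := cutDist f g = 0

/-- The edge density `ε(g)`. -/
def edgeDensity (g : Graphon) : ℝ := ∫ x, ∫ y, g.toFun x y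

/-- The triangle density `τ(g)`. -/
def triangleDensity (g : Graphon) : ℝ :=
  ∫ x, ∫ y, ∫ z, g.toFun x y * g.toFun y z * g.toFun z x

open Classical in
/-- The density `t_H(g)` of a finite simple graph `H`; every edge of `H` occurs once,
as the pair `(i, j)` of its end points with `i < j`. -/
def homDensity {k : ℕ} (H : SimpleGraph (Fin k)) (g : Graphon) : ℝ :=
  ∫ x : Fin k → I,
    ∏ e ∈ Finset.univ.filter (fun e : Fin k × Fin k => e.1 < e.2 ∧ H.Adj e.1 e.2),
      g.toFun (x e.1) (x e.2)

/-- The graphon entropy `S(g)`. -/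
def entropy (g : Graphon) : ℝ :=
  -(1 / 2) * ∫ x, ∫ y, (g.toFun x y * Real.log (g.toFun x y) +
    (1 - g.toFun x y) * Real.log (1 - g.toFun x y))

/-- `g` maximizes the entropy among all graphons with edge density `x.1` and
triangle density `x.2`. -/
def IsOptimizer (g : Graphon) (x : ℝ × ℝ) : Prop :=
  g.edgeDensity = x.1 ∧ g.triangleDensity = x.2 ∧
    ∀ h : Graphon, h.edgeDensity = x.1 → h.triangleDensity = x.2 → h.entropy ≤ g.entropy

/-- `g` is multipodal: the nodes are partitioned into podes `κ ⁻¹' {i}` of sizes `w i`, and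
the value of `g` between the podes `i` and `j` is `P i j`. -/
def IsMultipodal {ι : Type} (g : Graphon) (w : ι → ℝ) (P : ι → ι → ℝ) : Prop :=
  ∃ κ : I → ι, (∀ i, MeasurableSet (κ ⁻¹' {i})) ∧
    (∀ i, (volume : Measure I).real (κ ⁻¹' {i}) = w i) ∧
    ∀ᵐ z : I × I, g.toFun z.1 z.2 = P (κ z.1) (κ z.2)

/-- An `A(n,0)` graphon: `n` podes of size `1/n`, where the value between two podes only
depends on whether they coincide. -/
def IsTypeA (n : ℕ) (g : Graphon) : Prop :=
  ∃ u v : ℝ, IsMultipodal g (fun _ : Fin n => 1 / (n : ℝ)) (fun i j => if i = j then u else v)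

/-- Sizes of the podes: `r` podes share the mass `c` equally and `m` podes share the mass
`1 - c` equally. -/
def podeSize (r m : ℕ) (c : ℝ) : Fin r ⊕ Fin m → ℝ
  | Sum.inl _ => c / r
  | Sum.inr _ => (1 - c) / m

/-- Values between podes, for `r` interchangeable podes and `m` other interchangeable podes:
`a₁` on a pode of the first group, `a₂` between two podes of the first group,
`d` between the groups, `b` on a pode of the second group,
`p` between two podes of the second group. -/
def podeValue (r m : ℕ) (a₁ a₂ d b p : ℝ) : Fin r ⊕ Fin m → Fin r ⊕ Fin m → ℝ
  | Sum.inl i, Sum.inl j => if i = j then a₁ else a₂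
  | Sum.inl _, Sum.inr _ => d
  | Sum.inr _, Sum.inl _ => d
  | Sum.inr i, Sum.inr j => if i = j then b else p

/-- `g` has `m` interchangeable podes plus another `r` interchangeable podes. Injectivity says
that no two podes have the same edge probabilities, so that `g` really has `m + r` podes, and
the last clause that the `m + r` podes are not all equivalent. -/
def HasPodalStructure (m r : ℕ) (g : Graphon) : Prop :=
  ∃ c a₁ a₂ d b p : ℝ, 0 < c ∧ c < 1 ∧
    Function.Injective (podeValue r m a₁ a₂ d b p) ∧
    IsMultipodal g (podeSize r m c) (podeValue r m a₁ a₂ d b p) ∧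
    ¬ IsTypeA (m + r) g

/-- A `B(m,1)` graphon: `m` equivalent podes plus one other. -/
def IsTypeB (m : ℕ) (g : Graphon) : Prop := HasPodalStructure m 1 g

/-- A `C(m,2)` graphon: `m` equivalent podes plus another equivalent pair of podes. -/
def IsTypeC (m : ℕ) (g : Graphon) : Prop := HasPodalStructure m 2 g

/-- A phase: a connected open set of achievable pairs (edge density, triangle density) in which
the optimizer is unique as a reduced graphon and varies analytically, that is, the
densities of all finite graphs in it are analytic functions of the pair. -/
def IsPhase (U : Set (ℝ × ℝ)) : Prop :=
  IsOpen U ∧ IsConnected U ∧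
    ∃ G : ℝ × ℝ → Graphon,
      (∀ x ∈ U, IsOptimizer (G x) x ∧ ∀ h, IsOptimizer h x → Equivalent h (G x)) ∧
      ∀ (k : ℕ) (H : SimpleGraph (Fin k)), AnalyticOnNhd ℝ (fun x => homDensity H (G x)) U

/-- A `B(m,1)` phase: a phase in the region `τ < ε³` in which the optimizers are
`B(m,1)` graphons. -/
def IsPhaseB (m : ℕ) (U : Set (ℝ × ℝ)) : Prop :=
  IsPhase U ∧ (∀ x ∈ U, x.2 < x.1 ^ 3) ∧ ∀ x ∈ U, ∀ g, IsOptimizer g x → IsTypeB m g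

/-- A `C(m,2)` phase: a phase in the region `τ < ε³` in which the optimizers are
`C(m,2)` graphons. -/
def IsPhaseC (m : ℕ) (U : Set (ℝ × ℝ)) : Prop :=
  IsPhase U ∧ (∀ x ∈ U, x.2 < x.1 ^ 3) ∧ ∀ x ∈ U, ∀ g, IsOptimizer g x → IsTypeC m g

/-- The transition between `U` and `V` at their common boundary point `x₀` is continuous with
limit state `g₀`: the optimizers on both sides converge to `g₀` in the cut metric on
reduced graphons as `x → x₀`. -/
def IsContinuousTransition (U V : Set (ℝ × ℝ)) (x₀ : ℝ × ℝ) (g₀ : Graphon) : Prop :=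
  x₀ ∈ frontier U ∧ x₀ ∈ frontier V ∧
    ∀ η > 0, ∀ᶠ x in 𝓝[U ∪ V] x₀, ∀ g, IsOptimizer g x → cutDist g g₀ < η

end Graphon

end

/-! The exceptional set can be taken empty: optimizers of a C(m,2) phase never converge to a B(m,1)
graphon. Such a convergence would force the two podes of a pair to merge, and merging contradicts
extremality.

Fix the edge density ε and regard the maximal entropy s in the C phase as a function of τ. Below τ =
ε³, mixing with the constant graphon raises the triangle density without losing entropy, so s is
nondecreasing and hence differentiable almost everywhere. Where it is differentiable, the block
values v of the optimizer satisfy slope(v) = A + B·sq with B ≥ 0, and there is one more equation for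
the mass c of the pair (`Extremal.euler_lagrange`). On the pair this gives slope(a₁) - slope(a₂) =
B·c(a₁ - a₂)²/2, while `slope` decreases at rate at least 2; hence B|a₂ - a₁| ≥ 4, and B → ∞ if the
pair merges. Dividing by B removes the entropy: the limit satisfies the first order conditions for
minimizing triangles alone at fixed edge density (`limit_conditions`). With λ the value of `sq` on
the merged pode, `sq` equals λ on blocks with value in (0,1), is at least λ on blocks with value 0
and at most λ on blocks with value 1.

The entropy returns through a comparison of orders (`WeakExtremal.no_curve`). Splitting the merged
value a into a - ρ and a + ρ removes c³ρ³ triangles and costs entropy O(ρ²). A curve that gains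
entropy proportional to t and triangles at most O(t²) would, with t proportional to ρ^(3/2), pay for
the split and still gain entropy. Thus no null direction of the triangle problem may gain entropy.
In particular, blocks with the same `sq` as an interior merged pode have the same value
(`WeakExtremal.val_eq`).

With this, algebra (`degenerate_one`, `degenerate_two`) leaves only two kinds of limits. In one, a
pode with 0 < a < 1 is joined completely (d = 1) to podes with b = 0; there the curve that enlarges
the pode gains entropy (`WeakExtremal.false_of_joined`). In the other, m = 2 and the limit is a
balanced bipartite graphon with an isolated pode; the bipartite graphon without the isolated pode
has more entropy (`false_of_isolated`).

To pass from graphons to parameters, closeness in cut distance is turned into a coupling of podes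
with nearly equal values (`exists_coupling`). By compactness there is an exact coupling in the
limit, and since the rows of the limit are distinct it is a surjection of m + 2 podes onto m + 1. It
merges the pair or, for m = 2, the other two podes, a case reduced to the first by exchanging the
groups. -/

noncomputable section

/-! ### Densities and entropy of shapes; mixing with a constant. -/

/-- Parameters of a graphon with two interchangeable podes of total mass `c` and a second group of
interchangeable podes of total mass `1 - c`. -/
structure Shape where
  c : ℝ
  a₁ : ℝ
  a₂ : ℝ
  d : ℝ
  b : ℝ
  p : ℝ

namespace Shape

open Real (binEntropy log)

/-- Edge density, for a second group of `m` podes. -/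
def edge (m : ℕ) (θ : Shape) : ℝ :=
  θ.c ^ 2 * (θ.a₁ + θ.a₂) / 2 + 2 * θ.c * (1 - θ.c) * θ.d +
    (1 - θ.c) ^ 2 * (θ.b + (m - 1) * θ.p) / m

/-- Triangle density. -/
def tri (m : ℕ) (θ : Shape) : ℝ :=
  θ.c ^ 3 * (θ.a₁ ^ 3 + 3 * θ.a₁ * θ.a₂ ^ 2) / 4 +
    3 * θ.c ^ 2 * (1 - θ.c) * θ.d ^ 2 * (θ.a₁ + θ.a₂) / 2 +
    3 * θ.c * (1 - θ.c) ^ 2 * θ.d ^ 2 * (θ.b + (m - 1) * θ.p) / m +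
    (1 - θ.c) ^ 3 * (θ.b ^ 3 + 3 * (m - 1) * θ.b * θ.p ^ 2 + (m - 1) * (m - 2) * θ.p ^ 3) / m ^ 2

/-- Entropy. -/
def ent (m : ℕ) (θ : Shape) : ℝ :=
  1 / 2 * (θ.c ^ 2 * (binEntropy θ.a₁ + binEntropy θ.a₂) / 2 +
    2 * θ.c * (1 - θ.c) * binEntropy θ.d +
    (1 - θ.c) ^ 2 * (binEntropy θ.b + (m - 1) * binEntropy θ.p) / m)

/-- The range of `p` is imposed even for `m = 1`, where the block of `p` has weight zero. -/
structure Valid (θ : Shape) : Prop where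
  c : θ.c ∈ Icc (0 : ℝ) 1
  a₁ : θ.a₁ ∈ Icc (0 : ℝ) 1
  a₂ : θ.a₂ ∈ Icc (0 : ℝ) 1
  d : θ.d ∈ Icc (0 : ℝ) 1
  b : θ.b ∈ Icc (0 : ℝ) 1
  p : θ.p ∈ Icc (0 : ℝ) 1

/-- The measures of the five kinds of blocks. -/
def wt (m : ℕ) (θ : Shape) : Fin 5 → ℝ :=
  ![θ.c ^ 2 / 2, θ.c ^ 2 / 2, 2 * θ.c * (1 - θ.c), (1 - θ.c) ^ 2 / m, (1 - θ.c) ^ 2 * (m - 1) / m]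

/-- The values on the five kinds of blocks. -/
def val (θ : Shape) : Fin 5 → ℝ := ![θ.a₁, θ.a₂, θ.d, θ.b, θ.p]

theorem edge_eq_sum (m : ℕ) (θ : Shape) : θ.edge m = ∑ j, θ.wt m j * θ.val j := by
  simp [Fin.sum_univ_succ, edge, wt, val]; ring

theorem ent_eq_sum (m : ℕ) (θ : Shape) :
    θ.ent m = 1 / 2 * ∑ j, θ.wt m j * binEntropy (θ.val j) := by
  simp [Fin.sum_univ_succ, ent, wt, val]; ring

theorem wt_nonneg {m : ℕ} (hm : 1 ≤ m) {θ : Shape} (h : θ.Valid) (j : Fin 5) : 0 ≤ θ.wt m j := by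
  have h0 := h.c.1
  have h1 : 0 ≤ 1 - θ.c := sub_nonneg.2 h.c.2
  have h2 : (0 : ℝ) ≤ m - 1 := sub_nonneg.2 (by exact_mod_cast hm)
  fin_cases j <;> simp [wt] <;> positivity

theorem wt_sum {m : ℕ} (hm : 1 ≤ m) (θ : Shape) : ∑ j, θ.wt m j = 1 := by
  have : (m : ℝ) ≠ 0 := by positivity
  simp [Fin.sum_univ_succ, wt]; field_simp; ring

theorem Valid.val_mem {θ : Shape} (h : θ.Valid) (j : Fin 5) : θ.val j ∈ Icc (0 : ℝ) 1 := by
  fin_cases j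
  exacts [h.a₁, h.a₂, h.d, h.b, h.p]

/-- Interpolation of all values towards the constant `e`. -/
def mix (θ : Shape) (e t : ℝ) : Shape :=
  ⟨θ.c, (1 - t) * θ.a₁ + t * e, (1 - t) * θ.a₂ + t * e, (1 - t) * θ.d + t * e,
    (1 - t) * θ.b + t * e, (1 - t) * θ.p + t * e⟩

theorem mix_val (θ : Shape) (e t : ℝ) (j : Fin 5) :
    (θ.mix e t).val j = (1 - t) * θ.val j + t * e := by
  fin_cases j <;> simp [mix, val]

theorem mix_wt (m : ℕ) (θ : Shape) (e t : ℝ) : (θ.mix e t).wt m = θ.wt m := rfl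

theorem convex_mem {x e t : ℝ} (hx : x ∈ Icc (0 : ℝ) 1) (he : e ∈ Icc (0 : ℝ) 1)
    (ht : t ∈ Icc (0 : ℝ) 1) : (1 - t) * x + t * e ∈ Icc (0 : ℝ) 1 :=
  convex_Icc 0 1 hx he (sub_nonneg.2 ht.2) ht.1 (by ring)

theorem Valid.mix {θ : Shape} (h : θ.Valid) {e t : ℝ} (he : e ∈ Icc (0 : ℝ) 1)
    (ht : t ∈ Icc (0 : ℝ) 1) : (θ.mix e t).Valid :=
  ⟨h.c, convex_mem h.a₁ he ht, convex_mem h.a₂ he ht, convex_mem h.d he ht,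
    convex_mem h.b he ht, convex_mem h.p he ht⟩

theorem edge_mix {m : ℕ} (hm : 1 ≤ m) (θ : Shape) (e t : ℝ) :
    (θ.mix e t).edge m = (1 - t) * θ.edge m + t * e := by
  simp only [edge_eq_sum, mix_wt, mix_val, mul_add, Finset.sum_add_distrib, Finset.mul_sum]
  rw [← Finset.sum_mul, wt_sum hm, one_mul]
  congr 1
  exact Finset.sum_congr rfl fun j _ => by ring

theorem tri_mix_one {m : ℕ} (hm : 1 ≤ m) (θ : Shape) (e : ℝ) : (θ.mix e 1).tri m = e ^ 3 := by
  have : (m : ℝ) ≠ 0 := by positivity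
  simp [tri, mix]; field_simp; ring

theorem mix_zero (θ : Shape) (e : ℝ) : θ.mix e 0 = θ := by simp [mix]

theorem binEntropy_convex {x e t : ℝ} (hx : x ∈ Icc (0 : ℝ) 1) (he : e ∈ Icc (0 : ℝ) 1)
    (ht : t ∈ Icc (0 : ℝ) 1) :
    (1 - t) * binEntropy x + t * binEntropy e ≤ binEntropy ((1 - t) * x + t * e) := by
  simpa using Real.strictConcave_binEntropy.concaveOn.2 hx he (sub_nonneg.2 ht.2) ht.1 (by ring)

/-- Interpolation gains entropy; block `j` may be singled out. -/
theorem ent_mix_ge {m : ℕ} (hm : 1 ≤ m) {θ : Shape} (h : θ.Valid) {e t : ℝ}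
    (he : e ∈ Icc (0 : ℝ) 1) (ht : t ∈ Icc (0 : ℝ) 1) (j : Fin 5) :
    (1 - t) * θ.ent m + t * (binEntropy e / 2) + 1 / 2 * (θ.wt m j *
      (binEntropy ((1 - t) * θ.val j + t * e) -
        ((1 - t) * binEntropy (θ.val j) + t * binEntropy e))) ≤ (θ.mix e t).ent m := by
  set g : Fin 5 → ℝ := fun i => θ.wt m i * (binEntropy ((1 - t) * θ.val i + t * e) -
        ((1 - t) * binEntropy (θ.val i) + t * binEntropy e)) with hg
  have h1 : g j ≤ ∑ i, g i := Finset.single_le_sum (fun i _ =>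
    mul_nonneg (wt_nonneg hm h i) (sub_nonneg.2 (binEntropy_convex (h.val_mem i) he ht)))
    (Finset.mem_univ j)
  have h2 : ∑ i, g i = 2 * (θ.mix e t).ent m - (1 - t) * (2 * θ.ent m) - t * binEntropy e := by
    simp only [ent_eq_sum, mix_wt, mix_val, hg, mul_sub, mul_add, Finset.sum_sub_distrib,
      Finset.sum_add_distrib]
    have h3 : ∑ x, θ.wt m x * (t * binEntropy e) = t * binEntropy e := by
      rw [← Finset.sum_mul, wt_sum hm, one_mul]
    have h4 : ∑ x, θ.wt m x * ((1 - t) * binEntropy (θ.val x)) =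
        (1 - t) * ∑ x, θ.wt m x * binEntropy (θ.val x) := by
      rw [Finset.mul_sum]; exact Finset.sum_congr rfl fun j _ => by ring
    rw [h3, h4]; ring
  have h5 : g j = θ.wt m j * (binEntropy ((1 - t) * θ.val j + t * e) -
        ((1 - t) * binEntropy (θ.val j) + t * binEntropy e)) := rfl
  rw [← h5]
  linarith

/-- Jensen's inequality for the five block weights, which sum to 1. -/
theorem ent_le_binEntropy {m : ℕ} (hm : 1 ≤ m) {θ : Shape} (h : θ.Valid) :
    θ.ent m ≤ binEntropy (θ.edge m) / 2 := by
  have := Real.strictConcave_binEntropy.concaveOn.le_map_sum (t := Finset.univ) (w := θ.wt m)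
    (p := θ.val) (fun j _ => wt_nonneg hm h j) (wt_sum hm θ) (fun j _ => h.val_mem j)
  simp only [smul_eq_mul] at this
  rw [ent_eq_sum, edge_eq_sum]; linarith

theorem edge_mem {m : ℕ} (hm : 1 ≤ m) {θ : Shape} (h : θ.Valid) : θ.edge m ∈ Icc (0 : ℝ) 1 := by
  rw [edge_eq_sum]
  exact (convex_Icc (0 : ℝ) 1).sum_mem (fun j _ => wt_nonneg hm h j) (wt_sum hm θ)
    (fun j _ => h.val_mem j)

theorem continuous_tri_mix (m : ℕ) (θ : Shape) (e : ℝ) : Continuous fun t => (θ.mix e t).tri m := by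
  simp only [tri, mix]; fun_prop

theorem differentiable_tri_mix (m : ℕ) (θ : Shape) (e : ℝ) :
    Differentiable ℝ fun t => (θ.mix e t).tri m := by
  simp only [tri, mix]; fun_prop

/-- Below the curve `τ = ε³`, the triangle density can be raised without losing entropy. -/
theorem exists_tri_eq {m : ℕ} (hm : 1 ≤ m) {θ : Shape} (h : θ.Valid) {τ : ℝ}
    (h1 : θ.tri m ≤ τ) (h2 : τ ≤ θ.edge m ^ 3) :
    ∃ θ' : Shape, θ'.Valid ∧ θ'.edge m = θ.edge m ∧ θ'.tri m = τ ∧ θ.ent m ≤ θ'.ent m := by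
  -- The path mixes θ with the constant equal to its own edge density: the edge density stays fixed
  -- and the triangle density ends at its cube. The entropy is bounded below by the interpolation
  -- between its initial value and the final one, which is larger by Jensen.
  have hc := (continuous_tri_mix m θ (θ.edge m)).continuousOn (s := Icc 0 1)
  have := intermediate_value_Icc zero_le_one hc
  simp only [mix_zero, tri_mix_one hm] at this
  obtain ⟨t, ht, hτ⟩ := this ⟨h1, h2⟩
  have he := edge_mem hm h
  refine ⟨_, h.mix he ht, by rw [edge_mix hm]; ring, hτ, ?_⟩
  have h3 := ent_mix_ge hm h he ht 0
  have h4 := ent_le_binEntropy hm h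
  have h5 := binEntropy_convex (h.val_mem 0) he ht
  have h6 : 0 ≤ θ.wt m 0 * (binEntropy ((1 - t) * θ.val 0 + t * θ.edge m) -
        ((1 - t) * binEntropy (θ.val 0) + t * binEntropy (θ.edge m))) :=
    mul_nonneg (wt_nonneg hm h 0) (sub_nonneg.2 h5)
  have h7 : 0 ≤ t * (binEntropy (θ.edge m) / 2 - θ.ent m) := mul_nonneg ht.1 (sub_nonneg.2 h4)
  linarith

/-! ### Extremal shapes have block values strictly between 0 and 1. -/

/-- `S` is the maximal entropy at `(ε, τ)`, and the maximal entropy is nondecreasing in the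
triangle density and differentiable there. -/
structure Extremal (m : ℕ) (ε τ S : ℝ) : Prop where
  ent_le : ∀ θ : Shape, θ.Valid → θ.edge m = ε → θ.tri m ≤ τ → θ.ent m ≤ S
  exists_deriv : ∃ (s : ℝ → ℝ) (β : ℝ), 0 ≤ β ∧ HasDerivAt s β τ ∧ s τ = S ∧
    ∀ᶠ t in 𝓝 τ, ∀ θ : Shape, θ.Valid → θ.edge m = ε → θ.tri m = t → θ.ent m ≤ s t

/-- The term -x log x gives the entropy an infinite slope at 0. -/
theorem eventually_mul_lt_binEntropy (C : ℝ) : ∀ᶠ x in 𝓝[>] (0 : ℝ), C * x < binEntropy x := by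
  have h1 : ∀ᶠ x in 𝓝[>] (0 : ℝ), log x < -C :=
    Real.tendsto_log_nhdsGT_zero.eventually (eventually_lt_atBot _)
  have h2 : ∀ᶠ x in 𝓝[>] (0 : ℝ), x < 1 := nhdsWithin_le_nhds (eventually_lt_nhds one_pos)
  filter_upwards [h1, h2, self_mem_nhdsWithin] with x hx hx1 hx0
  rw [Real.binEntropy_eq_negMulLog_add_negMulLog_one_sub]
  have h3 : 0 ≤ Real.negMulLog (1 - x) :=
    Real.negMulLog_nonneg (by linarith) (by linarith [mem_Ioi.1 hx0])
  have h4 : Real.negMulLog x = x * (-log x) := by simp [Real.negMulLog]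
  have h5 : x * C < x * (-log x) := mul_lt_mul_of_pos_left (by linarith) hx0
  linarith

/-- Mixing with the constant e changes the triangle density, and hence the bound s on the entropy,
at most linearly in t. A block of positive weight with value 0 or 1 would gain entropy faster than
any linear function. -/
theorem val_mem_Ioo {m : ℕ} (hm : 1 ≤ m) {θ : Shape} (h : θ.Valid)
    (hE : Extremal m (θ.edge m) (θ.tri m) (θ.ent m)) (he : θ.edge m ∈ Ioo (0 : ℝ) 1) (j : Fin 5)
    (hj : 0 < θ.wt m j) : θ.val j ∈ Ioo (0 : ℝ) 1 := by
  obtain ⟨s, β, -, hs, hs0, hle⟩ := hE.exists_deriv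
  set e := θ.edge m with he_def
  have heI : e ∈ Icc (0 : ℝ) 1 := Ioo_subset_Icc_self he
  have hf : HasDerivAt (fun t => s ((θ.mix e t).tri m))
      (β * deriv (fun t => (θ.mix e t).tri m) 0) 0 := by
    refine HasDerivAt.comp (h₂ := s) 0 ?_ (differentiable_tri_mix m θ e 0).hasDerivAt
    simpa [mix_zero] using hs
  set K := β * deriv (fun t => (θ.mix e t).tri m) 0
  have hup : ∀ᶠ t in 𝓝[>] (0 : ℝ), s ((θ.mix e t).tri m) ≤ θ.ent m + (K + 1) * t := by
    have := hf.tendsto_slope_zero_right.eventually (eventually_lt_nhds (lt_add_one K))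
    filter_upwards [this, self_mem_nhdsWithin] with t ht ht0
    simp only [zero_add, mix_zero, hs0, smul_eq_mul] at ht
    rw [inv_mul_lt_iff₀ ht0] at ht
    linarith
  have hle' : ∀ᶠ t in 𝓝[>] (0 : ℝ), (θ.mix e t).ent m ≤ θ.ent m + (K + 1) * t := by
    have h1 : Tendsto (fun t => (θ.mix e t).tri m) (𝓝[>] 0) (𝓝 (θ.tri m)) := by
      have := (continuous_tri_mix m θ e).tendsto 0
      rw [mix_zero] at this
      exact this.mono_left nhdsWithin_le_nhds
    have h2 : ∀ᶠ t in 𝓝[>] (0 : ℝ), t < 1 := nhdsWithin_le_nhds (eventually_lt_nhds one_pos)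
    filter_upwards [hup, h1.eventually hle, h2, self_mem_nhdsWithin] with t ht1 ht2 ht3 ht4
    refine (ht2 _ (h.mix heI ⟨le_of_lt ht4, ht3.le⟩) ?_ rfl).trans ht1
    rw [edge_mix hm]; ring
  -- Here y is the distance from the boundary value to e, so the block has entropy H(ty) on the
  -- path. The value 1 reduces to the value 0 by H(1 - x) = H(x).
  have key : ∀ y : ℝ, 0 < y → (binEntropy (θ.val j) = 0) →
      (∀ t, binEntropy ((1 - t) * θ.val j + t * e) = binEntropy (t * y)) → False := by
    intro y hy h0 hyt
    -- Chosen so that a gain of C·t on block j, added to the linear interpolation of the other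
    -- terms, reaches exactly the upper bound of slope K + 1.
    set C := 2 / θ.wt m j * (K + 1 + θ.ent m) + binEntropy e - binEntropy e / θ.wt m j
    have h3 : Tendsto (fun t : ℝ => t * y) (𝓝[>] 0) (𝓝[>] 0) := by
      refine tendsto_nhdsWithin_iff.2 ⟨?_, ?_⟩
      · have : Tendsto (fun t : ℝ => t * y) (𝓝 0) (𝓝 (0 * y)) := tendsto_id.mul_const y
        simpa using this.mono_left nhdsWithin_le_nhds
      · filter_upwards [self_mem_nhdsWithin] with t ht using mul_pos ht hy
    have h4 := h3.eventually (eventually_mul_lt_binEntropy (C / y))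
    have h2 : ∀ᶠ t in 𝓝[>] (0 : ℝ), t < 1 := nhdsWithin_le_nhds (eventually_lt_nhds one_pos)
    obtain ⟨t, ht1, ht2, ht3, ht4⟩ := (hle'.and (h4.and (h2.and self_mem_nhdsWithin))).exists
    have h5 := ent_mix_ge hm h heI ⟨le_of_lt ht4, ht3.le⟩ j
    rw [hyt, h0] at h5
    have h6 : C / y * (t * y) = C * t := by field_simp
    rw [h6] at ht2
    have h7 := mul_lt_mul_of_pos_left ht2 hj
    have h8 : θ.wt m j * (C * t) = t * (2 * (K + 1 + θ.ent m) +
        θ.wt m j * binEntropy e - binEntropy e) := by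
      simp only [C]; field_simp
    rw [h8] at h7
    linarith
  have hv := h.val_mem j
  refine ⟨lt_of_le_of_ne hv.1 fun h0 => ?_, lt_of_le_of_ne hv.2 fun h0 => ?_⟩
  · exact key e he.1 (by simp [← h0]) fun t => by rw [← h0]; ring_nf
  · exact key (1 - e) (sub_pos.2 he.2) (by simp [h0]) fun t => by
      rw [h0, ← Real.binEntropy_one_sub (t * (1 - e))]; ring_nf

/-! ### First variations and the Euler–Lagrange equations. -/

/-- The derivative of `binEntropy`. -/
def slope (v : ℝ) : ℝ := log (1 - v) - log v

theorem hasDerivAt_slope {v : ℝ} (hv : v ∈ Ioo (0 : ℝ) 1) : HasDerivAt binEntropy (slope v) v :=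
  Real.hasDerivAt_binEntropy hv.1.ne' hv.2.ne

/-- The values of `∫ g(x, z) g(z, y) dz` on the five kinds of blocks. -/
def sq (m : ℕ) (θ : Shape) : Fin 5 → ℝ :=
  ![θ.c * (θ.a₁ ^ 2 + θ.a₂ ^ 2) / 2 + (1 - θ.c) * θ.d ^ 2,
    θ.c * θ.a₁ * θ.a₂ + (1 - θ.c) * θ.d ^ 2,
    θ.d * (θ.c * (θ.a₁ + θ.a₂) / 2 + (1 - θ.c) * (θ.b + (m - 1) * θ.p) / m),
    θ.c * θ.d ^ 2 + (1 - θ.c) * (θ.b ^ 2 + (m - 1) * θ.p ^ 2) / m,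
    θ.c * θ.d ^ 2 + (1 - θ.c) * (2 * θ.b * θ.p + (m - 2) * θ.p ^ 2) / m]

/-- Derivative of the edge density in the mass of the first group. -/
def edgeC (m : ℕ) (θ : Shape) : ℝ :=
  θ.c * (θ.a₁ + θ.a₂) + 2 * (1 - 2 * θ.c) * θ.d - 2 * (1 - θ.c) * (θ.b + (m - 1) * θ.p) / m

/-- Derivative of the triangle density in the mass of the first group. -/
def triC (m : ℕ) (θ : Shape) : ℝ :=
  3 * θ.c ^ 2 * (θ.a₁ ^ 3 + 3 * θ.a₁ * θ.a₂ ^ 2) / 4 +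
    3 * (2 * θ.c - 3 * θ.c ^ 2) * θ.d ^ 2 * (θ.a₁ + θ.a₂) / 2 +
    3 * ((1 - θ.c) ^ 2 - 2 * θ.c * (1 - θ.c)) * θ.d ^ 2 * (θ.b + (m - 1) * θ.p) / m -
    3 * (1 - θ.c) ^ 2 *
      (θ.b ^ 3 + 3 * (m - 1) * θ.b * θ.p ^ 2 + (m - 1) * (m - 2) * θ.p ^ 3) / m ^ 2

/-- Derivative of the entropy in the mass of the first group. -/
def entC (m : ℕ) (θ : Shape) : ℝ :=
  1 / 2 * (θ.c * (binEntropy θ.a₁ + binEntropy θ.a₂) + 2 * (1 - 2 * θ.c) * binEntropy θ.d -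
    2 * (1 - θ.c) * (binEntropy θ.b + (m - 1) * binEntropy θ.p) / m)

/-- The shape with given mass and block values. -/
def ofVal (c : ℝ) (v : Fin 5 → ℝ) : Shape := ⟨c, v 0, v 1, v 2, v 3, v 4⟩

theorem ofVal_val (θ : Shape) : ofVal θ.c θ.val = θ := rfl

theorem val_ofVal (c : ℝ) (v : Fin 5 → ℝ) (j : Fin 5) : (ofVal c v).val j = v j := by
  fin_cases j <;> rfl

theorem valid_ofVal {c : ℝ} {v : Fin 5 → ℝ} (hc : c ∈ Icc (0 : ℝ) 1)
    (hv : ∀ j, v j ∈ Icc (0 : ℝ) 1) : (ofVal c v).Valid :=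
  ⟨hc, hv 0, hv 1, hv 2, hv 3, hv 4⟩

section Curves

variable {m : ℕ} {c : ℝ → ℝ} {v : Fin 5 → ℝ → ℝ} {c' t : ℝ} {v' : Fin 5 → ℝ}

theorem hasDerivAt_edge (hc : HasDerivAt c c' t) (hv : ∀ j, HasDerivAt (v j) (v' j) t) :
    HasDerivAt (fun s => (ofVal (c s) fun j => v j s).edge m)
      (c' * (ofVal (c t) fun j => v j t).edgeC m +
        ∑ j, (ofVal (c t) fun j => v j t).wt m j * v' j) t := by
  have h1 := hc.const_sub 1
  have h := ((((hc.pow 2).mul ((hv 0).add (hv 1))).div_const 2).add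
    (((hc.const_mul 2).mul h1).mul (hv 2))).add
    (((h1.pow 2).mul ((hv 3).add ((hv 4).const_mul ((m : ℝ) - 1)))).div_const (m : ℝ))
  refine HasDerivAt.congr_deriv h ?_
  simp [Fin.sum_univ_succ, ofVal, wt, edgeC]
  ring

theorem hasDerivAt_ent (hc : HasDerivAt c c' t) (hv : ∀ j, HasDerivAt (v j) (v' j) t)
    (h01 : ∀ j, v j t ∈ Ioo (0 : ℝ) 1) :
    HasDerivAt (fun s => (ofVal (c s) fun j => v j s).ent m)
      (c' * (ofVal (c t) fun j => v j t).entC m +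
        1 / 2 * ∑ j, (ofVal (c t) fun j => v j t).wt m j * (slope (v j t) * v' j)) t := by
  have h1 := hc.const_sub 1
  have hH : ∀ j, HasDerivAt (fun s => binEntropy (v j s)) (slope (v j t) * v' j) t := fun j =>
    (hasDerivAt_slope (h01 j)).comp t (hv j)
  have h := (((((hc.pow 2).mul ((hH 0).add (hH 1))).div_const 2).add
    (((hc.const_mul 2).mul h1).mul (hH 2))).add
    (((h1.pow 2).mul ((hH 3).add ((hH 4).const_mul ((m : ℝ) - 1)))).div_const (m : ℝ))).const_mul
    (1 / 2)
  refine HasDerivAt.congr_deriv h ?_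
  simp [Fin.sum_univ_succ, ofVal, wt, entC]
  ring

/-- The three edges of a triangle contribute equally, so the partial derivative in the j-th block
value is 3·wt·sq. -/
theorem hasDerivAt_tri (hc : HasDerivAt c c' t) (hv : ∀ j, HasDerivAt (v j) (v' j) t) :
    HasDerivAt (fun s => (ofVal (c s) fun j => v j s).tri m)
      (c' * (ofVal (c t) fun j => v j t).triC m +
        3 * ∑ j, (ofVal (c t) fun j => v j t).wt m j *
          ((ofVal (c t) fun j => v j t).sq m j * v' j)) t := by
  have h1 := hc.const_sub 1
  have e1 := (((hc.pow 3).mul (((hv 0).pow 3).add (((hv 0).const_mul 3).mul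
    ((hv 1).pow 2)))).div_const 4)
  have e2 := (((((hc.pow 2).const_mul 3).mul h1).mul ((hv 2).pow 2)).mul
    ((hv 0).add (hv 1))).div_const 2
  have e3 := ((((hc.const_mul 3).mul (h1.pow 2)).mul ((hv 2).pow 2)).mul
    ((hv 3).add ((hv 4).const_mul ((m : ℝ) - 1)))).div_const (m : ℝ)
  have e4 := ((h1.pow 3).mul ((((hv 3).pow 3).add (((hv 3).const_mul (3 * ((m : ℝ) - 1))).mul
    ((hv 4).pow 2))).add (((hv 4).pow 3).const_mul (((m : ℝ) - 1) * (m - 2))))).div_const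
    ((m : ℝ) ^ 2)
  refine HasDerivAt.congr_deriv (((e1.add e2).add e3).add e4) ?_
  simp [Fin.sum_univ_succ, ofVal, wt, triC, sq]
  ring

end Curves

/-- First order conditions along a direction in which the first block value is adapted so as to
keep the edge density. -/
theorem Extremal.exists_deriv_eq {m : ℕ} {θ : Shape} {β : ℝ} {s : ℝ → ℝ}
    (hc : θ.c ∈ Ioo (0 : ℝ) 1) (h01 : ∀ j, θ.val j ∈ Ioo (0 : ℝ) 1)
    (hs : HasDerivAt s β (θ.tri m)) (hs0 : s (θ.tri m) = θ.ent m)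
    (hle : ∀ᶠ t in 𝓝 (θ.tri m), ∀ θ' : Shape, θ'.Valid → θ'.edge m = θ.edge m → θ'.tri m = t →
      θ'.ent m ≤ s t) (kc : ℝ) (k : Fin 5 → ℝ) :
    ∃ y : ℝ, kc * θ.edgeC m + ∑ j, θ.wt m j * Function.update k 0 y j = 0 ∧
      kc * θ.entC m + 1 / 2 * ∑ j, θ.wt m j * (slope (θ.val j) * Function.update k 0 y j) =
        β * (kc * θ.triC m + 3 * ∑ j, θ.wt m j * (θ.sq m j * Function.update k 0 y j)) := by
  set c : ℝ → ℝ := fun t => θ.c + t * kc with hcdef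
  have hc0 : HasDerivAt c kc 0 := by
    simpa [hcdef] using ((hasDerivAt_id (0 : ℝ)).mul_const kc).const_add θ.c
  -- With block 0 set to zero, R is the edge density of the other blocks. As block 0 has weight
  -- c²/2, the value a below restores the edge density.
  set u : Fin 5 → ℝ → ℝ := fun j t => Function.update (fun j => θ.val j + t * k j) 0 0 j
  have hu : ∀ j, HasDerivAt (u j) (Function.update k 0 0 j) 0 := by
    intro j
    rcases eq_or_ne j 0 with rfl | hj
    · simpa [u] using hasDerivAt_const (0 : ℝ) (0 : ℝ)
    · simpa [u, hj] using ((hasDerivAt_id (0 : ℝ)).mul_const (k j)).const_add (θ.val j)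
  have hR := hasDerivAt_edge (m := m) hc0 hu
  set R : ℝ → ℝ := fun t => (ofVal (c t) fun j => u j t).edge m
  set a : ℝ → ℝ := fun t => 2 * (θ.edge m - R t) / c t ^ 2 with ha
  have hcne : c 0 ≠ 0 := by simpa [hcdef] using hc.1.ne'
  have hRe : ∀ t, R t = (ofVal (c t) fun j => u j t).edge m := fun t => rfl
  have ha' : ∃ y, HasDerivAt a y 0 := ⟨_, ((hR.const_sub (θ.edge m)).const_mul 2).div (hc0.pow 2)
    (pow_ne_zero 2 hcne)⟩
  obtain ⟨y, hy⟩ := ha'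
  set v : Fin 5 → ℝ → ℝ := fun j t => Function.update (fun j => θ.val j + t * k j) 0 (a t) j
  have hv : ∀ j, HasDerivAt (v j) (Function.update k 0 y j) 0 := by
    intro j
    rcases eq_or_ne j 0 with rfl | hj
    · simpa [v] using hy
    · simpa [v, hj] using ((hasDerivAt_id (0 : ℝ)).mul_const (k j)).const_add (θ.val j)
  have hedge : ∀ t, c t ≠ 0 → (ofVal (c t) fun j => v j t).edge m = θ.edge m := by
    intro t ht
    have h1 : (ofVal (c t) fun j => v j t).edge m = R t + c t ^ 2 * a t / 2 := by
      rw [hRe]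
      simp [edge, ofVal, u, v]
      ring
    rw [h1, ha]
    field_simp
    ring
  have hv0 : ∀ j, v j 0 = θ.val j := by
    intro j
    rcases eq_or_ne j 0 with rfl | hj
    · have h1 : R 0 + θ.c ^ 2 * θ.a₁ / 2 = θ.edge m := by
        rw [hRe]
        simp [edge, ofVal, u, hcdef, val]
        ring
      have hcc : c 0 = θ.c := by simp [hcdef]
      simp only [v, Function.update_self, ha, hcc, ← h1]
      have := hc.1.ne'
      simp [val]
      field_simp
    · simp [v, hj]
  have hc00 : c 0 = θ.c := by simp [hcdef]
  have h0 : (ofVal (c 0) fun j => v j 0) = θ := by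
    simp only [hv0, hc00]; exact ofVal_val θ
  have hcev : ∀ᶠ t in 𝓝 (0 : ℝ), c t ≠ 0 := hc0.continuousAt.eventually_ne hcne
  have hE := hasDerivAt_edge (m := m) hc0 hv
  have hS := hasDerivAt_ent (m := m) hc0 hv (fun j => by rw [hv0]; exact h01 j)
  have hT := hasDerivAt_tri (m := m) hc0 hv
  rw [h0] at hE hS hT
  simp only [hv0] at hS
  refine ⟨y, ?_, ?_⟩
  · have h2 : HasDerivAt (fun t => (ofVal (c t) fun j => v j t).edge m) 0 0 :=
      (hasDerivAt_const 0 (θ.edge m)).congr_of_eventuallyEq (hcev.mono fun t ht => hedge t ht)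
    exact hE.unique h2
  · have hT0 : (ofVal (c 0) fun j => v j 0).tri m = θ.tri m := by rw [h0]
    have hsT := HasDerivAt.comp (h₂ := s) 0 (by rw [hT0]; exact hs) hT
    -- Along the curve s bounds the entropy, with equality at 0, so the difference has a critical
    -- point there.
    have hmin : IsLocalMin (fun t => s ((ofVal (c t) fun j => v j t).tri m) -
        (ofVal (c t) fun j => v j t).ent m) 0 := by
      have hcI : ∀ᶠ t in 𝓝 (0 : ℝ), c t ∈ Icc (0 : ℝ) 1 :=
        hc0.continuousAt.eventually_mem (by rw [hc00]; exact Icc_mem_nhds hc.1 hc.2)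
      have hvI : ∀ᶠ t in 𝓝 (0 : ℝ), ∀ j, v j t ∈ Icc (0 : ℝ) 1 :=
        eventually_all.2 fun j => (hv j).continuousAt.eventually_mem
          (by rw [hv0]; exact Icc_mem_nhds (h01 j).1 (h01 j).2)
      have hTt := hT.continuousAt.tendsto
      rw [hT0] at hTt
      filter_upwards [hcI, hvI, hcev, hTt.eventually hle] with t ht1 ht2 ht3 ht4
      have := ht4 _ (valid_ofVal ht1 ht2) (hedge t ht3) rfl
      rw [h0, hs0, sub_self]
      exact sub_nonneg.2 this
    have := hmin.hasDerivAt_eq_zero (hsT.sub hS)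
    linarith

/-- The Euler–Lagrange equations. -/
theorem Extremal.euler_lagrange {m : ℕ} {θ : Shape}
    (hE : Extremal m (θ.edge m) (θ.tri m) (θ.ent m)) (hc : θ.c ∈ Ioo (0 : ℝ) 1)
    (h01 : ∀ j, θ.val j ∈ Ioo (0 : ℝ) 1) :
    ∃ A B : ℝ, 0 ≤ B ∧ (∀ j, 0 < θ.wt m j → slope (θ.val j) = A + B * θ.sq m j) ∧
      θ.entC m = A / 2 * θ.edgeC m + B / 6 * θ.triC m := by
  obtain ⟨s, β, hβ, hs, hs0, hle⟩ := hE.exists_deriv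
  have key := Extremal.exists_deriv_eq hc h01 hs hs0 hle
  have hw : 0 < θ.wt m 0 := by simp only [wt]; have := hc.1; simp; positivity
  -- A is fixed by the equation on block 0. The factor 6 combines the 3 in the derivative of the
  -- triangle density with the 1/2 in the entropy.
  refine ⟨slope (θ.val 0) - 6 * β * θ.sq m 0, 6 * β, by positivity, fun j hj => ?_, ?_⟩
  · rcases eq_or_ne j 0 with rfl | hj0
    · ring
    obtain ⟨y, h1, h2⟩ := key 0 (Pi.single j 1)
    have h3 : ∀ f : Fin 5 → ℝ, ∑ i, f i * Function.update (Pi.single j 1 : Fin 5 → ℝ) 0 y i =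
        f 0 * y + f j := by
      intro f
      have : ∀ i, f i * Function.update (Pi.single j 1 : Fin 5 → ℝ) 0 y i =
          (if i = 0 then f 0 * y else 0) + (if i = j then f j else 0) := by
        intro i
        rcases eq_or_ne i 0 with rfl | hi
        · simp [hj0.symm]
        · rcases eq_or_ne i j with rfl | hij
          · simp [hi]
          · simp [hi, hij]
      simp [this, Finset.sum_add_distrib]
    simp only [← mul_assoc] at h2
    rw [h3] at h1 h2
    rw [h3] at h2
    have h4 : θ.wt m j = - (θ.wt m 0 * y) := by linarith
    have h5 : θ.wt m j * (slope (θ.val j) - (slope (θ.val 0) - 6 * β * θ.sq m 0 +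
        6 * β * θ.sq m j)) = 0 := by
      have h6 : θ.wt m 0 * y = - θ.wt m j := by linarith
      linear_combination 2 * h2 - (slope (θ.val 0) - 6 * β * θ.sq m 0) * h6
    have := (mul_eq_zero.1 h5).resolve_left hj.ne'
    linarith
  · obtain ⟨y, h1, h2⟩ := key 1 0
    have h3 : ∀ f : Fin 5 → ℝ, ∑ i, f i * Function.update (0 : Fin 5 → ℝ) 0 y i = f 0 * y := by
      intro f
      have : ∀ i, f i * Function.update (0 : Fin 5 → ℝ) 0 y i = if i = 0 then f 0 * y else 0 := by
        intro i
        rcases eq_or_ne i 0 with rfl | hi <;> simp [*]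
      simp [this]
    simp only [← mul_assoc] at h2
    rw [h3] at h1 h2
    rw [h3] at h2
    linear_combination h2 - (slope (θ.val 0) - 6 * β * θ.sq m 0) / 2 * h1

/-! ### Merging podes: the multiplier blows up. -/

/-- A shape from its mass and block values, uncurried. -/
def mk' (x : ℝ × (Fin 5 → ℝ)) : Shape := ofVal x.1 x.2

theorem continuous_edge (m : ℕ) : Continuous fun x => (mk' x).edge m := by
  simp only [mk', ofVal, edge, div_eq_mul_inv]; fun_prop

theorem continuous_tri (m : ℕ) : Continuous fun x => (mk' x).tri m := by
  simp only [mk', ofVal, tri, div_eq_mul_inv]; fun_prop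

theorem continuous_ent (m : ℕ) : Continuous fun x => (mk' x).ent m := by
  simp only [mk', ofVal, ent, div_eq_mul_inv]; fun_prop

theorem continuous_edgeC (m : ℕ) : Continuous fun x => (mk' x).edgeC m := by
  simp only [mk', ofVal, edgeC, div_eq_mul_inv]; fun_prop

theorem continuous_triC (m : ℕ) : Continuous fun x => (mk' x).triC m := by
  simp only [mk', ofVal, triC, div_eq_mul_inv]; fun_prop

theorem continuous_entC (m : ℕ) : Continuous fun x => (mk' x).entC m := by
  simp only [mk', ofVal, entC, div_eq_mul_inv]; fun_prop

theorem continuous_sq (m : ℕ) (j : Fin 5) : Continuous fun x => (mk' x).sq m j := by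
  simp only [mk', ofVal, sq, div_eq_mul_inv]
  fin_cases j <;> simp <;> fun_prop

/-- Both log(y/x) and log((1 - x)/(1 - y)) are at least y - x. -/
theorem slope_sub_le {x y : ℝ} (hx : 0 < x) (hxy : x < y) (hy : y < 1) :
    2 * (y - x) ≤ slope x - slope y := by
  have h1 := Real.one_sub_inv_le_log_of_pos (div_pos (hx.trans hxy) hx)
  have h2 := Real.one_sub_inv_le_log_of_pos (div_pos (sub_pos.2 (hxy.trans hy)) (sub_pos.2 hy))
  rw [Real.log_div (by linarith) (by linarith)] at h1 h2
  have h3 : y - x ≤ 1 - (y / x)⁻¹ := by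
    have h0 : 0 < y := by linarith
    have : 1 - (y / x)⁻¹ = (y - x) / y := by field_simp
    rw [this, le_div_iff₀ h0]
    nlinarith
  have h4 : y - x ≤ 1 - ((1 - x) / (1 - y))⁻¹ := by
    have h0 : 0 < 1 - x := by linarith
    have : 1 - ((1 - x) / (1 - y))⁻¹ = (y - x) / (1 - x) := by
      have : 1 - y ≠ 0 := by linarith
      field_simp; ring
    rw [this, le_div_iff₀ h0]
    nlinarith
  simp only [slope]
  linarith

/-- Different values inside and across a pair of podes force a large multiplier. -/
theorem multiplier_large {c x y A B s₁ s₂ : ℝ} (hc : c ∈ Ioo (0 : ℝ) 1) (hx : x ∈ Ioo (0 : ℝ) 1)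
    (hy : y ∈ Ioo (0 : ℝ) 1) (hxy : x ≠ y) (hB : 0 ≤ B) (h1 : slope x = A + B * s₁)
    (h2 : slope y = A + B * s₂) (hs : s₁ - s₂ = c / 2 * (x - y) ^ 2) :
    4 ≤ B * |y - x| ∧ 0 < B ∧ -log B ≤ slope x ∧ slope y ≤ log B := by
  have h3 : slope x - slope y = B * (c / 2 * (x - y) ^ 2) := by rw [h1, h2, ← hs]; ring
  have h4 : x < y := by
    by_contra h
    have h5 := slope_sub_le hy.1 (lt_of_le_of_ne (not_lt.1 h) hxy.symm) hx.2
    have h6 : 0 ≤ B * (c / 2 * (x - y) ^ 2) := by have := hc.1; positivity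
    have : y < x := lt_of_le_of_ne (not_lt.1 h) hxy.symm
    linarith
  have h5 := slope_sub_le hx.1 h4 hy.2
  rw [h3] at h5
  have h6 : 0 < y - x := sub_pos.2 h4
  have h7 : 4 ≤ B * (y - x) := by
    have h8 : 2 ≤ B * (c / 2 * (y - x)) := by
      refine le_of_mul_le_mul_right ?_ h6
      nlinarith
    have h9 : 0 ≤ B * (y - x) := by positivity
    nlinarith [hc.1, hc.2]
  have h8 : 0 < B := by
    rcases hB.lt_or_eq with h | h
    · exact h
    · rw [← h] at h7; norm_num at h7
  rw [abs_of_pos h6]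
  -- The gap bounds 1 - x and y from below by B⁻¹. This controls the slopes by log B, which is o(B),
  -- even if the common limit of x and y is 0 or 1.
  have h9 : B⁻¹ ≤ y - x := by
    rw [inv_le_iff_one_le_mul₀ h8]; linarith
  have hinv : 0 < B⁻¹ := inv_pos.2 h8
  refine ⟨h7, h8, ?_, ?_⟩
  · have h10 : log B⁻¹ ≤ log (1 - x) := Real.log_le_log hinv (by linarith [hy.2])
    have h11 : log x ≤ 0 := Real.log_nonpos hx.1.le hx.2.le
    rw [Real.log_inv] at h10
    simp only [slope]; linarith
  · have h10 : log B⁻¹ ≤ log y := Real.log_le_log hinv (by linarith [hx.1])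
    have h11 : log (1 - y) ≤ 0 := Real.log_nonpos (by linarith [hy.2]) (by linarith [hy.1])
    rw [Real.log_inv] at h10
    simp only [slope]; linarith

/-- The conditions satisfied by a limit of extremal shapes in which the first two podes merge. -/
theorem limit_conditions {m : ℕ} (hm : 1 ≤ m) {l : Filter ℕ} [l.NeBot]
    {x : ℕ → ℝ × (Fin 5 → ℝ)} {z : ℝ × (Fin 5 → ℝ)} (hx : Tendsto x l (𝓝 z))
    (hc : ∀ n, (x n).1 ∈ Ioo (0 : ℝ) 1) (hv : ∀ n j, (x n).2 j ∈ Ioo (0 : ℝ) 1)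
    (hne : ∀ n, (x n).2 0 ≠ (x n).2 1) (hz : z.2 0 = z.2 1)
    (hE : ∀ n, Extremal m ((mk' (x n)).edge m) ((mk' (x n)).tri m) ((mk' (x n)).ent m)) :
    (∀ j, j ≠ 4 ∨ 2 ≤ m → (z.2 j < 1 → (mk' z).sq m 0 ≤ (mk' z).sq m j) ∧
      (0 < z.2 j → (mk' z).sq m j ≤ (mk' z).sq m 0)) ∧
    (mk' z).triC m = 3 * (mk' z).sq m 0 * (mk' z).edgeC m := by
  have hval : ∀ n j, (mk' (x n)).val j = (x n).2 j := fun n j => val_ofVal _ _ _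
  have hEL := fun n => (hE n).euler_lagrange (hc n) (fun j => by rw [hval]; exact hv n j)
  choose A B hB hslope hnode using hEL
  have hm0 : (0 : ℝ) < m := by exact_mod_cast hm
  have hwt : ∀ n j, j ≠ 4 ∨ 2 ≤ m → 0 < (mk' (x n)).wt m j := by
    intro n j hj
    have h0 := (hc n).1
    have h1 : 0 < 1 - (x n).1 := sub_pos.2 (hc n).2
    fin_cases j
    · simp [wt, mk', ofVal]; positivity
    · simp [wt, mk', ofVal]; positivity
    · simp [wt, mk', ofVal]; positivity
    · simp [wt, mk', ofVal]; positivity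
    · have : 2 ≤ m := by simpa using hj
      have h2 : (0 : ℝ) < m - 1 := by
        have : (2 : ℝ) ≤ m := by exact_mod_cast this
        linarith
      simp [wt, mk', ofVal]; positivity
  have hsl : ∀ n j, j ≠ 4 ∨ 2 ≤ m → slope ((x n).2 j) = A n + B n * (mk' (x n)).sq m j := by
    intro n j hj
    rw [← hval]; exact hslope n j (hwt n j hj)
  have hlarge := fun n => multiplier_large (hc n) (hv n 0) (hv n 1) (hne n) (hB n)
    (hsl n 0 (by simp)) (hsl n 1 (by simp)) (by simp [sq, mk', ofVal]; ring)
  have hxj : ∀ j, Tendsto (fun n => (x n).2 j) l (𝓝 (z.2 j)) := fun j =>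
    (((continuous_apply j).comp continuous_snd).tendsto z).comp hx
  have hBtop : Tendsto B l atTop := by
    have h1 : Tendsto (fun n => |(x n).2 1 - (x n).2 0|) l (𝓝[>] 0) := by
      refine tendsto_nhdsWithin_iff.2 ⟨?_, Eventually.of_forall fun n => ?_⟩
      · have := ((hxj 1).sub (hxj 0)).abs
        rwa [hz, sub_self, abs_zero] at this
      · exact abs_pos.2 (sub_ne_zero.2 (hne n).symm)
    refine tendsto_atTop_mono (fun n => ?_) (h1.inv_tendsto_nhdsGT_zero.const_mul_atTop
      (r := 4) (by norm_num))
    have h2 := (hlarge n).1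
    have h3 : 0 < |(x n).2 1 - (x n).2 0| := abs_pos.2 (sub_ne_zero.2 (hne n).symm)
    simp only [Pi.inv_apply]
    rw [← div_eq_mul_inv, div_le_iff₀ h3]
    exact h2
  have hlogB : Tendsto (fun n => log (B n) / B n) l (𝓝 0) :=
    (Real.isLittleO_log_id_atTop.tendsto_div_nhds_zero).comp hBtop
  have hconst : ∀ K : ℝ, Tendsto (fun n => K / B n) l (𝓝 0) := fun K =>
    hBtop.const_div_atTop K
  have hsq : ∀ j, Tendsto (fun n => (mk' (x n)).sq m j) l (𝓝 ((mk' z).sq m j)) := fun j =>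
    ((continuous_sq m j).tendsto z).comp hx
  set lam : ℝ := (mk' z).sq m 0 with hlam
  have hlim : ∀ n j, j ≠ 4 ∨ 2 ≤ m →
      slope ((x n).2 j) / B n = (mk' (x n)).sq m j - (-A n / B n) := by
    intro n j hj
    have := (hlarge n).2.1.ne'
    rw [hsl n j hj]; field_simp; ring
  have hlamlim : Tendsto (fun n => -A n / B n) l (𝓝 lam) := by
    -- The two values of the pair squeeze -A/B between sq₁ - (log B)/B and sq₀ + (log B)/B, whose
    -- limits agree because the pair merges.
    have h01 : (mk' z).sq m 1 = lam := by
      rw [hlam]; simp only [sq, mk', ofVal, hz]; simp; ring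
    have h1 := (hsq 0).add hlogB
    have h2 := (hsq 1).sub hlogB
    rw [h01, sub_zero] at h2
    rw [add_zero] at h1
    refine tendsto_of_tendsto_of_tendsto_of_le_of_le h2 h1 (fun n => ?_) (fun n => ?_)
    · have h3 := hlim n 1 (by simp)
      have h4 : slope ((x n).2 1) / B n ≤ log (B n) / B n :=
        div_le_div_of_nonneg_right (hlarge n).2.2.2 (hB n)
      simp only; linarith
    · have h3 := hlim n 0 (by simp)
      have h4 : -log (B n) / B n ≤ slope ((x n).2 0) / B n :=
        div_le_div_of_nonneg_right (hlarge n).2.2.1 (hB n)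
      rw [neg_div] at h4
      simp only; linarith
  refine ⟨fun j hj => ⟨fun h1 => ?_, fun h0 => ?_⟩, ?_⟩
  -- A value with limit below 1 has `slope` bounded below, so the limit of slope/B is nonnegative.
  -- The next case is symmetric.
  · have hev : ∀ᶠ n in l, log ((1 - z.2 j) / 2) / B n ≤ (mk' (x n)).sq m j - (-A n / B n) := by
      have : ∀ᶠ n in l, (x n).2 j < (1 + z.2 j) / 2 :=
        (hxj j).eventually (eventually_lt_nhds (by linarith))
      filter_upwards [this] with n hn
      rw [← hlim n j hj]
      refine div_le_div_of_nonneg_right ?_ (hB n)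
      have h2 : log ((1 - z.2 j) / 2) ≤ log (1 - (x n).2 j) :=
        Real.log_le_log (by linarith) (by linarith)
      have h3 : log ((x n).2 j) ≤ 0 := Real.log_nonpos (hv n j).1.le (hv n j).2.le
      simp only [slope]; linarith
    have := le_of_tendsto_of_tendsto (hconst _) ((hsq j).sub hlamlim) hev
    linarith
  · have hev : ∀ᶠ n in l, (mk' (x n)).sq m j - (-A n / B n) ≤ -log (z.2 j / 2) / B n := by
      have : ∀ᶠ n in l, z.2 j / 2 < (x n).2 j :=
        (hxj j).eventually (eventually_gt_nhds (by linarith))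
      filter_upwards [this] with n hn
      rw [← hlim n j hj]
      refine div_le_div_of_nonneg_right ?_ (hB n)
      have h2 : log (z.2 j / 2) ≤ log ((x n).2 j) :=
        Real.log_le_log (by linarith) (by linarith)
      have h3 : log (1 - (x n).2 j) ≤ 0 :=
        Real.log_nonpos (by linarith [(hv n j).2]) (by linarith [(hv n j).1])
      simp only [slope]; linarith
    have := le_of_tendsto_of_tendsto ((hsq j).sub hlamlim) (hconst _) hev
    linarith
  -- The entropy derivative in c stays bounded, so it disappears from the mass equation after
  -- division by B.
  · have h1 : Tendsto (fun n => (mk' (x n)).entC m / B n) l (𝓝 0) :=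
      (((continuous_entC m).tendsto z).comp hx).div_atTop hBtop
    have h2 : Tendsto (fun n => -(-A n / B n) / 2 * (mk' (x n)).edgeC m +
        1 / 6 * (mk' (x n)).triC m) l
        (𝓝 (-lam / 2 * (mk' z).edgeC m + 1 / 6 * (mk' z).triC m)) :=
      ((hlamlim.neg.div_const 2).mul (((continuous_edgeC m).tendsto z).comp hx)).add
        ((((continuous_triC m).tendsto z).comp hx).const_mul (1 / 6))
    have h3 : ∀ n, (mk' (x n)).entC m / B n = -(-A n / B n) / 2 * (mk' (x n)).edgeC m +
        1 / 6 * (mk' (x n)).triC m := by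
      intro n
      have := (hlarge n).2.1.ne'
      rw [hnode n]; field_simp
    rw [tendsto_congr h3] at h1
    have := tendsto_nhds_unique h1 h2
    linarith

/-! ### Solving the first order conditions for triangles alone. -/

/-- The degenerate first order system, for two podes. -/
theorem degenerate_one {c q a d b lam : ℝ} (hc : 0 < c) (hq : 0 < q) (hcq : c + q = 1)
    (ha0 : 0 ≤ a) (ha1 : a ≤ 1) (hd0 : 0 ≤ d) (hd1 : d ≤ 1) (hb0 : 0 ≤ b) (hb1 : b ≤ 1)
    (hlam : lam = c * a ^ 2 + q * d ^ 2)
    (hD1 : d < 1 → lam ≤ d * (c * a + q * b)) (hD0 : 0 < d → d * (c * a + q * b) ≤ lam)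
    (hB1 : b < 1 → lam ≤ c * d ^ 2 + q * b ^ 2) (hB0 : 0 < b → c * d ^ 2 + q * b ^ 2 ≤ lam)
    (hV : c * a * lam + q * d * (d * (c * a + q * b)) - c * d * (d * (c * a + q * b)) -
      q * b * (c * d ^ 2 + q * b ^ 2) = 2 * lam * (c * a + q * d - c * d - q * b))
    (hfree : 0 < a → a < 1 → c * d ^ 2 + q * b ^ 2 = lam → b = a)
    (hconst : ¬(a = d ∧ b = d)) (hA : ¬(c = q ∧ a = b)) :
    0 < a ∧ a < 1 ∧ d = 1 ∧ b = 0 ∧ q < c := by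
  rcases hd0.eq_or_lt with rfl | hd0'
  · exfalso
    have h1 := hD1 one_pos
    have h2 : a = 0 := by
      have : c * a ^ 2 ≤ 0 := by linarith
      by_contra h
      have : 0 < c * a ^ 2 := by positivity
      linarith
    subst h2
    rcases hb0.eq_or_lt with rfl | hb
    · exact hconst ⟨rfl, rfl⟩
    · have h3 := hB0 hb
      have : 0 < q * b ^ 2 := by positivity
      linarith
  rcases hd1.lt_or_eq with hd1' | rfl
  · exfalso
    have hD := le_antisymm (hD0 hd0') (hD1 hd1')
    have hlam0 : 0 < lam := by rw [hlam]; positivity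
    rw [hD] at hV
    rcases hb0.eq_or_lt with rfl | hb0'
    · have h1 : lam * (c * a + q * d - c * d) = 0 := by linear_combination -hV
      have h2 := (mul_eq_zero.1 h1).resolve_left hlam0.ne'
      have h3 : q * d * (a - d) = 0 := by
        linear_combination a * h2 + hD + hlam
      rcases mul_eq_zero.1 h3 with h4 | h4
      · exact (mul_pos hq hd0').ne' h4
      · have : a = d := by linarith
        subst this
        have := mul_pos hq hd0'
        linarith
    rcases hb1.lt_or_eq with hb1' | rfl
    · have hB := le_antisymm (hB0 hb0') (hB1 hb1')
      -- With b and d both interior, all conditions are equalities with λ; eliminating b - d forces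
      -- a = d or ab = d², and both contradict non-constancy.
      have e1 : c * a * (a - d) = q * d * (b - d) := by linear_combination hlam - hD -2 * hlam
      have e2 : q * b * (b - d) = c * d * (a - d) := by linear_combination hB - hD
      have e3 : c * (a * b - d ^ 2) * (a - d) = 0 := by linear_combination b * e1 + d * e2
      by_cases had : a = d
      · subst had
        have : q * b * (b - a) = 0 := by linear_combination e2
        rcases mul_eq_zero.1 this with h | h
        · exact (mul_pos hq hb0').ne' h
        · exact hconst ⟨rfl, by linarith⟩
      · have had' : a - d ≠ 0 := sub_ne_zero.2 had
        have e4 := (mul_eq_zero.1 ((mul_eq_zero.1 e3).resolve_right had')).resolve_left hc.ne'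
        have e5 : (c * a ^ 2 + q * d ^ 2) * (a - d) = 0 := by
          linear_combination a * e1 + q * d * e4
        have := (mul_eq_zero.1 e5).resolve_right had'
        linarith
    · have hB := hB0 one_pos
      have h1 : q * (c * d ^ 2 + q * 1 ^ 2) = lam * (2 * q + c * d - c * a - q * d) := by
        linear_combination -hV
      have h2 : lam * (q + c * d - c * a - q * d) ≤ 0 := by nlinarith
      have h3 : q * (1 - d) ≤ c * (a - d) := by
        by_contra h
        have : 0 < lam * (q + c * d - c * a - q * d) := mul_pos hlam0 (by linarith)
        linarith
      have e1 : c * a * (a - d) = q * d * (1 - d) := by linear_combination -hD - hlam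
      have h4 : 0 < q * (1 - d) := mul_pos hq (by linarith)
      have h5 : a * (q * (1 - d)) ≤ d * (q * (1 - d)) := by nlinarith
      have h6 := le_of_mul_le_mul_right h5 h4
      nlinarith
  have hDle := hD0 one_pos
  rcases ha1.lt_or_eq with ha1' | rfl
  · rcases hb1.lt_or_eq with hb1' | rfl
    · rcases hb0.eq_or_lt with rfl | hb0'
      · have hB := hB1 one_pos
        rcases ha0.eq_or_lt with rfl | ha0'
        · exfalso
          have h1 : q * (q - c) = 0 := by rw [hlam] at hV; linear_combination -hV/2
          have := (mul_eq_zero.1 h1).resolve_left hq.ne'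
          exact hA ⟨by linarith, rfl⟩
        · refine ⟨ha0', ha1', rfl, rfl, ?_⟩
          have : 0 < c * a ^ 2 := by positivity
          linarith
      · exfalso
        have hB := le_antisymm (hB0 hb0') (hB1 hb1')
        rcases ha0.eq_or_lt with rfl | ha0'
        · have h1 : c = q * (1 - b ^ 2) := by linear_combination hB + hlam
          have h2 : lam = q := by linear_combination hlam
          rw [hB, h2, h1] at hV
          have h3 : q ^ 2 * b * (1 - b) ^ 2 = 0 := by linear_combination hV
          have : 0 < q ^ 2 * b * (1 - b) ^ 2 := by
            have := sub_pos.2 hb1'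
            positivity
          linarith
        · have h1 := hfree ha0' ha1' hB
          subst h1
          have h2 : (c - q) * (1 - b ^ 2) = 0 := by linear_combination hB + hlam
          have h3 : 1 - b ^ 2 ≠ 0 := by nlinarith
          exact hA ⟨by linarith [(mul_eq_zero.1 h2).resolve_right h3], rfl⟩
    · exfalso
      have hB := hB0 one_pos
      have : c * a ^ 2 < c := by nlinarith
      linarith
  · exfalso
    rcases hb1.lt_or_eq with hb1' | rfl
    · have hB := hB1 hb1'
      have : q * b ^ 2 < q := by nlinarith
      linarith
    · exact hconst ⟨rfl, rfl⟩

set_option maxHeartbeats 800000 in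
/-- The degenerate first order system, for a second group of at least two podes. -/
theorem degenerate_two {c q k a d b p lam : ℝ} (hk : 2 ≤ k) (hc : 0 < c) (hq : 0 < q)
    (hcq : c + k * q = 1)
    (ha0 : 0 ≤ a) (ha1 : a ≤ 1) (hd0 : 0 ≤ d) (hd1 : d ≤ 1) (hb0 : 0 ≤ b) (hb1 : b ≤ 1)
    (hp0 : 0 ≤ p) (hp1 : p ≤ 1)
    (hlam : lam = c * a ^ 2 + k * q * d ^ 2) {D B P : ℝ}
    (hDdef : D = d * (c * a + q * (b + (k - 1) * p)))
    (hBdef : B = c * d ^ 2 + q * (b ^ 2 + (k - 1) * p ^ 2))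
    (hPdef : P = c * d ^ 2 + q * (2 * b * p + (k - 2) * p ^ 2))
    (hD1 : d < 1 → lam ≤ D) (hD0 : 0 < d → D ≤ lam)
    (hB1 : b < 1 → lam ≤ B) (hB0 : 0 < b → B ≤ lam)
    (hP1 : p < 1 → lam ≤ P) (hP0 : 0 < p → P ≤ lam)
    (hV : c * a * lam + k * q * d * D - c * d * D - q * (b * B + (k - 1) * p * P) =
      2 * lam * (c * a + k * q * d - c * d - q * (b + (k - 1) * p)))
    (hfree : 0 < a → a < 1 → (B = lam → b = a) ∧ (P = lam → p = a))
    (hbp : b ≠ p) (hA : ¬(c = q ∧ a = b ∧ d = p)) :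
    (k = 2 ∧ a = 0 ∧ d = 0 ∧ b = 0 ∧ 0 < p) ∨
      (0 < a ∧ a < 1 ∧ d = 1 ∧ b = 0 ∧ ((p = 1 ∧ q < c) ∨ (p = a ∧ k * q ≤ c))) := by
  -- Hence P < B strictly. Since B ≤ λ if b > 0 and λ ≤ P if p < 1, either b = 0 or p = 1.
  have hBP : B - P = q * (b - p) ^ 2 := by rw [hBdef, hPdef]; ring
  have hBP' : 0 < q * (b - p) ^ 2 := by have := sub_ne_zero.2 hbp; positivity
  have hk0 : 0 < k := by linarith
  have hdz : d = 0 → a = 0 ∧ lam = 0 := by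
    rintro rfl
    have h1 := hD1 one_pos
    have : a = 0 := by
      by_contra h
      have : 0 < c * a ^ 2 := by positivity
      linarith
    subst this
    exact ⟨rfl, by rw [hlam]; ring⟩
  have hlampos : 0 < d → 0 < lam := by
    intro hd
    rw [hlam]; positivity
  rcases hp1.lt_or_eq with hp1' | rfl
  · have hlP := hP1 hp1'
    have hb : b = 0 := by
      by_contra h
      have := hB0 (lt_of_le_of_ne hb0 (Ne.symm h))
      linarith
    subst hb
    have hp0' : 0 < p := lt_of_le_of_ne hp0 hbp
    have hP := le_antisymm (hP0 hp0') hlP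
    rcases hd0.eq_or_lt with rfl | hd0'
    · obtain ⟨rfl, h2⟩ := hdz rfl
      left
      refine ⟨?_, rfl, rfl, rfl, hp0'⟩
      have : (k - 2) * (q * p ^ 2) = 0 := by linear_combination hP - hPdef + h2
      have h3 : q * p ^ 2 ≠ 0 := by positivity
      linarith [(mul_eq_zero.1 this).resolve_right h3]
    rcases hd1.lt_or_eq with hd1' | rfl
    · exfalso
      have hD := le_antisymm (hD0 hd0') (hD1 hd1')
      have hl := hlampos hd0'
      rw [hD, hP] at hV
      have h1 : lam * (c * a + k * q * d - c * d - q * ((k - 1) * p)) = 0 := by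
        linear_combination -hV
      have h2 := (mul_eq_zero.1 h1).resolve_left hl.ne'
      have h3 : c * (d - a) ^ 2 = 0 := by
        linear_combination -hD - hlam + hDdef - d * h2
      have h4 : a = d := by
        have := (mul_eq_zero.1 h3).resolve_left hc.ne'
        have := pow_eq_zero_iff (two_ne_zero) |>.1 this
        linarith
      subst h4
      have h5 : k * a - (k - 1) * p = 0 := by
        have : q * (k * a - (k - 1) * p) = 0 := by linear_combination h2
        exact (mul_eq_zero.1 this).resolve_left hq.ne'
      have h6 : q * p ^ 2 = 0 := by
        linear_combination k * (hPdef - hP - hlam) - q * (k * a + (k - 1) * p) * h5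
      have : 0 < q * p ^ 2 := by positivity
      linarith
    · rcases ha1.lt_or_eq with ha1' | rfl
      · rcases ha0.eq_or_lt with rfl | ha0'
        · exfalso
          have e1 : c = k * q - q * (k - 2) * p ^ 2 := by linear_combination hP + hlam - hPdef
          have e2 : lam = k * q := by linear_combination hlam
          rw [hP, hDdef, e2, e1] at hV
          have h1 : q ^ 2 * p * (k * (k - 1) - (k - 2) * p * (2 * k - (k - 1) * p)) = 0 := by
            linear_combination hV
          have h2 : 0 < k * (k - 1) - (k - 2) * p * (2 * k - (k - 1) * p) := by
            have h3 : 0 ≤ (k - 2) * ((1 - p) * (k + 1 - (k - 1) * p)) := by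
              refine mul_nonneg (by linarith) (mul_nonneg (by linarith) ?_)
              nlinarith
            nlinarith
          have : 0 < q ^ 2 * p * (k * (k - 1) - (k - 2) * p * (2 * k - (k - 1) * p)) := by
            positivity
          linarith
        · right
          refine ⟨ha0', ha1', rfl, rfl, Or.inr ?_⟩
          have hpa := (hfree ha0' ha1').2 hP
          refine ⟨hpa, ?_⟩
          subst hpa
          have e1 : (c - k * q) * (1 - p ^ 2) = 2 * q * p ^ 2 := by
            linear_combination hP - hPdef + hlam
          have h2 : 0 < 1 - p ^ 2 := by nlinarith
          by_contra h
          have : (c - k * q) * (1 - p ^ 2) < 0 := mul_neg_of_neg_of_pos (by linarith) h2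
          have : 0 ≤ 2 * q * p ^ 2 := by positivity
          linarith
      · exfalso
        have h1 : (k - 2) * p ^ 2 ≤ k - 2 := by
          have : p ^ 2 ≤ 1 := by nlinarith
          nlinarith
        nlinarith
  · have hb1' : b < 1 := lt_of_le_of_ne hb1 hbp
    have hlB := hB1 hb1'
    have hPl := hP0 one_pos
    have hbB : b * (B - lam) = 0 := by
      rcases hb0.eq_or_lt with rfl | h
      · simp
      · rw [le_antisymm (hB0 h) hlB]; ring
    rcases hd0.eq_or_lt with rfl | hd0'
    · obtain ⟨rfl, h2⟩ := hdz rfl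
      left
      have h3 : q * (2 * b + (k - 2)) ≤ 0 := by linarith
      have h4 : 2 * b + (k - 2) ≤ 0 := by
        by_contra h
        have := mul_pos hq (not_le.1 h)
        linarith
      exact ⟨by linarith, rfl, rfl, by linarith, one_pos⟩
    rcases hd1.lt_or_eq with hd1' | rfl
    · exfalso
      have hD := le_antisymm (hD0 hd0') (hD1 hd1')
      have hl := hlampos hd0'
      rw [hD] at hV
      -- In these variables D = λ reads a·u = d·w, and the mass equation gives u ≤ w because P ≤ λ.
      -- As u has the sign of d - a, both are possible only if a = d.
      obtain ⟨u, hu⟩ : ∃ u, u = c * (d - a) := ⟨_, rfl⟩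
      obtain ⟨w, hw⟩ : ∃ w, w = q * (k * d - b - k + 1) := ⟨_, rfl⟩
      have e1 : a * u = d * w := by rw [hu, hw]; linear_combination -hDdef + hD + hlam
      have e2 : lam * (w - u) = q * (k - 1) * (lam - P) := by
        rw [hu, hw]; linear_combination -hV - q * hbB
      have huw : u ≤ w := by
        have : 0 ≤ lam * (w - u) := by
          rw [e2]
          exact mul_nonneg (mul_nonneg hq.le (by linarith)) (by linarith)
        linarith [nonneg_of_mul_nonneg_right this hl]
      have had : a = d := by
        rcases lt_trichotomy a d with h | h | h
        · have h1 : 0 < u := by rw [hu]; exact mul_pos hc (by linarith)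
          have h2 : a * u < d * u := mul_lt_mul_of_pos_right h h1
          have h3 : d * u ≤ d * w := mul_le_mul_of_nonneg_left huw hd0
          linarith
        · exact h
        · have h1 : u < 0 := by rw [hu]; exact mul_neg_of_pos_of_neg hc (by linarith)
          have h2 : a * u < d * u := mul_lt_mul_of_neg_right h h1
          have h3 : d * u ≤ d * w := mul_le_mul_of_nonneg_left huw hd0
          linarith
      subst had
      have hu0 : u = 0 := by rw [hu]; ring
      have hw0 : w = 0 := by
        rw [hu0, mul_zero] at e1
        exact (mul_eq_zero.1 e1.symm).resolve_left hd0'.ne'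
      rw [hw0, hu0, sub_zero, mul_zero] at e2
      have h3 : P = lam := by
        have h4 : q * (k - 1) ≠ 0 := (mul_pos hq (by linarith)).ne'
        linarith [(mul_eq_zero.1 e2.symm).resolve_left h4]
      have h5 : q * k * (1 - a) ^ 2 = 0 := by
        linear_combination hPdef - h3 - hlam + 2 * (hw - hw0)
      have : 0 < q * k * (1 - a) ^ 2 := by
        have := sub_pos.2 hd1'
        positivity
      linarith
    · rcases ha1.lt_or_eq with ha1' | rfl
      · rcases hb0.eq_or_lt with rfl | hb0'
        · rcases ha0.eq_or_lt with rfl | ha0'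
          · exfalso
            rw [hDdef, hPdef, hlam] at hV
            have : 2 * q * (q - c) = 0 := by linear_combination -hV
            have := (mul_eq_zero.1 this).resolve_left (by positivity)
            exact hA ⟨by linarith, rfl, rfl⟩
          · right
            refine ⟨ha0', ha1', rfl, rfl, Or.inl ⟨rfl, ?_⟩⟩
            have : 0 < c * a ^ 2 := by positivity
            linarith
        · exfalso
          have hB := le_antisymm (hB0 hb0') hlB
          rcases ha0.eq_or_lt with rfl | ha0'
          · have e1 : c = q * (1 - b ^ 2) := by linear_combination hB - hBdef + hlam
            rw [hB, hDdef, hPdef, hlam, e1] at hV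
            have h1 : q ^ 2 * (b * (1 - b) ^ 2) = 0 := by linear_combination hV
            have : 0 < q ^ 2 * (b * (1 - b) ^ 2) := by
              have := sub_pos.2 hb1'
              positivity
            linarith
          · have hba := (hfree ha0' ha1').1 hB
            subst hba
            have h2 : (c - q) * (1 - b ^ 2) = 0 := by linear_combination hB - hBdef + hlam
            have h3 : 1 - b ^ 2 ≠ 0 := by nlinarith
            exact hA ⟨by linarith [(mul_eq_zero.1 h2).resolve_right h3], rfl, rfl⟩
      · exfalso
        have : q * b ^ 2 < q := by nlinarith
        nlinarith

/-! ### Entropy against triangles: the splitting argument. -/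

/-- No shape with fewer triangles has more entropy. -/
def WeakExtremal (m : ℕ) (ε τ S : ℝ) : Prop :=
  ∀ θ : Shape, θ.Valid → 0 < θ.c → θ.a₁ ∈ Ioo (0 : ℝ) 1 → θ.edge m = ε → θ.tri m < τ → θ.ent m ≤ S

/-- A competitor at the limit has edge density ε rather than `e n`. Its first block has weight c²/2,
so shifting a₁ by 2(e n - ε)/c² repairs this, which needs c > 0 and a₁ interior. The strict
inequality for triangles absorbs the perturbation. -/
theorem weakExtremal_of_tendsto {m : ℕ} {l : Filter ℕ} [l.NeBot] {e t s : ℕ → ℝ} {ε τ S : ℝ}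
    (he : Tendsto e l (𝓝 ε)) (ht : Tendsto t l (𝓝 τ)) (hs : Tendsto s l (𝓝 S))
    (hE : ∀ n, Extremal m (e n) (t n) (s n)) : WeakExtremal m ε τ S := by
  intro θ hθ hc ha hedge htri
  set v : ℕ → Fin 5 → ℝ := fun n => Function.update θ.val 0 (θ.a₁ + 2 * (e n - ε) / θ.c ^ 2)
  set x : ℕ → ℝ × (Fin 5 → ℝ) := fun n => (θ.c, v n)
  have ha' : Tendsto (fun n => θ.a₁ + 2 * (e n - ε) / θ.c ^ 2) l (𝓝 θ.a₁) := by
    have := (((he.sub_const ε).const_mul 2).div_const (θ.c ^ 2)).const_add θ.a₁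
    simpa using this
  have hx : Tendsto x l (𝓝 (θ.c, θ.val)) := by
    refine Tendsto.prodMk_nhds tendsto_const_nhds (tendsto_pi_nhds.2 fun j => ?_)
    rcases eq_or_ne j 0 with rfl | hj
    · simp only [v, Function.update_self]; exact ha'
    · simp [v, hj]
  have hz : mk' (θ.c, θ.val) = θ := rfl
  have hT := ((continuous_tri m).tendsto (θ.c, θ.val)).comp hx
  have hS := ((continuous_ent m).tendsto (θ.c, θ.val)).comp hx
  rw [hz] at hT hS
  have h1 : ∀ᶠ n in l, (mk' (x n)).tri m < t n := hT.eventually_lt ht htri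
  have h2 : ∀ᶠ n in l, θ.a₁ + 2 * (e n - ε) / θ.c ^ 2 ∈ Icc (0 : ℝ) 1 :=
    ha'.eventually_mem (Icc_mem_nhds ha.1 ha.2)
  refine le_of_tendsto_of_tendsto hS hs ?_
  filter_upwards [h1, h2] with n hn1 hn2
  refine (hE n).ent_le _ (valid_ofVal hθ.c fun j => ?_) ?_ hn1.le
  · rcases eq_or_ne j 0 with rfl | hj
    · simpa [x, v] using hn2
    · simpa [x, v, hj] using hθ.val_mem j
  · have : (mk' (x n)).edge m = θ.edge m + (e n - ε) := by
      simp [edge, mk', ofVal, x, v, val]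
      field_simp
      ring
    rw [this, hedge]; ring

/-- Second differences of the entropy. -/
theorem binEntropy_second_difference {A r : ℝ} (hr : 0 ≤ r) (h0 : r < A) (h1 : A + r < 1) :
    -(2 * r ^ 2 * (A⁻¹ + (1 - A)⁻¹)) ≤
      binEntropy (A - r) + binEntropy (A + r) - 2 * binEntropy A := by
  have key : ∀ x : ℝ, r < x → -(2 * r ^ 2 * x⁻¹) ≤
      Real.negMulLog (x - r) + Real.negMulLog (x + r) - 2 * Real.negMulLog x := by
    intro x hx
    have hx0 : 0 < x := by linarith
    have e1 := Real.log_le_sub_one_of_pos (div_pos (by linarith : 0 < x + r) hx0)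
    have e2 := Real.log_le_sub_one_of_pos (div_pos (by linarith : 0 < x - r) hx0)
    rw [Real.log_div (by linarith) hx0.ne'] at e1 e2
    have e3 := mul_le_mul_of_nonneg_left e1 (by linarith : 0 ≤ x + r)
    have e4 := mul_le_mul_of_nonneg_left e2 (by linarith : 0 ≤ x - r)
    have e5 : (x + r) * ((x + r) / x - 1) + (x - r) * ((x - r) / x - 1) = 2 * r ^ 2 * x⁻¹ := by
      field_simp; ring
    simp only [Real.negMulLog]
    linarith
  have k1 := key A h0
  have k2 := key (1 - A) (by linarith)
  simp only [Real.binEntropy_eq_negMulLog_add_negMulLog_one_sub]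
  have r1 : 1 - (A - r) = 1 - A + r := by ring
  have r2 : 1 - (A + r) = 1 - A - r := by ring
  rw [r1, r2]
  linarith

/-- A curve which gains entropy at first order and triangles only at second order contradicts
extremality, because splitting the first pode loses triangles at third order at a cost in entropy
of second order. -/
theorem WeakExtremal.no_curve {m : ℕ} {θ : Shape} (hc : 0 < θ.c) (ha : θ.a₁ ∈ Ioo (0 : ℝ) 1)
    (hW : WeakExtremal m (θ.edge m) (θ.tri m) (θ.ent m))
    {c : ℝ → ℝ} {v : Fin 5 → ℝ → ℝ} {C σ₀ : ℝ} (hσ : 0 < σ₀)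
    (hc0 : Tendsto c (𝓝[>] 0) (𝓝 θ.c)) (ha0 : Tendsto (v 0) (𝓝[>] 0) (𝓝 θ.a₁))
    (hsymm : ∀ t, v 0 t = v 1 t)
    (hvalid : ∀ᶠ t in 𝓝[>] (0 : ℝ), (ofVal (c t) fun j => v j t).Valid)
    (hedge : ∀ᶠ t in 𝓝[>] (0 : ℝ), (ofVal (c t) fun j => v j t).edge m = θ.edge m)
    (htri : ∀ᶠ t in 𝓝[>] (0 : ℝ), (ofVal (c t) fun j => v j t).tri m ≤ θ.tri m + C * t ^ 2)
    (hent : ∀ᶠ t in 𝓝[>] (0 : ℝ), θ.ent m + σ₀ * t ≤ (ofVal (c t) fun j => v j t).ent m) :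
    False := by
  set a := θ.a₁
  -- With κ this small, the at most Cκ²r⁶ triangles added by the curve are outweighed by those the
  -- split removes, as the mass stays above half of `θ.c`.
  obtain ⟨κ, hκ, hκC⟩ : ∃ κ : ℝ, 0 < κ ∧ C * κ ^ 2 < (θ.c / 2) ^ 3 := by
    have h1 : Tendsto (fun κ : ℝ => C * κ ^ 2) (𝓝[>] 0) (𝓝 0) := by
      have : Continuous fun κ : ℝ => C * κ ^ 2 := by fun_prop
      simpa using (this.tendsto 0).mono_left nhdsWithin_le_nhds
    have h2 := (h1.eventually (eventually_lt_nhds (by positivity : 0 < (θ.c / 2) ^ 3))).and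
      self_mem_nhdsWithin
    obtain ⟨κ, h3, h4⟩ := h2.exists
    exact ⟨κ, h4, h3⟩
  set K := (a / 2)⁻¹ + ((1 - a) / 2)⁻¹ with hK
  have ha1 : 0 < a := ha.1
  have ha2 : 0 < 1 - a := sub_pos.2 ha.2
  have hK0 : 0 < K := by positivity
  have ht : Tendsto (fun r : ℝ => κ * r ^ 3) (𝓝[>] 0) (𝓝[>] 0) := by
    refine tendsto_nhdsWithin_iff.2 ⟨?_, ?_⟩
    · have : Continuous fun r : ℝ => κ * r ^ 3 := by fun_prop
      simpa using (this.tendsto 0).mono_left nhdsWithin_le_nhds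
    · filter_upwards [self_mem_nhdsWithin] with r hr
      have : 0 < r := hr
      exact mem_Ioi.2 (by positivity)
  have hr2 : Tendsto (fun r : ℝ => r ^ 2) (𝓝[>] 0) (𝓝 0) := by
    have : Continuous fun r : ℝ => r ^ 2 := by fun_prop
    simpa using (this.tendsto 0).mono_left nhdsWithin_le_nhds
  have hr1 : Tendsto (fun r : ℝ => K * r) (𝓝[>] 0) (𝓝 0) := by
    have : Continuous fun r : ℝ => K * r := by fun_prop
    simpa using (this.tendsto 0).mono_left nhdsWithin_le_nhds
  have E1 := ht.eventually hvalid
  have E2 := ht.eventually hedge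
  have E3 := ht.eventually htri
  have E4 := ht.eventually hent
  have E5 := (hc0.comp ht).eventually (eventually_gt_nhds (by linarith : θ.c / 2 < θ.c))
  have E6 := (ha0.comp ht).eventually (eventually_gt_nhds (by linarith : a / 2 < a))
  have E7 := (ha0.comp ht).eventually (eventually_lt_nhds (by linarith : a < (1 + a) / 2))
  have E8 := hr2.eventually (eventually_lt_nhds (by positivity : 0 < a / 2))
  have E9 := hr2.eventually (eventually_lt_nhds (by positivity : 0 < (1 - a) / 2))
  have E10 := hr1.eventually (eventually_lt_nhds (by positivity : 0 < σ₀ * κ))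
  obtain ⟨r, h1, h2, h3, h4, h5, h6, h7, h8, h9, h10, hr⟩ := (E1.and (E2.and (E3.and (E4.and
    (E5.and (E6.and (E7.and (E8.and (E9.and (E10.and self_mem_nhdsWithin)))))))))).exists
  have hr : 0 < r := hr
  simp only [Function.comp_apply] at h5 h6 h7
  -- Splitting by r² removes c³r⁶ triangles and costs at most K·r⁴ of entropy; moving along the
  -- curve to t = κr³ changes triangles at order r⁶ but gains entropy of order r³.
  set t := κ * r ^ 3 with htdef
  have hs := hsymm t
  set A := v 0 t with hA
  set γ : Shape := ofVal (c t) fun j => v j t with hγ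
  have hγc : γ.c = c t := rfl
  have hγ1 : γ.a₁ = A := rfl
  have hγ2 : γ.a₂ = A := hs.symm
  set δ : Shape := ⟨γ.c, A - r ^ 2, A + r ^ 2, γ.d, γ.b, γ.p⟩ with hδ
  have hδv : δ.Valid := ⟨h1.c, ⟨by simp only [δ]; linarith, by simp only [δ]; linarith [sq_nonneg r]⟩,
    ⟨by simp only [δ]; linarith [sq_nonneg r], by simp only [δ]; linarith⟩, h1.d, h1.b, h1.p⟩
  have hδedge : δ.edge m = γ.edge m := by
    simp only [edge, δ, hγ1, hγ2]; ring
  have hδtri : δ.tri m = γ.tri m - γ.c ^ 3 * r ^ 6 := by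
    simp only [tri, δ, hγ1, hγ2]; ring
  have hδent : δ.ent m = γ.ent m +
      γ.c ^ 2 / 4 * (binEntropy (A - r ^ 2) + binEntropy (A + r ^ 2) - 2 * binEntropy A) := by
    simp only [ent, δ, hγ1, hγ2]; ring
  have hr6 : 0 < r ^ 6 := by positivity
  have hcube : (θ.c / 2) ^ 3 ≤ γ.c ^ 3 := pow_le_pow_left₀ (by positivity) h5.le 3
  have hcon := hW δ hδv (by simp only [δ, hγc]; linarith)
    ⟨by simp only [δ]; linarith, by simp only [δ]; linarith [sq_nonneg r]⟩ (hδedge.trans h2) (by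
      rw [hδtri]
      have e1 : C * t ^ 2 = (C * κ ^ 2) * r ^ 6 := by rw [htdef]; ring
      have e2 := mul_lt_mul_of_pos_right (hκC.trans_le hcube) hr6
      linarith)
  have hsd := binEntropy_second_difference (A := A) (r := r ^ 2) (by positivity) (by linarith)
    (by linarith)
  have hinv : A⁻¹ + (1 - A)⁻¹ ≤ K := by
    rw [hK]
    refine add_le_add ?_ ?_
    · exact inv_anti₀ (by positivity) h6.le
    · exact inv_anti₀ (by positivity) (by linarith)
  have hinv0 : 0 ≤ A⁻¹ + (1 - A)⁻¹ := by
    have : 0 < A := by linarith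
    have : 0 < 1 - A := by linarith
    positivity
  have hc1 : γ.c ^ 2 ≤ 1 := pow_le_one₀ h1.c.1 h1.c.2
  have e3 : -(r ^ 4 * K) ≤
      γ.c ^ 2 / 4 * (binEntropy (A - r ^ 2) + binEntropy (A + r ^ 2) - 2 * binEntropy A) := by
    have e4 := mul_le_mul_of_nonneg_left hsd (by positivity : 0 ≤ γ.c ^ 2 / 4)
    have e5 : γ.c ^ 2 / 4 * (2 * (r ^ 2) ^ 2 * (A⁻¹ + (1 - A)⁻¹)) ≤ 1 * (r ^ 4 * K) := by
      have : γ.c ^ 2 / 4 * (2 * (r ^ 2) ^ 2 * (A⁻¹ + (1 - A)⁻¹)) =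
        (γ.c ^ 2 / 2) * (r ^ 4 * (A⁻¹ + (1 - A)⁻¹)) := by ring
      rw [this]
      refine mul_le_mul (by linarith) (mul_le_mul_of_nonneg_left hinv (by positivity))
        (by positivity) zero_le_one
    linarith
  have e6 : r ^ 4 * K < σ₀ * t := by
    have : r ^ 3 * (K * r) < r ^ 3 * (σ₀ * κ) := mul_lt_mul_of_pos_left h10 (by positivity)
    rw [htdef]
    calc r ^ 4 * K = r ^ 3 * (K * r) := by ring
      _ < r ^ 3 * (σ₀ * κ) := this
      _ = σ₀ * (κ * r ^ 3) := by ring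
  rw [hδent] at hcon
  linarith

/-- First order Taylor formula with remainder on [0,1]; it supplies the triangle bound that
`WeakExtremal.no_curve` requires. -/
theorem le_add_sq_of_deriv_eq_zero {f : ℝ → ℝ} (hf : ContDiffOn ℝ 2 f (Icc 0 1))
    (h0 : HasDerivAt f 0 0) : ∃ C, ∀ᶠ t in 𝓝[>] (0 : ℝ), f t ≤ f 0 + C * t ^ 2 := by
  obtain ⟨C, hC⟩ := exists_taylor_mean_remainder_bound (n := 1) (zero_le_one' ℝ)
    (by norm_num; exact hf)
  refine ⟨C, ?_⟩
  have h2 : ∀ᶠ t in 𝓝[>] (0 : ℝ), t < 1 := nhdsWithin_le_nhds (eventually_lt_nhds one_pos)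
  filter_upwards [h2, self_mem_nhdsWithin] with t ht1 ht0
  have h3 := hC t ⟨le_of_lt ht0, ht1.le⟩
  have h4 : derivWithin f (Icc 0 1) 0 = 0 :=
    h0.hasDerivWithinAt.derivWithin (uniqueDiffOn_Icc one_pos 0 (by simp))
  rw [taylorWithinEval_succ, taylor_within_zero_eval] at h3
  simp only [iteratedDerivWithin_one, zero_add, h4, sub_zero, smul_zero, add_zero] at h3
  have := le_abs_self (f t - f 0)
  rw [Real.norm_eq_abs] at h3
  norm_num at h3
  linarith

/-- No entropy can be gained by moving the block values along a null direction. -/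
theorem WeakExtremal.no_direction {m : ℕ} (hm : 1 ≤ m) {θ : Shape} (hθ : θ.Valid) (hc : 0 < θ.c)
    (ha : θ.a₁ ∈ Ioo (0 : ℝ) 1) (haa : θ.a₁ = θ.a₂)
    (hW : WeakExtremal m (θ.edge m) (θ.tri m) (θ.ent m)) {k : Fin 5 → ℝ} (hk : k 0 = k 1)
    (hk01 : ∀ j, θ.val j + k j ∈ Icc (0 : ℝ) 1) (he : ∑ j, θ.wt m j * k j = 0)
    (ht : ∑ j, θ.wt m j * (θ.sq m j * k j) = 0) :
    (ofVal θ.c fun j => θ.val j + k j).ent m ≤ θ.ent m := by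
  by_contra! hlt
  set c : ℝ → ℝ := fun _ => θ.c
  set v : Fin 5 → ℝ → ℝ := fun j t => θ.val j + t * k j with hv
  have hv0 : ∀ j, v j 0 = θ.val j := fun j => by simp [v]
  have hv' : ∀ j, HasDerivAt (v j) (k j) 0 := fun j => by
    simpa [hv] using ((hasDerivAt_id (0 : ℝ)).mul_const (k j)).const_add (θ.val j)
  have h0 : (ofVal (c 0) fun j => v j 0) = θ := by simp only [hv0]; exact ofVal_val θ
  have hT := hasDerivAt_tri (m := m) (hasDerivAt_const 0 θ.c : HasDerivAt c 0 0) hv'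
  rw [h0, ht, zero_mul, mul_zero, add_zero] at hT
  have hcd : ContDiffOn ℝ 2 (fun t => (ofVal (c t) fun j => v j t).tri m) (Icc 0 1) := by
    refine ContDiff.contDiffOn ?_
    simp only [tri, ofVal, c, v, div_eq_mul_inv]
    fun_prop
  obtain ⟨C, hC⟩ := le_add_sq_of_deriv_eq_zero hcd hT
  simp only [h0] at hC
  have hsmall : ∀ᶠ t in 𝓝[>] (0 : ℝ), t ∈ Icc (0 : ℝ) 1 := by
    have h2 : ∀ᶠ t in 𝓝[>] (0 : ℝ), t < 1 := nhdsWithin_le_nhds (eventually_lt_nhds one_pos)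
    filter_upwards [h2, self_mem_nhdsWithin] with t ht1 ht0 using ⟨le_of_lt ht0, ht1.le⟩
  have hconv : ∀ j t, v j t = (1 - t) * θ.val j + t * (θ.val j + k j) := fun j t => by
    simp only [v]; ring
  -- By concavity the entropy lies above its chord on the segment, so the difference of the end
  -- values serves as rate of gain, even where block values are 0 or 1.
  refine hW.no_curve hc ha (c := c) (v := v) (C := C) (sub_pos.2 hlt) tendsto_const_nhds ?_ ?_ ?_
    ?_ hC ?_
  · have := (hv' 0).continuousAt.tendsto
    rw [hv0] at this
    exact this.mono_left nhdsWithin_le_nhds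
  · intro t
    have : θ.val 0 = θ.val 1 := haa
    simp only [v, hk, this]
  · filter_upwards [hsmall] with t ht
    refine valid_ofVal hθ.c fun j => ?_
    rw [hconv]
    exact convex_mem (hθ.val_mem j) (hk01 j) ht
  · refine Eventually.of_forall fun t => ?_
    have hw : (ofVal (c t) fun j => v j t).wt m = θ.wt m := rfl
    rw [edge_eq_sum, edge_eq_sum, hw]
    have : ∀ j, θ.wt m j * (ofVal (c t) fun j => v j t).val j =
        θ.wt m j * θ.val j + t * (θ.wt m j * k j) := fun j => by
      rw [val_ofVal]; simp only [v]; ring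
    simp only [this, Finset.sum_add_distrib, ← Finset.mul_sum, he]
    ring
  · filter_upwards [hsmall] with t ht
    have hw : (ofVal (c t) fun j => v j t).wt m = θ.wt m := rfl
    have hw1 : (ofVal θ.c fun j => θ.val j + k j).wt m = θ.wt m := rfl
    have h1 : ∀ j, (1 - t) * (θ.wt m j * binEntropy (θ.val j)) +
        t * (θ.wt m j * binEntropy ((ofVal θ.c fun j => θ.val j + k j).val j)) ≤
        θ.wt m j * binEntropy ((ofVal (c t) fun j => v j t).val j) := by
      intro j
      rw [val_ofVal, val_ofVal, hconv]
      have := mul_le_mul_of_nonneg_left (binEntropy_convex (hθ.val_mem j) (hk01 j) ht)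
        (wt_nonneg hm hθ j)
      linarith
    have h2 := Finset.sum_le_sum fun j (_ : j ∈ Finset.univ) => h1 j
    rw [Finset.sum_add_distrib, ← Finset.mul_sum, ← Finset.mul_sum] at h2
    rw [ent_eq_sum m (ofVal (c t) fun j => v j t), ent_eq_sum m (ofVal θ.c fun j => θ.val j + k j),
      ent_eq_sum m θ, hw, hw1]
    linarith

/-- A block with the same value of `sq` as the first pode has the same value. -/
theorem WeakExtremal.val_eq {m : ℕ} (hm : 1 ≤ m) {θ : Shape} (hθ : θ.Valid) (hc : 0 < θ.c)
    (ha : θ.a₁ ∈ Ioo (0 : ℝ) 1) (haa : θ.a₁ = θ.a₂)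
    (hW : WeakExtremal m (θ.edge m) (θ.tri m) (θ.ent m)) {j : Fin 5} (hj : 2 ≤ j)
    (hw : 0 < θ.wt m j) (hsq : θ.sq m j = θ.sq m 0) : θ.val j = θ.a₁ := by
  by_contra hne
  set a := θ.a₁ with hadef
  set w := θ.wt m j
  set u := θ.val j
  have hc2 : 0 < θ.c ^ 2 := by positivity
  -- The weighted mean of the merged pode and block j. Replacing both values by μ preserves edges,
  -- is null for triangles because the `sq` agree, and gains entropy by strict concavity.
  set μ := (θ.c ^ 2 * a + w * u) / (θ.c ^ 2 + w) with hμ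
  have hsum : 0 < θ.c ^ 2 + w := by positivity
  have h01 : θ.val 0 = a := rfl
  have h11 : θ.val 1 = a := haa.symm
  have hμeq : θ.c ^ 2 * (μ - a) + w * (μ - u) = 0 := by
    rw [hμ]; field_simp; ring
  have hμH : θ.c ^ 2 * binEntropy a + w * binEntropy u < (θ.c ^ 2 + w) * binEntropy μ := by
    have := Real.strictConcave_binEntropy.2 hθ.a₁ (hθ.val_mem j) (Ne.symm hne)
      (div_pos hc2 hsum) (div_pos hw hsum) (by field_simp)
    simp only [smul_eq_mul] at this
    have e : θ.c ^ 2 / (θ.c ^ 2 + w) * a + w / (θ.c ^ 2 + w) * u = μ := by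
      rw [hμ]; field_simp
    rw [← hadef, e] at this
    have := mul_lt_mul_of_pos_left this hsum
    have e2 : (θ.c ^ 2 + w) * (θ.c ^ 2 / (θ.c ^ 2 + w) * binEntropy a +
        w / (θ.c ^ 2 + w) * binEntropy u) = θ.c ^ 2 * binEntropy a + w * binEntropy u := by
      field_simp
    linarith
  have hμI : μ ∈ Icc (0 : ℝ) 1 := by
    have := convex_Icc (0 : ℝ) 1 hθ.a₁ (hθ.val_mem j) (div_pos hc2 hsum).le
      (div_pos hw hsum).le (by field_simp)
    simp only [smul_eq_mul] at this
    have e : θ.c ^ 2 / (θ.c ^ 2 + w) * a + w / (θ.c ^ 2 + w) * u = μ := by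
      rw [hμ]; field_simp
    rwa [← hadef, e] at this
  have hsumf : ∀ (f : Fin 5 → ℝ) (x y : ℝ),
      ∑ i, f i * (if i < 2 then x else if i = j then y else 0) = (f 0 + f 1) * x + f j * y := by
    intro f x y
    fin_cases j <;> simp_all [Fin.sum_univ_succ] <;> ring
  have hcases : ∀ i : Fin 5, i < 2 → i = 0 ∨ i = 1 := by decide
  have hwt01 : θ.wt m 0 + θ.wt m 1 = θ.c ^ 2 := by simp [wt]
  have hsq1 : θ.sq m 1 = θ.sq m 0 := by simp [sq, ← haa]; rw [← hadef]; ring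
  have hvk : ∀ i, θ.val i + (if i < 2 then μ - a else if i = j then μ - u else 0) =
      if i < 2 then μ else if i = j then μ else θ.val i := by
    intro i
    split_ifs with h1 h2
    · rcases hcases i h1 with rfl | rfl
      · rw [h01]; ring
      · rw [h11]; ring
    · subst h2; ring
    · ring
  have := hW.no_direction hm hθ hc ha haa
    (k := fun i => if i < 2 then μ - a else if i = j then μ - u else 0) (by simp)
    (fun i => by
      rw [hvk]
      split_ifs
      exacts [hμI, hμI, hθ.val_mem i])
    (by rw [hsumf, hwt01]; exact hμeq)
    (by
      simp only [← mul_assoc]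
      rw [hsumf (fun i => θ.wt m i * θ.sq m i), hsq1, hsq]
      linear_combination θ.sq m 0 * hμeq + θ.sq m 0 * (μ - a) * hwt01)
  have hwt' : (ofVal θ.c fun i => θ.val i +
      (if i < 2 then μ - a else if i = j then μ - u else 0)).wt m = θ.wt m := rfl
  rw [ent_eq_sum, ent_eq_sum, hwt'] at this
  have hH : ∀ i, θ.wt m i * binEntropy ((ofVal θ.c fun i => θ.val i +
      (if i < 2 then μ - a else if i = j then μ - u else 0)).val i) =
      θ.wt m i * binEntropy (θ.val i) + θ.wt m i * (if i < 2 then binEntropy μ - binEntropy a else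
        if i = j then binEntropy μ - binEntropy u else 0) := by
    intro i
    rw [val_ofVal, hvk]
    split_ifs with h1 h2
    · rcases hcases i h1 with rfl | rfl
      · rw [h01]; ring
      · rw [h11]; ring
    · subst h2; ring
    · ring
  simp only [hH] at this
  rw [Finset.sum_add_distrib, hsumf, hwt01] at this
  have e : θ.wt m j = w := rfl
  rw [e] at this
  linarith

/-- A pode joined completely to the podes of an independent second group gains entropy when it
grows. -/
theorem WeakExtremal.false_of_joined {m : ℕ} (hm : 1 ≤ m) {θ : Shape} (hθ : θ.Valid)
    (hc0 : 0 < θ.c) (hc1 : θ.c < 1)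
    (ha : θ.a₁ ∈ Ioo (0 : ℝ) 1) (haa : θ.a₁ = θ.a₂)
    (hW : WeakExtremal m (θ.edge m) (θ.tri m) (θ.ent m)) (hd : θ.d = 1) (hb : θ.b = 0)
    (hV : θ.triC m = 3 * θ.sq m 0 * θ.edgeC m)
    (hp : ((m = 1 ∨ θ.p = 1) ∧ 1 - θ.c < m * θ.c) ∨ (θ.p = θ.a₁ ∧ 1 - θ.c ≤ θ.c)) : False := by
  set a := θ.a₁ with hadef
  have hm0 : (0 : ℝ) < m := by exact_mod_cast hm
  set c : ℝ → ℝ := fun t => θ.c + t with hcdef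
  -- The mass of the pode grows to c + t while its value A keeps the edge density fixed; R is the
  -- contribution of the other blocks.
  set R : ℝ → ℝ := fun t => 2 * c t * (1 - c t) + (1 - c t) ^ 2 * ((m - 1) * θ.p) / m with hR
  set A : ℝ → ℝ := fun t => (θ.edge m - R t) / c t ^ 2 with hA
  set v : Fin 5 → ℝ → ℝ := ![A, A, fun _ => 1, fun _ => 0, fun _ => θ.p] with hv
  have hc00 : c 0 = θ.c := by simp [c]
  have hcd : HasDerivAt c 1 0 := by simpa [hcdef] using (hasDerivAt_id (0 : ℝ)).const_add θ.c
  have hE0 : θ.edge m = R 0 + θ.c ^ 2 * a := by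
    simp only [edge, R, hc00, hd, hb, ← haa, ← hadef]; ring
  have hA0 : A 0 = a := by
    simp only [A, hE0, hc00]; field_simp; ring
  have hRd : HasDerivAt R (θ.edgeC m - 2 * θ.c * a) 0 := by
    have h1 := hcd.const_sub 1
    have := ((hcd.const_mul 2).mul h1).add (((h1.pow 2).mul_const (((m : ℝ) - 1) * θ.p)).div_const
      (m : ℝ))
    refine this.congr_deriv ?_
    simp only [edgeC, hc00, hd, hb, ← haa, ← hadef]
    norm_num
    ring
  have hAd : HasDerivAt A (-θ.edgeC m / θ.c ^ 2) 0 := by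
    have := (hRd.const_sub (θ.edge m)).div (hcd.pow 2) (by rw [Pi.pow_apply, hc00]; positivity)
    refine this.congr_deriv ?_
    simp only [Pi.pow_apply, hc00, hE0]
    field_simp
    ring
  have hv' : ∀ j, HasDerivAt (v j) ((![-θ.edgeC m / θ.c ^ 2, -θ.edgeC m / θ.c ^ 2, 0, 0, 0] :
      Fin 5 → ℝ) j) 0 := by
    intro j
    fin_cases j
    exacts [hAd, hAd, hasDerivAt_const _ _, hasDerivAt_const _ _, hasDerivAt_const _ _]
  have h0 : (ofVal (c 0) fun j => v j 0) = θ := by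
    rcases θ with ⟨_, _, _, _, _, _⟩
    simp_all [ofVal]
  have hT := hasDerivAt_tri (m := m) hcd hv'
  -- As A has derivative -edgeC/c² at 0, the triangle derivative is triC - 3·sq₀·edgeC, which
  -- vanishes by the limiting mass equation.
  have hT' : HasDerivAt (fun t => (ofVal (c t) fun j => v j t).tri m) 0 0 := by
    refine hT.congr_deriv ?_
    rw [h0, hV]
    have hsq1 : θ.sq m 1 = θ.sq m 0 := by simp [sq, ← haa]; rw [← hadef]; ring
    simp [Fin.sum_univ_succ, hsq1]
    simp [wt]
    field_simp
    ring
  have hcpos : ∀ t ∈ Icc (0 : ℝ) 1, c t ^ 2 ≠ 0 := fun t ht => by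
    have : 0 < c t := by simp only [c]; linarith [ht.1]
    positivity
  have hAc : ContDiffOn ℝ 2 A (Icc 0 1) := by
    refine ContDiffOn.div ?_ ?_ hcpos
    · refine ContDiff.contDiffOn ?_
      simp only [R, c, div_eq_mul_inv]
      fun_prop
    · refine ContDiff.contDiffOn ?_
      simp only [c]
      fun_prop
  have hTc : ContDiffOn ℝ 2 (fun t => (ofVal (c t) fun j => v j t).tri m) (Icc 0 1) := by
    have hcc : ContDiffOn ℝ 2 c (Icc 0 1) := by
      refine ContDiff.contDiffOn ?_
      simp only [c]; fun_prop
    simp [tri, ofVal, v, div_eq_mul_inv]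
    fun_prop
  obtain ⟨C, hC⟩ := le_add_sq_of_deriv_eq_zero hTc hT'
  simp only [h0] at hC
  have hentf : ∀ t, (ofVal (c t) fun j => v j t).ent m =
      1 / 2 * (c t ^ 2 * binEntropy (A t) + (1 - c t) ^ 2 * ((m - 1) * binEntropy θ.p) / m) := by
    intro t
    simp [ent, ofVal, v]
    ring
  have hS : HasDerivAt (fun t => (ofVal (c t) fun j => v j t).ent m)
      (θ.entC m - slope a * θ.edgeC m / 2) 0 := by
    simp only [hentf]
    have h1 := hcd.const_sub 1
    have hHA : HasDerivAt (fun t => binEntropy (A t)) (slope a * (-θ.edgeC m / θ.c ^ 2)) 0 :=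
      HasDerivAt.comp (h₂ := binEntropy) 0 (by rw [hA0]; exact hasDerivAt_slope ha) hAd
    have := (((hcd.pow 2).mul hHA).add (((h1.pow 2).mul_const
      (((m : ℝ) - 1) * binEntropy θ.p)).div_const (m : ℝ))).const_mul (1 / 2)
    refine this.congr_deriv ?_
    simp only [entC, hc00, hA0, Pi.pow_apply, hd, hb, ← haa, ← hadef]
    simp
    field_simp
    ring
  -- Since H(a) - a·slope(a) = -log(1 - a), each case becomes a combination of -log(1 - a) and -log
  -- a in which the first coefficient is positive and the second nonnegative.
  have hpos : 0 < θ.entC m - slope a * θ.edgeC m / 2 := by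
    have hL : 0 < -log (1 - a) := by
      have := Real.log_neg (sub_pos.2 ha.2) (by linarith [ha.1])
      linarith
    have hL' : 0 < -log a := by
      have := Real.log_neg ha.1 ha.2
      linarith
    have hq : 0 < 1 - θ.c := sub_pos.2 hc1
    have hH : binEntropy a - a * slope a = -log (1 - a) := by
      simp only [Real.binEntropy_eq_negMulLog_add_negMulLog_one_sub, Real.negMulLog, slope]; ring
    have hform : θ.entC m - slope a * θ.edgeC m / 2 = θ.c * (binEntropy a - a * slope a) -
        (1 - 2 * θ.c) * slope a -
        (1 - θ.c) * (m - 1) / m * (binEntropy θ.p - θ.p * slope a) := by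
      simp only [entC, edgeC, hd, hb, ← haa, ← hadef]
      simp
      ring
    have hsl : slope a = log (1 - a) - log a := rfl
    rw [hform, hH]
    rcases hp with ⟨h1 | h1, h2⟩ | ⟨h1, h2⟩
    · subst h1
      simp at h2 ⊢
      rw [hsl]
      nlinarith
    · rw [h1]
      simp only [Real.binEntropy_one]
      have e : θ.c * -log (1 - a) - (1 - 2 * θ.c) * slope a -
          (1 - θ.c) * (m - 1) / m * (0 - 1 * slope a) =
          ((1 - θ.c) * (-log (1 - a)) + (m * θ.c - (1 - θ.c)) * (-log a)) / m := by
        rw [hsl]; field_simp; ring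
      rw [e]
      have : 0 < m * θ.c - (1 - θ.c) := by linarith
      positivity
    · rw [h1, hH]
      have e : θ.c * -log (1 - a) - (1 - 2 * θ.c) * slope a -
          (1 - θ.c) * (m - 1) / m * (-log (1 - a)) =
          ((1 - θ.c) * (-log (1 - a))) / m + (θ.c - (1 - θ.c)) * (-log a) := by
        rw [hsl]; field_simp; ring
      rw [e]
      have : 0 ≤ θ.c - (1 - θ.c) := by linarith
      positivity
  have hAt : Tendsto A (𝓝[>] 0) (𝓝 a) := by
    have := hAd.continuousAt.tendsto
    rw [hA0] at this
    exact this.mono_left nhdsWithin_le_nhds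
  have hct : Tendsto c (𝓝[>] 0) (𝓝 θ.c) := by
    have := hcd.continuousAt.tendsto
    rw [hc00] at this
    exact this.mono_left nhdsWithin_le_nhds
  refine hW.no_curve hc0 ha (c := c) (v := v) (C := C) (half_pos hpos) hct hAt (fun t => rfl) ?_ ?_
    hC ?_
  · filter_upwards [hAt.eventually_mem (Icc_mem_nhds ha.1 ha.2),
      hct.eventually_mem (Icc_mem_nhds hc0 hc1)] with t h1 h2
    exact ⟨h2, h1, h1, by simp [ofVal, v], by simp [ofVal, v], hθ.p⟩
  · filter_upwards [hct.eventually (eventually_gt_nhds hc0)] with t h1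
    have : (ofVal (c t) fun j => v j t).edge m = c t ^ 2 * A t + R t := by
      simp [edge, ofVal, v, R]
      ring
    rw [this]
    simp only [A]
    field_simp
    ring
  · have := hS.tendsto_slope_zero_right.eventually (eventually_gt_nhds (half_lt_self hpos))
    filter_upwards [this, self_mem_nhdsWithin] with t ht ht0
    have ht0 : 0 < t := ht0
    simp only [zero_add, h0, smul_eq_mul] at ht
    rw [lt_inv_mul_iff₀ ht0] at ht
    linarith

/-! ### Contradiction for limits with a merged pair. -/

theorem tri_nonneg {m : ℕ} (hm : 1 ≤ m) {θ : Shape} (h : θ.Valid) : 0 ≤ θ.tri m := by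
  have h0 := h.c.1
  have h1 : 0 ≤ 1 - θ.c := sub_nonneg.2 h.c.2
  have h2 : (0 : ℝ) ≤ m - 1 := sub_nonneg.2 (by exact_mod_cast hm)
  have h3 : (0 : ℝ) ≤ (m - 1) * (m - 2) := by
    rcases hm.eq_or_lt with rfl | h
    · simp
    · have : (2 : ℝ) ≤ m := by exact_mod_cast h
      exact mul_nonneg h2 (by linarith)
  have := h.a₁.1
  have := h.a₂.1
  have := h.d.1
  have := h.b.1
  have := h.p.1
  simp only [tri]
  positivity

/-- A limit of extremal shapes is not a union of a balanced bipartite graphon and an isolated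
pode. -/
theorem false_of_isolated {l : Filter ℕ} [l.NeBot] {e t s : ℕ → ℝ} {c p : ℝ}
    (hc0 : 0 < c) (hc1 : c < 1) (hp0 : 0 < p) (hp1 : p ≤ 1)
    (he : Tendsto e l (𝓝 ((⟨c, 0, 0, 0, 0, p⟩ : Shape).edge 2)))
    (hs : Tendsto s l (𝓝 ((⟨c, 0, 0, 0, 0, p⟩ : Shape).ent 2)))
    (ht : ∀ n, 0 ≤ t n) (he0 : ∀ n, 0 ≤ e n) (hE : ∀ n, Extremal 2 (e n) (t n) (s n)) : False := by
  have h1 : (⟨c, 0, 0, 0, 0, p⟩ : Shape).edge 2 = (1 - c) ^ 2 * p / 2 := by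
    simp only [edge]; push_cast; ring
  have h2 : (⟨c, 0, 0, 0, 0, p⟩ : Shape).ent 2 = (1 - c) ^ 2 * binEntropy p / 4 := by
    simp only [ent, Real.binEntropy_zero]; push_cast; ring
  rw [h1] at he
  rw [h2] at hs
  have hw0 : 0 < (1 - c) ^ 2 := by have := sub_pos.2 hc1; positivity
  have hw1 : (1 - c) ^ 2 < 1 := by nlinarith
  -- Strict concavity and H(0) = 0: spreading the bipartite part over all the mass gains entropy.
  have hH : (1 - c) ^ 2 * binEntropy p < binEntropy ((1 - c) ^ 2 * p) := by
    have := Real.strictConcave_binEntropy.2 (x := p) (y := 0) ⟨hp0.le, hp1⟩ ⟨le_rfl, zero_le_one⟩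
      hp0.ne' hw0 (sub_pos.2 hw1) (by ring)
    simpa using this
  have h3 : Tendsto (fun n => binEntropy (2 * e n) / 4) l
      (𝓝 (binEntropy ((1 - c) ^ 2 * p) / 4)) := by
    have h4 : Tendsto (fun n => 2 * e n) l (𝓝 ((1 - c) ^ 2 * p)) := by
      have := he.const_mul 2
      rwa [mul_div_cancel₀ _ (two_ne_zero)] at this
    exact ((Real.binEntropy_continuous.tendsto _).comp h4).div_const 4
  have h5 : ∀ᶠ n in l, s n < binEntropy (2 * e n) / 4 := hs.eventually_lt h3 (by linarith)
  have h6 : ∀ᶠ n in l, e n < 1 / 2 := he.eventually (eventually_lt_nhds (by nlinarith))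
  obtain ⟨n, h7, h8⟩ := (h5.and h6).exists
  -- The balanced bipartite graphon of edge density `e n`: it has no triangles, so it competes at
  -- every triangle density.
  have h9 := (hE n).ent_le ⟨1, 0, 2 * e n, 0, 0, 0⟩
    ⟨by simp, by simp, ⟨by simp [he0 n], by linarith⟩, by simp, by simp, by simp⟩
    (by simp [edge]) (by simpa [tri] using ht n)
  simp [ent] at h9
  linarith

/-- Extremal shapes with `m + 2` podes do not converge to a shape with `m + 1` podes that are
not all equivalent, the podes of the pair merging in the limit. -/
theorem false_of_merging {m : ℕ} (hm : 1 ≤ m) {l : Filter ℕ} [l.NeBot]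
    {x : ℕ → ℝ × (Fin 5 → ℝ)} {z : ℝ × (Fin 5 → ℝ)} (hx : Tendsto x l (𝓝 z))
    (hc : ∀ n, (x n).1 ∈ Ioo (0 : ℝ) 1) (hv : ∀ n j, (x n).2 j ∈ Ioo (0 : ℝ) 1)
    (hne : ∀ n, (x n).2 0 ≠ (x n).2 1)
    (hE : ∀ n, Extremal m ((mk' (x n)).edge m) ((mk' (x n)).tri m) ((mk' (x n)).ent m))
    (hzc : z.1 ∈ Ioo (0 : ℝ) 1) (hz : z.2 0 = z.2 1) (hbp : 2 ≤ m → z.2 3 ≠ z.2 4)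
    (hconst : m = 1 → ¬(z.2 0 = z.2 2 ∧ z.2 3 = z.2 2))
    (hA : ¬(z.1 = (1 - z.1) / m ∧ z.2 0 = z.2 3 ∧ (2 ≤ m → z.2 2 = z.2 4))) : False := by
  obtain ⟨hsq, hV⟩ := limit_conditions hm hx hc hv hne hz hE
  have hxj : ∀ j, Tendsto (fun n => (x n).2 j) l (𝓝 (z.2 j)) := fun j =>
    (((continuous_apply j).comp continuous_snd).tendsto z).comp hx
  have hzI : ∀ j, z.2 j ∈ Icc (0 : ℝ) 1 := fun j =>
    isClosed_Icc.mem_of_tendsto (hxj j) (Eventually.of_forall fun n => Ioo_subset_Icc_self (hv n j))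
  have hedge := ((continuous_edge m).tendsto z).comp hx
  have htri := ((continuous_tri m).tendsto z).comp hx
  have hent := ((continuous_ent m).tendsto z).comp hx
  have hW := weakExtremal_of_tendsto hedge htri hent hE
  set θ := mk' z with hθdef
  have hθ : θ.Valid := valid_ofVal (Ioo_subset_Icc_self hzc) hzI
  set c := z.1 with hcdef
  set a := z.2 0 with hadef
  set d := z.2 2 with hddef
  set b := z.2 3 with hbdef
  set p := z.2 4 with hpdef
  have hθeq : θ = ⟨c, a, a, d, b, p⟩ := by
    rw [hθdef]; simp only [mk', ofVal, ← hz, c, a, d, b, p]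
  have hm0 : (0 : ℝ) < m := by exact_mod_cast hm
  set q := (1 - c) / m with hqdef
  have hc1 : 0 < 1 - c := sub_pos.2 hzc.2
  have hq : 0 < q := div_pos hc1 hm0
  have hcq : c + m * q = 1 := by rw [hqdef]; field_simp; ring
  have hcq' : 1 - c = m * q := by linarith
  have sq0 : θ.sq m 0 = c * a ^ 2 + m * q * d ^ 2 := by
    rw [hθeq]; simp [sq]; rw [hcq']; ring
  have sq2 : θ.sq m 2 = d * (c * a + q * (b + (m - 1) * p)) := by
    rw [hθeq]; simp [sq]; rw [hcq']; left; field_simp; ring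
  have sq3 : θ.sq m 3 = c * d ^ 2 + q * (b ^ 2 + (m - 1) * p ^ 2) := by
    rw [hθeq]; simp [sq]; rw [hcq']; field_simp
  have sq4 : θ.sq m 4 = c * d ^ 2 + q * (2 * b * p + (m - 2) * p ^ 2) := by
    rw [hθeq]; simp [sq]; rw [hcq']; field_simp
  have hedgeC : θ.edgeC m = 2 * (c * a + m * q * d - c * d - q * (b + (m - 1) * p)) := by
    have e : 1 - 2 * c = m * q - c := by linarith
    rw [hθeq]; simp only [edgeC]; rw [hcq', e]; field_simp; ring
  have htriC : θ.triC m = 3 * (c ^ 2 * a ^ 3 + (2 * c * m * q - c ^ 2) * d ^ 2 * a +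
      (m * q ^ 2 - 2 * c * q) * d ^ 2 * (b + (m - 1) * p) -
      q ^ 2 * (b ^ 3 + 3 * (m - 1) * b * p ^ 2 + (m - 1) * (m - 2) * p ^ 3)) := by
    have e : 2 * c - 3 * c ^ 2 = 2 * c * (m * q) - c ^ 2 := by
      rw [← hcq']; ring
    rw [hθeq]; simp only [triC]; rw [hcq', e]; field_simp; ring
  have hV' : c * a * θ.sq m 0 + m * q * d * θ.sq m 2 - c * d * θ.sq m 2 -
      q * (b * θ.sq m 3 + (m - 1) * p * θ.sq m 4) =
      2 * θ.sq m 0 * (c * a + m * q * d - c * d - q * (b + (m - 1) * p)) := by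
    have h1 := hV
    rw [hedgeC, htriC] at h1
    have h2 : c ^ 2 * a ^ 3 + (2 * c * m * q - c ^ 2) * d ^ 2 * a +
      (m * q ^ 2 - 2 * c * q) * d ^ 2 * (b + (m - 1) * p) -
      q ^ 2 * (b ^ 3 + 3 * (m - 1) * b * p ^ 2 + (m - 1) * (m - 2) * p ^ 3) =
      c * a * θ.sq m 0 + m * q * d * θ.sq m 2 - c * d * θ.sq m 2 -
      q * (b * θ.sq m 3 + (m - 1) * p * θ.sq m 4) := by
      rw [sq0, sq2, sq3, sq4]; ring
    rw [← h2]
    linarith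
  have hwt : ∀ j, 2 ≤ j → (j ≠ 4 ∨ 2 ≤ m) → 0 < θ.wt m j := by
    intro j hj2 hj
    have h0 := hzc.1
    rw [hθeq]
    fin_cases j
    · simp at hj2
    · simp at hj2
    · simp [wt]; positivity
    · simp [wt]; positivity
    · have : 2 ≤ m := by simpa using hj
      have h2 : (0 : ℝ) < m - 1 := by
        have : (2 : ℝ) ≤ m := by exact_mod_cast this
        linarith
      simp [wt]; positivity
  have haa : θ.a₁ = θ.a₂ := by rw [hθeq]
  have ha1 : θ.a₁ = a := by rw [hθeq]
  have hfree : ∀ j, 2 ≤ j → (j ≠ 4 ∨ 2 ≤ m) → 0 < a → a < 1 → θ.sq m j = θ.sq m 0 →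
      θ.val j = a := fun j hj2 hj h0 h1 hsqj =>
    (hW.val_eq hm hθ hzc.1 (by rw [ha1]; exact ⟨h0, h1⟩) haa hj2 (hwt j hj2 hj) hsqj).trans ha1
  have hjoin : 0 < a → a < 1 → d = 1 → b = 0 →
      (((m = 1 ∨ p = 1) ∧ q < c) ∨ (p = a ∧ m * q ≤ c)) → False := by
    intro h0 h1 hd hb hcase
    refine hW.false_of_joined hm hθ hzc.1 hzc.2 (by rw [ha1]; exact ⟨h0, h1⟩) haa hd hb hV ?_
    rcases hcase with ⟨h2, h3⟩ | ⟨h2, h3⟩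
    · refine Or.inl ⟨h2, ?_⟩
      have : m * q < m * c := mul_lt_mul_of_pos_left h3 hm0
      change 1 - c < m * c
      linarith
    · refine Or.inr ⟨?_, ?_⟩
      · rw [ha1]; exact h2
      · change 1 - c ≤ c
        linarith
  have hd' := hsq 2 (by simp)
  have hb' := hsq 3 (by simp)
  rcases hm.eq_or_lt with rfl | hm2
  · have e1 : ((1 : ℕ) : ℝ) = 1 := Nat.cast_one
    rw [e1] at sq0 sq2 sq3 sq4 hV' hcq
    simp only [sub_self, zero_mul, add_zero, one_mul] at sq0 sq2 sq3 hV' hcq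
    rw [sq2] at hd'
    rw [sq3] at hb'
    have := degenerate_one (lam := θ.sq 1 0) hzc.1 hq hcq (hzI 0).1 (hzI 0).2 (hzI 2).1
      (hzI 2).2 (hzI 3).1 (hzI 3).2 sq0 hd'.1 hd'.2 hb'.1 hb'.2
      (by rw [sq2, sq3] at hV'; linear_combination hV')
      (fun h0 h1 h2 => hfree 3 (by decide) (by simp) h0 h1 (by rw [sq3]; exact h2))
      (hconst rfl) (fun h => hA ⟨h.1, h.2, fun h3 => by omega⟩)
    obtain ⟨h0, h1, h2, h3, h4⟩ := this
    exact hjoin h0 h1 h2 h3 (Or.inl ⟨Or.inl rfl, h4⟩)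
  · have hm2 : 2 ≤ m := hm2
    have hp' := hsq 4 (Or.inr hm2)
    have := degenerate_two (lam := θ.sq m 0) (D := θ.sq m 2) (B := θ.sq m 3) (P := θ.sq m 4)
      (k := m) (by exact_mod_cast hm2) hzc.1 hq hcq (hzI 0).1 (hzI 0).2 (hzI 2).1
      (hzI 2).2 (hzI 3).1 (hzI 3).2 (hzI 4).1 (hzI 4).2 sq0 sq2 sq3 sq4 hd'.1 hd'.2 hb'.1 hb'.2
      hp'.1 hp'.2 hV'
      (fun h0 h1 => ⟨hfree 3 (by decide) (by simp) h0 h1, hfree 4 (by decide) (Or.inr hm2) h0 h1⟩)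
      (hbp hm2) (fun h => hA ⟨h.1, h.2.1, fun _ => h.2.2⟩)
    rcases this with ⟨h0, h1, h2, h3, h4⟩ | ⟨h0, h1, h2, h3, h4⟩
    · have hm2' : m = 2 := by exact_mod_cast h0
      subst hm2'
      have hθ' : mk' z = ⟨c, 0, 0, 0, 0, p⟩ := by
        rw [← hθdef, hθeq, show a = 0 from h1, show d = 0 from h2, show b = 0 from h3]
      have hvn : ∀ n, (mk' (x n)).Valid := fun n => valid_ofVal (Ioo_subset_Icc_self (hc n))
        fun j => Ioo_subset_Icc_self (hv n j)
      rw [hθdef, hθ'] at hedge hent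
      exact false_of_isolated hzc.1 hzc.2 h4 (hzI 4).2 hedge hent
        (fun n => tri_nonneg hm (hvn n)) (fun n => (edge_mem hm (hvn n)).1) hE
    · refine hjoin h0 h1 h2 h3 ?_
      rcases h4 with ⟨h4, h5⟩ | h4
      · exact Or.inl ⟨Or.inr h4, h5⟩
      · exact Or.inr h4

end Shape

/-! ### Densities and entropy of multipodal graphons. -/

namespace Graphon

section Podes

variable {ι : Type} [Fintype ι] {κ : I → ι}

theorem integral_comp_pode (hκ : ∀ i, MeasurableSet (κ ⁻¹' {i})) (f : ι → ℝ) :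
    ∫ x, f (κ x) = ∑ i, (volume : Measure I).real (κ ⁻¹' {i}) * f i := by
  let _ : MeasurableSpace ι := ⊤
  have hm : Measurable κ := measurable_to_countable' hκ
  have hf : Measurable f := measurable_from_top
  rw [← integral_map (φ := κ) hm.aemeasurable hf.aestronglyMeasurable,
    integral_fintype (Integrable.of_finite)]
  refine Finset.sum_congr rfl fun i _ => ?_
  rw [map_measureReal_apply hm (MeasurableSet.singleton i), smul_eq_mul]

theorem integral_comp_pode₂ (hκ : ∀ i, MeasurableSet (κ ⁻¹' {i})) {g : I → I → ℝ}
    {P : ι → ι → ℝ} (hg : ∀ᵐ x : I, ∀ᵐ y : I, g x y = P (κ x) (κ y)) (f : ℝ → ℝ) :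
    ∫ x, ∫ y, f (g x y) = ∑ i, ∑ j, (volume : Measure I).real (κ ⁻¹' {i}) *
      (volume : Measure I).real (κ ⁻¹' {j}) * f (P i j) := by
  have h1 : ∀ᵐ x : I, ∫ y, f (g x y) =
      ∑ j, (volume : Measure I).real (κ ⁻¹' {j}) * f (P (κ x) j) := by
    filter_upwards [hg] with x hx
    rw [← integral_comp_pode hκ fun j => f (P (κ x) j)]
    exact integral_congr_ae (hx.mono fun y hy => by simp only [hy])
  rw [integral_congr_ae h1, integral_comp_pode hκ fun i =>
    ∑ j, (volume : Measure I).real (κ ⁻¹' {j}) * f (P i j)]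
  refine Finset.sum_congr rfl fun i _ => ?_
  rw [Finset.mul_sum]
  exact Finset.sum_congr rfl fun j _ => by ring

theorem integral_comp_pode₃ (hκ : ∀ i, MeasurableSet (κ ⁻¹' {i})) {g : I → I → ℝ}
    (hsymm : ∀ x y, g x y = g y x)
    {P : ι → ι → ℝ} (hg : ∀ᵐ x : I, ∀ᵐ y : I, g x y = P (κ x) (κ y)) :
    ∫ x, ∫ y, ∫ z, g x y * g y z * g z x = ∑ i, ∑ j, ∑ k,
      (volume : Measure I).real (κ ⁻¹' {i}) * (volume : Measure I).real (κ ⁻¹' {j}) *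
      (volume : Measure I).real (κ ⁻¹' {k}) * (P i j * P j k * P i k) := by
  have h2 : ∀ᵐ x : I, ∀ᵐ y : I, ∫ z, g x y * g y z * g z x =
      ∑ k, (volume : Measure I).real (κ ⁻¹' {k}) * (P (κ x) (κ y) * P (κ y) k * P (κ x) k) := by
    filter_upwards [hg] with x hx
    filter_upwards [hx, hg] with y hy hy'
    rw [← integral_comp_pode hκ fun k => P (κ x) (κ y) * P (κ y) k * P (κ x) k]
    refine integral_congr_ae ?_
    filter_upwards [hx, hy'] with z hz hz'
    rw [hsymm z x, hz, hz', hy]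
  have h1 : ∀ᵐ x : I, ∫ y, ∫ z, g x y * g y z * g z x =
      ∑ j, (volume : Measure I).real (κ ⁻¹' {j}) *
      ∑ k, (volume : Measure I).real (κ ⁻¹' {k}) * (P (κ x) j * P j k * P (κ x) k) := by
    filter_upwards [h2] with x hx
    rw [integral_congr_ae hx, integral_comp_pode hκ fun j => ∑ k, (volume : Measure I).real
      (κ ⁻¹' {k}) * (P (κ x) j * P j k * P (κ x) k)]
  rw [integral_congr_ae h1, integral_comp_pode hκ fun i => ∑ j, (volume : Measure I).real
    (κ ⁻¹' {j}) * ∑ k, (volume : Measure I).real (κ ⁻¹' {k}) * (P i j * P j k * P i k)]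
  simp only [Finset.mul_sum]
  exact Finset.sum_congr rfl fun i _ => Finset.sum_congr rfl fun j _ =>
    Finset.sum_congr rfl fun k _ => by ring

variable {g : Graphon} {w : ι → ℝ} {P : ι → ι → ℝ}

theorem IsMultipodal.edgeDensity_eq (h : IsMultipodal g w P) :
    g.edgeDensity = ∑ i, ∑ j, w i * w j * P i j := by
  obtain ⟨κ, hκ, hw, hP⟩ := h
  have := integral_comp_pode₂ hκ (Measure.ae_ae_of_ae_prod hP) id
  simp only [id, hw] at this
  exact this

theorem IsMultipodal.triangleDensity_eq (h : IsMultipodal g w P) :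
    g.triangleDensity = ∑ i, ∑ j, ∑ k, w i * w j * w k * (P i j * P j k * P i k) := by
  obtain ⟨κ, hκ, hw, hP⟩ := h
  have := integral_comp_pode₃ hκ g.symm' (Measure.ae_ae_of_ae_prod hP)
  simp only [hw] at this
  exact this

theorem IsMultipodal.entropy_eq (h : IsMultipodal g w P) :
    g.entropy = 1 / 2 * ∑ i, ∑ j, w i * w j * Real.binEntropy (P i j) := by
  obtain ⟨κ, hκ, hw, hP⟩ := h
  have := integral_comp_pode₂ hκ (Measure.ae_ae_of_ae_prod hP)
    (fun u => u * Real.log u + (1 - u) * Real.log (1 - u))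
  simp only [hw] at this
  rw [entropy, this, neg_mul, ← mul_neg, ← Finset.sum_neg_distrib]
  congr 1
  refine Finset.sum_congr rfl fun i _ => ?_
  rw [← Finset.sum_neg_distrib]
  refine Finset.sum_congr rfl fun j _ => ?_
  rw [Real.binEntropy_eq_negMulLog_add_negMulLog_one_sub]
  simp only [Real.negMulLog]
  ring

end Podes

section Values

variable {ι : Type} {g : Graphon} {w : ι → ℝ} {P : ι → ι → ℝ}

theorem IsMultipodal.value_mem (h : IsMultipodal g w P) {i j : ι} (hi : 0 < w i) (hj : 0 < w j) :
    P i j ∈ Icc (0 : ℝ) 1 := by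
  obtain ⟨κ, hκ, hw, hP⟩ := h
  have hfreq : ∀ i, 0 < w i → ∃ᵐ x : I, x ∈ κ ⁻¹' {i} := by
    intro i hi
    rw [frequently_ae_mem_iff]
    intro h0
    rw [← hw, measureReal_def, h0] at hi
    simp at hi
  have h1 : ∀ᵐ x : I, ∀ᵐ y : I, g.toFun x y = P (κ x) (κ y) := Measure.ae_ae_of_ae_prod hP
  obtain ⟨x, hx, hx'⟩ := ((hfreq i hi).and_eventually h1).exists
  obtain ⟨y, hy, hy'⟩ := ((hfreq j hj).and_eventually hx').exists
  have e1 : κ x = i := hx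
  have e2 : κ y = j := hy
  rw [← e1, ← e2, ← hy']
  exact ⟨g.nonneg' _ _, g.le_one' _ _⟩

/-- Renaming the podes. -/
theorem IsMultipodal.reindex {ι' : Type} (h : IsMultipodal g w P) (e : ι ≃ ι') :
    IsMultipodal g (fun i => w (e.symm i)) (fun i j => P (e.symm i) (e.symm j)) := by
  obtain ⟨κ, hκ, hw, hP⟩ := h
  have hpre : ∀ i, (e ∘ κ) ⁻¹' {i} = κ ⁻¹' {e.symm i} := fun i => by
    ext x; simp [Equiv.eq_symm_apply]
  exact ⟨e ∘ κ, fun i => by rw [hpre]; exact hκ _, fun i => by rw [hpre]; exact hw _,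
    hP.mono fun z hz => by simpa using hz⟩

end Values

theorem podeValue_symm (r m : ℕ) (a₁ a₂ d b p : ℝ) (i j : Fin r ⊕ Fin m) :
    podeValue r m a₁ a₂ d b p i j = podeValue r m a₁ a₂ d b p j i := by
  rcases i with i | i <;> rcases j with j | j <;> simp [podeValue, eq_comm]

section Shapes

variable {m : ℕ} {g : Graphon} {θ : Shape}

/-- `g` has the podal structure described by `θ`. -/
def HasShape (m : ℕ) (g : Graphon) (θ : Shape) : Prop :=
  IsMultipodal g (podeSize 2 m θ.c) (podeValue 2 m θ.a₁ θ.a₂ θ.d θ.b θ.p)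

theorem sum_shape₂ (hm : 1 ≤ m) (f : ℝ → ℝ) :
    ∑ i, ∑ j, podeSize 2 m θ.c i * podeSize 2 m θ.c j *
      f (podeValue 2 m θ.a₁ θ.a₂ θ.d θ.b θ.p i j) =
    θ.c ^ 2 * (f θ.a₁ + f θ.a₂) / 2 + 2 * θ.c * (1 - θ.c) * f θ.d +
      (1 - θ.c) ^ 2 * (f θ.b + (m - 1) * f θ.p) / m := by
  have hm0 : (m : ℝ) ≠ 0 := by positivity
  have h1 : ∀ x y : ℝ, ∀ i : Fin m, ∑ j : Fin m, f (if i = j then x else y) =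
      f x + (m - 1) * f y := by
    intro x y i
    have : ∀ j : Fin m, f (if i = j then x else y) = f y + if i = j then f x - f y else 0 := by
      intro j; split_ifs <;> ring
    simp only [this, Finset.sum_add_distrib]
    simp
    ring
  simp only [Fintype.sum_sum_type, Fin.sum_univ_two, podeSize, podeValue]
  simp only [← Finset.mul_sum, h1]
  simp
  field_simp
  ring

theorem sum_shape₃ (hm : 1 ≤ m) :
    ∑ i, ∑ j, ∑ k, podeSize 2 m θ.c i * podeSize 2 m θ.c j * podeSize 2 m θ.c k *
      (podeValue 2 m θ.a₁ θ.a₂ θ.d θ.b θ.p i j * podeValue 2 m θ.a₁ θ.a₂ θ.d θ.b θ.p j k *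
        podeValue 2 m θ.a₁ θ.a₂ θ.d θ.b θ.p i k) = θ.tri m := by
  have hm0 : (m : ℝ) ≠ 0 := by positivity
  set b := θ.b
  set p := θ.p
  have e0 : ∀ i j : Fin m, (if i = j then b else p) = p + if i = j then b - p else 0 := by
    intro i j; split_ifs <;> ring
  have h1 : ∀ i : Fin m, ∑ j : Fin m, (if i = j then b else p) = b + (m - 1) * p := by
    intro i
    simp only [e0, Finset.sum_add_distrib]
    simp; ring
  have h2 : ∀ i j : Fin m, ∑ k : Fin m, (if j = k then b else p) * (if i = k then b else p) =
      m * p ^ 2 + 2 * p * (b - p) + if i = j then (b - p) ^ 2 else 0 := by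
    intro i j
    simp only [e0, mul_add, add_mul, Finset.sum_add_distrib, mul_ite, ite_mul, mul_zero, zero_mul]
    by_cases hij : i = j
    · subst hij; simp; ring
    · simp [hij, Ne.symm hij]; ring
  have h3 : ∀ i : Fin m, ∑ j : Fin m, (if i = j then b else p) *
      (m * p ^ 2 + 2 * p * (b - p) + if i = j then (b - p) ^ 2 else 0) =
      (b + (m - 1) * p) * (m * p ^ 2 + 2 * p * (b - p)) + b * (b - p) ^ 2 := by
    intro i
    simp only [mul_add, Finset.sum_add_distrib, ← Finset.sum_mul, h1]
    simp
  have h2' : ∀ i j : Fin m, ∀ x : ℝ, ∑ k : Fin m, x * ((if i = j then b else p) *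
      (if j = k then b else p) * (if i = k then b else p)) = x * ((if i = j then b else p) *
      (m * p ^ 2 + 2 * p * (b - p) + if i = j then (b - p) ^ 2 else 0)) := by
    intro i j x
    rw [← h2, Finset.mul_sum, Finset.mul_sum]
    exact Finset.sum_congr rfl fun k _ => by ring
  simp only [Fintype.sum_sum_type, Fin.sum_univ_two, podeSize, podeValue, h2']
  simp only [Finset.sum_add_distrib, ← Finset.mul_sum, ← Finset.sum_mul, h1, h3]
  simp [Shape.tri]
  field_simp
  ring

theorem HasShape.edgeDensity_eq (hm : 1 ≤ m) (h : HasShape m g θ) : g.edgeDensity = θ.edge m := by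
  rw [IsMultipodal.edgeDensity_eq h]
  exact sum_shape₂ hm id

theorem HasShape.entropy_eq (hm : 1 ≤ m) (h : HasShape m g θ) : g.entropy = θ.ent m := by
  rw [IsMultipodal.entropy_eq h, sum_shape₂ hm Real.binEntropy]
  rfl

theorem HasShape.triangleDensity_eq (hm : 1 ≤ m) (h : HasShape m g θ) :
    g.triangleDensity = θ.tri m := by
  rw [IsMultipodal.triangleDensity_eq h, sum_shape₃ hm]

theorem podeSize_nonneg (r : ℕ) {c : ℝ} (hc : c ∈ Icc (0 : ℝ) 1) (i : Fin r ⊕ Fin m) :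
    0 ≤ podeSize r m c i := by
  have := hc.1
  have := sub_nonneg.2 hc.2
  rcases i with i | i <;> simp only [podeSize] <;> positivity

theorem podeSize_sum {r : ℕ} (hr : 1 ≤ r) (hm : 1 ≤ m) (c : ℝ) : ∑ i, podeSize r m c i = 1 := by
  have hm0 : (m : ℝ) ≠ 0 := by positivity
  have hr0 : (r : ℝ) ≠ 0 := by positivity
  simp [Fintype.sum_sum_type, podeSize]
  field_simp
  ring

/-- A partition of the unit interval with prescribed sizes. -/
theorem exists_podes {ι : Type} [Fintype ι] {w : ι → ℝ} (hw : ∀ i, 0 ≤ w i) (hs : ∑ i, w i = 1) :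
    ∃ κ : I → ι, (∀ i, MeasurableSet (κ ⁻¹' {i})) ∧
      ∀ i, (volume : Measure I).real (κ ⁻¹' {i}) = w i := by
  classical
  let _ : MeasurableSpace ι := ⊤
  have : DiscreteMeasurableSpace ι := ⟨fun _ => trivial⟩
  have hs' : ∑ i, ENNReal.ofReal (w i) = 1 := by
    rw [← ENNReal.ofReal_sum_of_nonneg fun i _ => hw i, hs, ENNReal.ofReal_one]
  have : Nonempty ι := by
    by_contra hne
    rw [not_nonempty_iff] at hne
    simp at hs
  set μ : Measure ι := (PMF.ofFintype (fun i => ENNReal.ofReal (w i)) hs').toMeasure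
  obtain ⟨κ, hκ, hmap⟩ := μ.exists_measurable_map_eq
  refine ⟨κ, fun i => hκ (MeasurableSet.singleton i), fun i => ?_⟩
  rw [← map_measureReal_apply hκ (MeasurableSet.singleton i), hmap, measureReal_def,
    PMF.toMeasure_apply_singleton _ _ (MeasurableSet.singleton i), PMF.ofFintype_apply,
    ENNReal.toReal_ofReal (hw i)]

theorem exists_hasShape (hm : 1 ≤ m) (hθ : θ.Valid) : ∃ g : Graphon, HasShape m g θ := by
  obtain ⟨κ, hκ, hw⟩ := exists_podes (fun i => podeSize_nonneg (m := m) 2 hθ.c i)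
    (podeSize_sum (by norm_num) hm θ.c)
  let _ : MeasurableSpace (Fin 2 ⊕ Fin m) := ⊤
  have hκm : Measurable κ := measurable_to_countable' hκ
  have hP : ∀ i j, podeValue 2 m θ.a₁ θ.a₂ θ.d θ.b θ.p i j ∈ Icc (0 : ℝ) 1 := by
    rintro (i | i) (j | j) <;> simp only [podeValue] <;> (try split_ifs)
    exacts [hθ.a₁, hθ.a₂, hθ.d, hθ.d, hθ.b, hθ.p]
  refine ⟨⟨fun x y => podeValue 2 m θ.a₁ θ.a₂ θ.d θ.b θ.p (κ x) (κ y), ?_, fun x y =>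
    podeValue_symm _ _ _ _ _ _ _ _ _, fun x y => (hP _ _).1, fun x y => (hP _ _).2⟩, κ, hκ, hw,
    Eventually.of_forall fun z => rfl⟩
  have : DiscreteMeasurableSpace (Fin 2 ⊕ Fin m) := ⟨fun _ => trivial⟩
  have : Measurable (Function.uncurry (podeValue 2 m θ.a₁ θ.a₂ θ.d θ.b θ.p)) :=
    Measurable.of_discrete
  exact this.comp ((hκm.comp measurable_fst).prodMk (hκm.comp measurable_snd))

end Shapes

/-! ### Couplings of podes from the cut distance. -/

/-- Graphons close in the cut distance have podes which are coupled with close values. -/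
theorem exists_coupling {ι ι' : Type} [Fintype ι] [Fintype ι'] {f g : Graphon} {w : ι → ℝ}
    {P : ι → ι → ℝ} {w' : ι' → ℝ} {P' : ι' → ι' → ℝ} (hf : IsMultipodal f w P)
    (hg : IsMultipodal g w' P') {η : ℝ} (h : cutDist f g < η) :
    ∃ M : ι → ι' → ℝ, (∀ i j, 0 ≤ M i j) ∧ (∀ i, ∑ j, M i j = w i) ∧ (∀ j, ∑ i, M i j = w' j) ∧
      ∀ i j k l, M i j * M k l * |P i k - P' j l| < η := by
  classical
  obtain ⟨κ, hκ, hw, hP⟩ := hf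
  obtain ⟨κ', hκ', hw', hP'⟩ := hg
  have hne : {r : ℝ | ∃ φ ψ : I → I, MeasurePreserving φ volume volume ∧
    MeasurePreserving ψ volume volume ∧
    r = cutMetric (fun x y => f.toFun (φ x) (φ y)) (fun x y => g.toFun (ψ x) (ψ y))}.Nonempty :=
    ⟨_, id, id, MeasurePreserving.id _, MeasurePreserving.id _, rfl⟩
  obtain ⟨_, ⟨φ, ψ, hφ, hψ, rfl⟩, hlt⟩ := exists_lt_of_csInf_lt hne h
  -- The common refinement of the two pulled-back partitions. The coupling is the measure of its
  -- cells, and the cells serve as test sets for the cut metric.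
  set K : I → ι × ι' := fun x => (κ (φ x), κ' (ψ x))
  have hKpre : ∀ i j, K ⁻¹' {(i, j)} = φ ⁻¹' (κ ⁻¹' {i}) ∩ ψ ⁻¹' (κ' ⁻¹' {j}) := by
    intro i j; ext x; simp [K]
  have hK : ∀ z, MeasurableSet (K ⁻¹' {z}) := by
    rintro ⟨i, j⟩
    rw [hKpre]
    exact (hφ.measurable (hκ i)).inter (hψ.measurable (hκ' j))
  have hκφ : ∀ i, MeasurableSet ((κ ∘ φ) ⁻¹' {i}) := fun i => hφ.measurable (hκ i)
  have hκψ : ∀ i, MeasurableSet ((κ' ∘ ψ) ⁻¹' {i}) := fun i => hψ.measurable (hκ' i)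
  refine ⟨fun i j => (volume : Measure I).real (K ⁻¹' {(i, j)}), fun i j => measureReal_nonneg,
    fun i => ?_, fun j => ?_, fun i j k l => ?_⟩
  · have h1 := integral_comp_pode hκφ fun u => if u = i then (1 : ℝ) else 0
    have h2 := integral_comp_pode hK fun u => if u.1 = i then (1 : ℝ) else 0
    have h3 : (volume : Measure I).real ((κ ∘ φ) ⁻¹' {i}) = w i := by
      rw [← hw, preimage_comp, measureReal_def, measureReal_def,
        hφ.measure_preimage (hκ i).nullMeasurableSet]
    have h4 : ∫ x, (fun u => if u = i then (1 : ℝ) else 0) ((κ ∘ φ) x) =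
      ∫ x, (fun u : ι × ι' => if u.1 = i then (1 : ℝ) else 0) (K x) := rfl
    rw [h1, h2, Fintype.sum_prod_type] at h4
    simp at h4
    rw [← h3, h4]
  · have h1 := integral_comp_pode hκψ fun u => if u = j then (1 : ℝ) else 0
    have h2 := integral_comp_pode hK fun u => if u.2 = j then (1 : ℝ) else 0
    have h3 : (volume : Measure I).real ((κ' ∘ ψ) ⁻¹' {j}) = w' j := by
      rw [← hw', preimage_comp, measureReal_def, measureReal_def,
        hψ.measure_preimage (hκ' j).nullMeasurableSet]
    have h4 : ∫ x, (fun u => if u = j then (1 : ℝ) else 0) ((κ' ∘ ψ) x) =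
      ∫ x, (fun u : ι × ι' => if u.2 = j then (1 : ℝ) else 0) (K x) := rfl
    rw [h1, h2, Fintype.sum_prod_type] at h4
    simp at h4
    rw [← h3, h4]
  · refine lt_of_le_of_lt ?_ hlt
    refine le_csSup ?_ ⟨K ⁻¹' {(i, j)}, K ⁻¹' {(k, l)}, hK _, hK _, ?_⟩
    · refine ⟨1, ?_⟩
      rintro _ ⟨S, T, -, -, rfl⟩
      have hin : ∀ x : I, ‖∫ y in T, (f.toFun (φ x) (φ y) - g.toFun (ψ x) (ψ y))‖ ≤ 1 := by
        intro x
        refine (norm_setIntegral_le_of_norm_le_const (C := 1) (measure_lt_top _ _)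
          fun y _ => ?_).trans ?_
        · rw [Real.norm_eq_abs, abs_le]
          constructor <;> linarith [f.nonneg' (φ x) (φ y), g.nonneg' (ψ x) (ψ y),
            f.le_one' (φ x) (φ y), g.le_one' (ψ x) (ψ y)]
        · rw [one_mul]; exact measureReal_le_one
      rw [← Real.norm_eq_abs]
      refine (norm_setIntegral_le_of_norm_le_const (C := 1) (measure_lt_top _ _)
        fun x _ => hin x).trans ?_
      rw [one_mul]; exact measureReal_le_one
    · have hF : ∀ᵐ x : I, ∀ᵐ y : I, f.toFun (φ x) (φ y) = P (κ (φ x)) (κ (φ y)) := by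
        have h1 : ∀ᵐ u : I, ∀ᵐ v : I, f.toFun u v = P (κ u) (κ v) := Measure.ae_ae_of_ae_prod hP
        exact (hφ.quasiMeasurePreserving.ae h1).mono fun x hx => hφ.quasiMeasurePreserving.ae hx
      have hG : ∀ᵐ x : I, ∀ᵐ y : I, g.toFun (ψ x) (ψ y) = P' (κ' (ψ x)) (κ' (ψ y)) := by
        have h1 : ∀ᵐ u : I, ∀ᵐ v : I, g.toFun u v = P' (κ' u) (κ' v) :=
          Measure.ae_ae_of_ae_prod hP'
        exact (hψ.quasiMeasurePreserving.ae h1).mono fun x hx => hψ.quasiMeasurePreserving.ae hx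
      have h1 : ∫ x in K ⁻¹' {(i, j)}, ∫ y in K ⁻¹' {(k, l)},
          (f.toFun (φ x) (φ y) - g.toFun (ψ x) (ψ y)) =
          ∫ x in K ⁻¹' {(i, j)}, (volume : Measure I).real (K ⁻¹' {(k, l)}) *
            (P i k - P' j l) := by
        refine setIntegral_congr_ae (hK _) ?_
        filter_upwards [hF, hG] with x hx hx' hxK
        rw [hKpre] at hxK
        have e1 : κ (φ x) = i := hxK.1
        have e2 : κ' (ψ x) = j := hxK.2
        have h2 : ∫ y in K ⁻¹' {(k, l)}, (f.toFun (φ x) (φ y) - g.toFun (ψ x) (ψ y)) =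
            ∫ y in K ⁻¹' {(k, l)}, (P i k - P' j l) := by
          refine setIntegral_congr_ae (hK _) ?_
          filter_upwards [hx, hx'] with y hy hy' hyK
          rw [hKpre] at hyK
          have e3 : κ (φ y) = k := hyK.1
          have e4 : κ' (ψ y) = l := hyK.2
          rw [hy, hy', e1, e2, e3, e4]
        rw [h2, setIntegral_const, smul_eq_mul]
      rw [h1, setIntegral_const, smul_eq_mul, abs_mul, abs_mul, abs_of_nonneg measureReal_nonneg,
        abs_of_nonneg measureReal_nonneg]
      ring

/-- A coupling of two weighted matrices under which the values agree. -/
structure Coupling {ι ι' : Type} [Fintype ι] [Fintype ι'] (w : ι → ℝ) (P : ι → ι → ℝ)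
    (w' : ι' → ℝ) (P' : ι' → ι' → ℝ) (M : ι → ι' → ℝ) : Prop where
  nonneg : ∀ i j, 0 ≤ M i j
  row : ∀ i, ∑ j, M i j = w i
  col : ∀ j, ∑ i, M i j = w' j
  val : ∀ i j k l, M i j * M k l * |P i k - P' j l| ≤ 0

namespace Coupling

variable {ι ι' : Type} [Fintype ι] [Fintype ι'] {w : ι → ℝ} {P : ι → ι → ℝ}
    {w' : ι' → ℝ} {P' : ι' → ι' → ℝ} {M : ι → ι' → ℝ}

theorem val_eq (h : Coupling w P w' P' M) {i j k l} (h1 : 0 < M i j) (h2 : 0 < M k l) :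
    P i k = P' j l := by
  have h3 := h.val i j k l
  have h4 := mul_pos h1 h2
  have h5 : |P i k - P' j l| ≤ 0 := by
    by_contra h6
    have := mul_pos h4 (not_le.1 h6)
    linarith
  exact sub_eq_zero.1 (abs_nonpos_iff.1 h5)

theorem exists_row (h : Coupling w P w' P' M) {j} (hj : 0 < w' j) : ∃ i, 0 < M i j := by
  by_contra! hc
  have := h.col j
  have h2 : ∑ i, M i j ≤ 0 := Finset.sum_nonpos fun i _ => hc i
  linarith

theorem exists_col (h : Coupling w P w' P' M) {i} (hi : 0 < w i) : ∃ j, 0 < M i j := by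
  by_contra! hc
  have := h.row i
  have h2 : ∑ j, M i j ≤ 0 := Finset.sum_nonpos fun i _ => hc i
  linarith

theorem eq_zero (h : Coupling w P w' P' M) {i} (hi : w i = 0) (j) : M i j = 0 :=
  (Finset.sum_eq_zero_iff_of_nonneg fun j _ => h.nonneg i j).1 ((h.row i).trans hi) j
    (Finset.mem_univ j)

/-- If j and j' are both coupled to i, then P' j l = P i k = P' j' l for any k coupled to l, so
their rows agree. -/
theorem col_unique (h : Coupling w P w' P' M) (hw' : ∀ j, 0 < w' j)
    (hinj : Function.Injective P') {i j j'} (h1 : 0 < M i j) (h2 : 0 < M i j') : j = j' := by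
  apply hinj
  funext l
  obtain ⟨k, hk⟩ := h.exists_row (hw' l)
  rw [← h.val_eq h1 hk, ← h.val_eq h2 hk]

/-- If all weights are positive, a coupling is given by a map. -/
theorem exists_map [DecidableEq ι'] (h : Coupling w P w' P' M) (hw : ∀ i, 0 < w i)
    (hw' : ∀ j, 0 < w' j) (hinj : Function.Injective P') :
    ∃ π : ι → ι', Function.Surjective π ∧ (∀ i k, P i k = P' (π i) (π k)) ∧
      ∀ j, w' j = ∑ i, if π i = j then w i else 0 := by
  choose π hπ using fun i => h.exists_col (hw i)
  have hM : ∀ i j, M i j = if π i = j then w i else 0 := by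
    have h0 : ∀ i j, π i ≠ j → M i j = 0 := by
      intro i j hne
      by_contra hc
      exact hne (h.col_unique hw' hinj (hπ i) (lt_of_le_of_ne (h.nonneg i j) (Ne.symm hc)))
    intro i j
    split_ifs with hij
    · subst hij
      rw [← h.row i]
      exact (Finset.sum_eq_single_of_mem (π i) (Finset.mem_univ _)
        fun j _ hj => h0 i j (Ne.symm hj)).symm
    · exact h0 i j hij
  refine ⟨π, fun j => ?_, fun i k => h.val_eq (hπ i) (hπ k), fun j => ?_⟩
  · obtain ⟨i, hi⟩ := h.exists_row (hw' j)
    exact ⟨i, h.col_unique hw' hinj (hπ i) hi⟩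
  · rw [← h.col j]
    exact Finset.sum_congr rfl fun i _ => hM i j

end Coupling

/-! ### How m + 2 podes collapse onto m + 1. -/

/-- `m + 1` podes of equal size with equal values are of type `A`. -/
theorem isTypeA_of_balanced {m : ℕ} (hm : 1 ≤ m) {g : Graphon} {c a d b p : ℝ}
    (h : IsMultipodal g (podeSize 1 m c) (podeValue 1 m a a d b p)) (hc : c = (1 - c) / m)
    (hab : a = b) (hdp : 2 ≤ m → d = p) : IsTypeA (m + 1) g := by
  have hm0 : (0 : ℝ) < m := by exact_mod_cast hm
  have hc' : c = 1 / ((m + 1 : ℕ) : ℝ) := by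
    push_cast
    have : c * m = 1 - c := by
      nth_rw 1 [hc]; field_simp
    rw [eq_div_iff (by positivity)]
    linarith
  set e : Fin 1 ⊕ Fin m ≃ Fin (m + 1) := finSumFinEquiv.trans (finCongr (Nat.add_comm 1 m))
  have h1 := h.reindex e
  refine ⟨a, d, ?_⟩
  convert h1 using 2 with i i
  · rcases e.symm i with j | j
    · simp only [podeSize, Nat.cast_one, div_one]; exact hc'.symm
    · simp only [podeSize, ← hc]; exact hc'.symm
  · funext j
    have hij : i = j ↔ e.symm i = e.symm j := e.symm.injective.eq_iff.symm
    simp only [hij]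
    rcases e.symm i with i | i <;> rcases e.symm j with j | j
    · simp [podeValue, Subsingleton.elim i j]
    · simp [podeValue]
    · simp [podeValue]
    · simp only [podeValue, Sum.inr.injEq, hab]
      split_ifs with h2
      · rfl
      · refine hdp ?_
        by_contra h3
        have : m = 1 := by omega
        subst this
        exact h2 (Subsingleton.elim _ _)

theorem podeSize_pos {r m : ℕ} (hr : 1 ≤ r) (hm : 1 ≤ m) {c : ℝ} (hc : c ∈ Ioo (0 : ℝ) 1)
    (i : Fin r ⊕ Fin m) : 0 < podeSize r m c i := by
  have := hc.1
  have := sub_pos.2 hc.2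
  rcases i with i | i <;> simp only [podeSize] <;> positivity

section Merging

variable {m : ℕ} {g₀ : Graphon} {c₀ : ℝ} {P₀ : Fin 1 ⊕ Fin m → Fin 1 ⊕ Fin m → ℝ}

/-- If the first two podes are merged, the limit has the corresponding podal structure, which is
not degenerate. -/
theorem nondegenerate_of_merged (hm : 1 ≤ m) {c a₁ a₂ d b p : ℝ}
    (hinj : Function.Injective P₀) (hg : IsMultipodal g₀ (podeSize 1 m c₀) P₀)
    (hA : ¬IsTypeA (m + 1) g₀) {π : Fin 2 ⊕ Fin m → Fin 1 ⊕ Fin m} (hπ : Function.Surjective π)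
    (hval : ∀ i k, podeValue 2 m a₁ a₂ d b p i k = P₀ (π i) (π k))
    (hsize : ∀ j, podeSize 1 m c₀ j = ∑ i, if π i = j then podeSize 2 m c i else 0)
    (h01 : π (Sum.inl 0) = π (Sum.inl 1)) :
    a₁ = a₂ ∧ (2 ≤ m → b ≠ p) ∧ (m = 1 → ¬(a₁ = d ∧ b = d)) ∧
      ¬(c = (1 - c) / m ∧ a₁ = b ∧ (2 ≤ m → d = p)) := by
  have ha : a₁ = a₂ := by
    have h1 := hval (Sum.inl 0) (Sum.inl 0)
    have h2 := hval (Sum.inl 0) (Sum.inl 1)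
    rw [← h01, ← h1] at h2
    simpa [podeValue] using h2.symm
  subst ha
  -- With the merged pair counted once, π becomes a surjection between sets of equal size, hence a
  -- relabelling of the podes of g₀.
  set ρ : Fin 1 ⊕ Fin m → Fin 1 ⊕ Fin m := Sum.elim (fun _ => π (Sum.inl 0)) fun j => π (Sum.inr j)
  have hρs : Function.Surjective ρ := by
    intro j
    obtain ⟨i, rfl⟩ := hπ j
    rcases i with i | i
    · refine ⟨Sum.inl 0, ?_⟩
      fin_cases i
      · rfl
      · exact h01
    · exact ⟨Sum.inr i, rfl⟩
  have hρi : Function.Injective ρ := Finite.injective_iff_surjective.2 hρs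
  have hρv : ∀ i k, podeValue 1 m a₁ a₁ d b p i k = P₀ (ρ i) (ρ k) := by
    rintro (i | i) (k | k)
    · simp [podeValue, ρ, ← hval]
    · simp [podeValue, ρ, ← hval]
    · simp [podeValue, ρ, ← hval]
    · simp [podeValue, ρ, ← hval]
  have hrow : ∀ i k, podeValue 1 m a₁ a₁ d b p i = podeValue 1 m a₁ a₁ d b p k → i = k := by
    intro i k hik
    refine hρi (hinj (funext fun j => ?_))
    obtain ⟨l, rfl⟩ := hρs j
    rw [← hρv, ← hρv, hik]
  refine ⟨rfl, fun hm2 hbp => ?_, fun hm1 hc => ?_, fun hc => hA ?_⟩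
  · have := hrow (Sum.inr ⟨0, by omega⟩) (Sum.inr ⟨1, by omega⟩) (by
      funext k
      rcases k with k | k <;> simp [podeValue, hbp])
    simp at this
  · subst hm1
    have := hrow (Sum.inl 0) (Sum.inr 0) (by
      funext k
      rcases k with k | k <;> simp [podeValue, hc.1, hc.2, Subsingleton.elim (0 : Fin 1) k])
    simp at this
  · have hmult : IsMultipodal g₀ (podeSize 1 m c) (podeValue 1 m a₁ a₁ d b p) := by
      have h1 : IsMultipodal g₀ (fun i => podeSize 1 m c₀ (ρ i)) fun i j => P₀ (ρ i) (ρ j) :=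
        hg.reindex (Equiv.ofBijective ρ ⟨hρi, hρs⟩).symm
      convert h1 using 2 with i i
      · rw [hsize, Fintype.sum_sum_type]
        rcases i with i | i
        · have h2 : ∀ j, π (Sum.inr j) ≠ π (Sum.inl 0) := fun j hj => by
            have : ρ (Sum.inr j) = ρ (Sum.inl i) := hj
            simpa using hρi this
          have h3 : ρ (Sum.inl i) = π (Sum.inl 0) := rfl
          simp [h2, h3, ← h01, podeSize]
        · have h2 : ∀ k, π (Sum.inr k) = ρ (Sum.inr i) ↔ k = i := fun k => by
            have : π (Sum.inr k) = ρ (Sum.inr k) := rfl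
            rw [this, hρi.eq_iff, Sum.inr.injEq]
          have h3 : ∀ k, π (Sum.inl k) ≠ ρ (Sum.inr i) := fun k hk => by
            have : π (Sum.inl k) = ρ (Sum.inl 0) := by
              fin_cases k
              · rfl
              · exact h01.symm
            rw [this] at hk
            simpa using hρi hk
          simp [h2, h3, podeSize]
      · funext k
        exact hρv i k
    exact isTypeA_of_balanced hm hmult hc.1 hc.2.1 hc.2.2

/-- The mass of the pair of podes does not vanish in the limit. -/
theorem Coupling.mass_ne_zero (hc₀ : c₀ ∈ Ioo (0 : ℝ) 1) (hm : 1 ≤ m)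
    (hinj : Function.Injective P₀) {c : ℝ} {P : Fin 2 ⊕ Fin m → Fin 2 ⊕ Fin m → ℝ}
    {M : Fin 2 ⊕ Fin m → Fin 1 ⊕ Fin m → ℝ}
    (h : Coupling (podeSize 2 m c) P (podeSize 1 m c₀) P₀ M) : c ≠ 0 := by
  rintro rfl
  have hw' := podeSize_pos (r := 1) le_rfl hm hc₀
  -- A pair of mass zero would leave m podes to be coupled to m + 1 distinct ones.
  have hex : ∀ j, ∃ i, 0 < M (Sum.inr i) j := by
    intro j
    obtain ⟨i | i, hi⟩ := h.exists_row (hw' j)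
    · rw [h.eq_zero (by simp [podeSize])] at hi
      exact absurd hi (lt_irrefl _)
    · exact ⟨i, hi⟩
  choose f hf using hex
  have hfi : Function.Injective f := fun j j' hj =>
    h.col_unique hw' hinj (hf j) (by rw [hj]; exact hf j')
  have := Fintype.card_le_of_injective f hfi
  simp at this

/-- The pair of podes does not exhaust the mass in the limit. -/
theorem Coupling.mass_ne_one (hc₀ : c₀ ∈ Ioo (0 : ℝ) 1) (hm : 1 ≤ m)
    (hinj : Function.Injective P₀) (hg : IsMultipodal g₀ (podeSize 1 m c₀) P₀)
    (hA : ¬IsTypeA (m + 1) g₀) {c a₁ a₂ d b p : ℝ} {M : Fin 2 ⊕ Fin m → Fin 1 ⊕ Fin m → ℝ}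
    (h : Coupling (podeSize 2 m c) (podeValue 2 m a₁ a₂ d b p) (podeSize 1 m c₀) P₀ M) :
    c ≠ 1 := by
  rintro rfl
  have hw' := podeSize_pos (r := 1) le_rfl hm hc₀
  have hzero : ∀ i j, M (Sum.inr i) j = 0 := fun i j => h.eq_zero (by simp [podeSize]) j
  have hex : ∀ j, ∃ i, 0 < M (Sum.inl i) j := by
    intro j
    obtain ⟨i | i, hi⟩ := h.exists_row (hw' j)
    · exact ⟨i, hi⟩
    · rw [hzero] at hi
      exact absurd hi (lt_irrefl _)
  choose f hf using hex
  have hfi : Function.Injective f := fun j j' hj =>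
    h.col_unique hw' hinj (hf j) (by rw [hj]; exact hf j')
  have hcard := Fintype.card_le_of_injective f hfi
  -- Two podes carry all the mass and must cover m + 1. For m = 1 they correspond bijectively to
  -- podes of size 1/2, which makes g₀ of type A.
  have hm1 : m = 1 := by simp at hcard; omega
  subst hm1
  have hfb : Function.Bijective f :=
    (Fintype.bijective_iff_injective_and_card f).2 ⟨hfi, by simp⟩
  have hoff : ∀ j j', j ≠ j' → M (Sum.inl (f j)) j' = 0 := by
    intro j j' hne
    by_contra hc
    exact hne (h.col_unique hw' hinj (hf j) (lt_of_le_of_ne (h.nonneg _ _) (Ne.symm hc)))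
  have hsz : ∀ j, podeSize 1 1 c₀ j = 1 / 2 := by
    intro j
    rw [← h.col j, Fintype.sum_sum_type]
    simp only [hzero, Finset.sum_const_zero, add_zero]
    rw [Finset.sum_eq_single_of_mem (f j) (Finset.mem_univ _), ← Finset.sum_eq_single_of_mem
      (f := fun j' => M (Sum.inl (f j)) j') j (Finset.mem_univ _), h.row]
    · simp [podeSize]
    · intro j' _ hj'
      exact hoff j j' (Ne.symm hj')
    · intro i _ hi
      obtain ⟨j', rfl⟩ := hfb.2 i
      exact hoff j' j fun h => hi (by rw [h])
  refine hA ⟨a₁, a₂, ?_⟩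
  have h1 := hg.reindex (Equiv.ofBijective f hfb)
  convert h1 using 2 with i i
  · rw [hsz]; norm_num
  · funext k
    obtain ⟨i, rfl⟩ := hfb.2 i
    obtain ⟨k, rfl⟩ := hfb.2 k
    have e : ∀ i, (Equiv.ofBijective f hfb).symm (f i) = i := fun i =>
      (Equiv.ofBijective f hfb).symm_apply_apply i
    rw [e, e, ← h.val_eq (hf i) (hf k)]
    rfl

/-- Only the podes of one group merge in the limit, and this group is a pair. -/
theorem merged_or_swapped {a₁ a₂ d b p : ℝ}
    (hinj : Function.Injective P₀) {π : Fin 2 ⊕ Fin m → Fin 1 ⊕ Fin m}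
    (hπ : Function.Surjective π)
    (hval : ∀ i k, podeValue 2 m a₁ a₂ d b p i k = P₀ (π i) (π k)) :
    π (Sum.inl 0) = π (Sum.inl 1) ∨ (m = 2 ∧ ∀ i j, π (Sum.inr i) = π (Sum.inr j)) := by
  by_contra! hcon
  obtain ⟨h01, h2⟩ := hcon
  have hrow : ∀ i k, podeValue 2 m a₁ a₂ d b p i = podeValue 2 m a₁ a₂ d b p k → π i = π k := by
    intro i k hik
    refine hinj (funext fun j => ?_)
    obtain ⟨l, rfl⟩ := hπ j
    rw [← hval, ← hval, hik]
  have hrow' : ∀ i k, π i = π k → podeValue 2 m a₁ a₂ d b p i = podeValue 2 m a₁ a₂ d b p k := by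
    intro i k hik
    funext l
    rw [hval, hval, hik]
  -- Equal rows for podes of different groups would give a₁ = d = a₂, and then the pair itself would
  -- merge.
  have hnot : ∀ x j, π (Sum.inl x) ≠ π (Sum.inr j) := by
    intro x j hxj
    have h3 := congrFun (hrow' _ _ hxj)
    have h4 := h3 (Sum.inl 0)
    have h5 := h3 (Sum.inl 1)
    refine h01 (hrow _ _ (funext fun k => ?_))
    rcases k with k | k
    · fin_cases x <;> fin_cases k <;> simp [podeValue] at h4 h5 ⊢ <;> linarith
    · simp [podeValue]
  have hni : ¬Function.Injective π := fun hi => by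
    have := Fintype.card_le_of_injective π hi
    simp at this
  simp only [Function.Injective, not_forall] at hni
  obtain ⟨i, k, hik, hne⟩ := hni
  rcases i with i | i <;> rcases k with k | k
  · fin_cases i <;> fin_cases k
    · exact hne rfl
    · exact h01 hik
    · exact h01 hik.symm
    · exact hne rfl
  · exact hnot _ _ hik
  · exact hnot _ _ hik.symm
  · have hik' : i ≠ k := fun h => hne (by rw [h])
    have hbp : b = p := by
      have := congrFun (hrow' _ _ hik) (Sum.inr i)
      simpa [podeValue, hik'.symm] using this
    have hall : ∀ i j, π (Sum.inr i) = π (Sum.inr j) := by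
      intro i j
      refine hrow _ _ (funext fun k => ?_)
      rcases k with k | k <;> simp [podeValue, hbp]
    have hm2 : 2 ≤ m := by
      have h3 : Nontrivial (Fin m) := ⟨i, k, hik'⟩
      rwa [Fin.nontrivial_iff_two_le] at h3
    -- Two merged podes of the second group give b = p, so the whole group collapses. At most three
    -- images remain, whence m + 1 ≤ 3.
    have hs : Function.Surjective (fun t : Fin 2 ⊕ Fin 1 =>
        π (Sum.elim Sum.inl (fun _ => Sum.inr i) t)) := by
      intro j
      obtain ⟨l, rfl⟩ := hπ j
      rcases l with l | l
      · exact ⟨Sum.inl l, rfl⟩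
      · exact ⟨Sum.inr 0, hall _ _⟩
    have := Fintype.card_le_of_surjective _ hs
    simp at this
    obtain ⟨i', j', h3⟩ := h2 (by omega)
    exact h3 (hall _ _)

end Merging

/-! ### Extremal points of a C phase and the conclusion. -/

variable {m : ℕ}

theorem IsTypeC.exists_shape (hm : 1 ≤ m) {g : Graphon} (h : IsTypeC m g) :
    ∃ θ : Shape, θ.Valid ∧ HasShape m g θ ∧ θ.c ∈ Ioo (0 : ℝ) 1 ∧ θ.a₁ ≠ θ.a₂ ∧
      (2 ≤ m → θ.b ≠ θ.p) ∧ (m = 1 → θ.p = 1 / 2) := by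
  obtain ⟨c, a₁, a₂, d, b, p, hc0, hc1, hinj, hg, -⟩ := h
  have hpos := podeSize_pos (r := 2) (by norm_num) hm ⟨hc0, hc1⟩
  have hmem := fun i j => hg.value_mem (hpos i) (hpos j)
  have ha : a₁ ≠ a₂ := by
    rintro rfl
    have := @hinj (Sum.inl 0) (Sum.inl 1) (by
      funext k
      rcases k with k | k <;> simp [podeValue])
    simp at this
  have h1 : a₁ ∈ Icc (0 : ℝ) 1 := by simpa [podeValue] using hmem (Sum.inl 0) (Sum.inl 0)
  have h2 : a₂ ∈ Icc (0 : ℝ) 1 := by simpa [podeValue] using hmem (Sum.inl 0) (Sum.inl 1)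
  have h3 : d ∈ Icc (0 : ℝ) 1 := hmem (Sum.inl 0) (Sum.inr ⟨0, hm⟩)
  have h4 : b ∈ Icc (0 : ℝ) 1 := by
    simpa [podeValue] using hmem (Sum.inr ⟨0, hm⟩) (Sum.inr ⟨0, hm⟩)
  rcases hm.eq_or_lt with rfl | hm2
  -- For `m = 1` no block has value p, so p may be unconstrained; the choice 1/2 keeps it inside
  -- (0,1).
  · refine ⟨⟨c, a₁, a₂, d, b, 1 / 2⟩, ⟨⟨hc0.le, hc1.le⟩, h1, h2, h3, h4, by norm_num⟩, ?_,
      ⟨hc0, hc1⟩, ha, by omega, fun _ => rfl⟩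
    have : podeValue 2 1 a₁ a₂ d b (1 / 2) = podeValue 2 1 a₁ a₂ d b p := by
      funext i j
      rcases i with i | i <;> rcases j with j | j <;> simp only [podeValue]
      simp [Subsingleton.elim i j]
    rw [← this] at hg
    exact hg
  · have h5 : p ∈ Icc (0 : ℝ) 1 := by
      simpa [podeValue] using hmem (Sum.inr ⟨0, hm⟩) (Sum.inr ⟨1, hm2⟩)
    refine ⟨⟨c, a₁, a₂, d, b, p⟩, ⟨⟨hc0.le, hc1.le⟩, h1, h2, h3, h4, h5⟩, hg, ⟨hc0, hc1⟩, ha,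
      fun _ => ?_, by omega⟩
    rintro (rfl : b = p)
    have := @hinj (Sum.inr ⟨0, hm⟩) (Sum.inr ⟨1, hm2⟩) (by
      funext k
      rcases k with k | k <;> simp [podeValue])
    simp at this

/-- A competitor with too few triangles is first raised to the prescribed triangle density, at no
loss of entropy, by `Shape.exists_tri_eq`. -/
theorem IsOptimizer.ent_le (hm : 1 ≤ m) {g : Graphon} {y : ℝ × ℝ} (h : IsOptimizer g y)
    (hy : y.2 < y.1 ^ 3) {θ : Shape} (hθ : θ.Valid) (he : θ.edge m = y.1) (ht : θ.tri m ≤ y.2) :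
    θ.ent m ≤ g.entropy := by
  obtain ⟨θ', hθ', he', ht', hS⟩ := Shape.exists_tri_eq hm hθ ht (by rw [he]; exact hy.le)
  obtain ⟨g', hg'⟩ := exists_hasShape hm hθ'
  rw [← hg'.entropy_eq hm] at hS
  exact hS.trans (h.2.2 g' (by rw [hg'.edgeDensity_eq hm, he', he])
    (by rw [hg'.triangleDensity_eq hm, ht']))

/-- In a `C(m,2)` phase the maximal entropy is differentiable in the triangle density at
a dense set of points. -/
theorem IsPhaseC.exists_extremal (hm : 1 ≤ m) {V : Set (ℝ × ℝ)} (hV : IsPhaseC m V)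
    {W : Set (ℝ × ℝ)} (hW : IsOpen W) (hWV : W ⊆ V) (hne : W.Nonempty) :
    ∃ y ∈ W, ∃ g, IsOptimizer g y ∧ ∃ θ : Shape, θ.Valid ∧ HasShape m g θ ∧ θ.c ∈ Ioo (0 : ℝ) 1 ∧
      θ.a₁ ≠ θ.a₂ ∧ (2 ≤ m → θ.b ≠ θ.p) ∧ (m = 1 → θ.p = 1 / 2) ∧ θ.edge m ∈ Ioo (0 : ℝ) 1 ∧
      Shape.Extremal m (θ.edge m) (θ.tri m) (θ.ent m) := by
  obtain ⟨⟨-, -, G, hG, -⟩, hlt, htype⟩ := hV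
  obtain ⟨⟨ε, τ⟩, hx⟩ := hne
  have hopen : IsOpen {t : ℝ | (ε, t) ∈ W} := hW.preimage (by fun_prop : Continuous (Prod.mk ε))
  obtain ⟨r, hr, hball⟩ := Metric.isOpen_iff.1 hopen τ hx
  rw [Real.ball_eq_Ioo] at hball
  set J := Ioo (τ - r) (τ + r)
  set s : ℝ → ℝ := fun t => (G (ε, t)).entropy
  have hopt : ∀ t ∈ J, IsOptimizer (G (ε, t)) (ε, t) := fun t ht => (hG _ (hWV (hball ht))).1
  have hshape := fun t (ht : t ∈ J) =>
    (htype _ (hWV (hball ht)) _ (hopt t ht)).exists_shape hm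
  have hbound : ∀ t ∈ J, ∀ θ : Shape, θ.Valid → θ.edge m = ε → θ.tri m ≤ t → θ.ent m ≤ s t :=
    fun t ht θ hθ he h => (hopt t ht).ent_le hm (hlt _ (hWV (hball ht))) hθ he h
  have hmono : MonotoneOn s J := by
    intro t ht t' ht' htt'
    obtain ⟨θ, hθ, hs, -⟩ := hshape t ht
    have h1 := (hopt t ht).1
    have h2 := (hopt t ht).2.1
    rw [hs.edgeDensity_eq hm] at h1
    rw [hs.triangleDensity_eq hm] at h2
    have := hbound t' ht' θ hθ h1 (h2.le.trans htt')
    rwa [← hs.entropy_eq hm] at this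
  -- Lebesgue's theorem: a monotone function is differentiable almost everywhere, and J has positive
  -- measure.
  obtain ⟨t, ht, hd⟩ : ∃ t ∈ J, DifferentiableWithinAt ℝ s J t := by
    have h1 : ∃ᵐ t : ℝ, t ∈ J := by
      rw [frequently_ae_mem_iff]
      simp [J, hr]
    obtain ⟨t, ht, h⟩ := (h1.and_eventually hmono.ae_differentiableWithinAt_of_mem).exists
    exact ⟨t, ht, h ht⟩
  have hJ : J ∈ 𝓝 t := isOpen_Ioo.mem_nhds ht
  have hd' : DifferentiableAt ℝ s t := hd.differentiableAt hJ
  obtain ⟨θ, hθ, hs, hc, ha, hbp, hp⟩ := hshape t ht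
  have h1 := (hopt t ht).1
  have h2 := (hopt t ht).2.1
  rw [hs.edgeDensity_eq hm] at h1
  rw [hs.triangleDensity_eq hm] at h2
  have h3 : s t = θ.ent m := hs.entropy_eq hm
  simp only at h1 h2
  refine ⟨(ε, t), hball ht, G (ε, t), hopt t ht, θ, hθ, hs, hc, ha, hbp, hp, ?_, ?_⟩
  · have h4 := Shape.edge_mem hm hθ
    refine ⟨lt_of_le_of_ne h4.1 fun h0 => ?_, lt_of_le_of_ne h4.2 fun h0 => ha ?_⟩
    · have h5 := Shape.tri_nonneg hm hθ
      have h6 : t < ε ^ 3 := hlt _ (hWV (hball ht))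
      rw [← h1, ← h0, ← h2] at h6
      linarith
    · have h5 : ∑ j, θ.wt m j * (1 - θ.val j) = 0 := by
        simp only [mul_sub, mul_one, Finset.sum_sub_distrib, Shape.wt_sum hm,
          ← Shape.edge_eq_sum, h0, sub_self]
      have h6 := (Finset.sum_eq_zero_iff_of_nonneg fun j _ => mul_nonneg (Shape.wt_nonneg hm hθ j)
        (sub_nonneg.2 (hθ.val_mem j).2)).1 h5
      have h7 : θ.c ^ 2 / 2 ≠ 0 := by have := hc.1; positivity
      have h8 := (mul_eq_zero.1 (h6 0 (Finset.mem_univ _))).resolve_left h7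
      have h9 := (mul_eq_zero.1 (h6 1 (Finset.mem_univ _))).resolve_left h7
      simp only [Shape.val, Matrix.cons_val_zero, Matrix.cons_val_one] at h8 h9
      linarith
  · rw [h1, h2, ← h3]
    refine ⟨hbound t ht, s, deriv s t, ?_, hd'.hasDerivAt, rfl, ?_⟩
    · rw [← derivWithin_of_mem_nhds hJ]
      exact hmono.derivWithin_nonneg
    · filter_upwards [hJ] with u hu θ' hθ' he htu
      exact hbound u hu θ' hθ' he htu.le

/-- The podal structure with parameters `x` converging to a limit in which the pair of podes
is merged. -/
theorem false_of_merged (hm : 1 ≤ m) {g₀ : Graphon} {c₀ : ℝ}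
    {P₀ : Fin 1 ⊕ Fin m → Fin 1 ⊕ Fin m → ℝ} (hinj : Function.Injective P₀)
    (hg : IsMultipodal g₀ (podeSize 1 m c₀) P₀) (hA : ¬IsTypeA (m + 1) g₀)
    {l : Filter ℕ} [l.NeBot] {x : ℕ → ℝ × (Fin 5 → ℝ)} {z : ℝ × (Fin 5 → ℝ)}
    (hx : Tendsto x l (𝓝 z)) (hc : ∀ n, (x n).1 ∈ Ioo (0 : ℝ) 1)
    (hv : ∀ n j, (x n).2 j ∈ Ioo (0 : ℝ) 1) (hne : ∀ n, (x n).2 0 ≠ (x n).2 1)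
    (hE : ∀ n, Shape.Extremal m ((Shape.mk' (x n)).edge m) ((Shape.mk' (x n)).tri m)
      ((Shape.mk' (x n)).ent m)) (hzc : z.1 ∈ Ioo (0 : ℝ) 1)
    {π : Fin 2 ⊕ Fin m → Fin 1 ⊕ Fin m} (hπ : Function.Surjective π)
    (hval : ∀ i k, podeValue 2 m (z.2 0) (z.2 1) (z.2 2) (z.2 3) (z.2 4) i k = P₀ (π i) (π k))
    (hsize : ∀ j, podeSize 1 m c₀ j = ∑ i, if π i = j then podeSize 2 m z.1 i else 0)
    (h01 : π (Sum.inl 0) = π (Sum.inl 1)) : False := by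
  obtain ⟨h1, h2, h3, h4⟩ := nondegenerate_of_merged hm hinj hg hA hπ hval hsize h01
  exact Shape.false_of_merging hm hx hc hv hne hE hzc h1 h2 h3 h4

/-- For `m = 2`, the parameters after exchanging the two pairs of podes. -/
def exchange (x : ℝ × (Fin 5 → ℝ)) : ℝ × (Fin 5 → ℝ) :=
  (1 - x.1, ![x.2 3, x.2 4, x.2 2, x.2 0, x.2 1])

theorem continuous_exchange : Continuous exchange := by
  refine (continuous_const.sub continuous_fst).prodMk (continuous_pi fun j => ?_)
  fin_cases j <;> simp <;> fun_prop

theorem edge_exchange (x : ℝ × (Fin 5 → ℝ)) :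
    (Shape.mk' (exchange x)).edge 2 = (Shape.mk' x).edge 2 := by
  simp [Shape.mk', Shape.ofVal, Shape.edge, exchange]; ring

theorem tri_exchange (x : ℝ × (Fin 5 → ℝ)) :
    (Shape.mk' (exchange x)).tri 2 = (Shape.mk' x).tri 2 := by
  simp [Shape.mk', Shape.ofVal, Shape.tri, exchange]; ring

theorem ent_exchange (x : ℝ × (Fin 5 → ℝ)) :
    (Shape.mk' (exchange x)).ent 2 = (Shape.mk' x).ent 2 := by
  simp [Shape.mk', Shape.ofVal, Shape.ent, exchange]; ring

/-- Extremal `C(m,2)` structures do not converge to a `B(m,1)` structure. -/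
theorem false_of_coupling_limit (hm : 1 ≤ m) {g₀ : Graphon} {c₀ : ℝ} (hc₀ : c₀ ∈ Ioo (0 : ℝ) 1)
    {P₀ : Fin 1 ⊕ Fin m → Fin 1 ⊕ Fin m → ℝ} (hinj : Function.Injective P₀)
    (hg : IsMultipodal g₀ (podeSize 1 m c₀) P₀) (hA : ¬IsTypeA (m + 1) g₀)
    {l : Filter ℕ} [l.NeBot] {x : ℕ → ℝ × (Fin 5 → ℝ)} {z : ℝ × (Fin 5 → ℝ)}
    (hx : Tendsto x l (𝓝 z)) (hc : ∀ n, (x n).1 ∈ Ioo (0 : ℝ) 1)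
    (hv : ∀ n j, (x n).2 j ∈ Ioo (0 : ℝ) 1) (hne : ∀ n, (x n).2 0 ≠ (x n).2 1)
    (hbp : 2 ≤ m → ∀ n, (x n).2 3 ≠ (x n).2 4)
    (hE : ∀ n, Shape.Extremal m ((Shape.mk' (x n)).edge m) ((Shape.mk' (x n)).tri m)
      ((Shape.mk' (x n)).ent m)) {M : Fin 2 ⊕ Fin m → Fin 1 ⊕ Fin m → ℝ}
    (hM : Coupling (podeSize 2 m z.1)
      (podeValue 2 m (z.2 0) (z.2 1) (z.2 2) (z.2 3) (z.2 4)) (podeSize 1 m c₀) P₀ M) :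
    False := by
  have hz : z.1 ∈ Icc (0 : ℝ) 1 :=
    isClosed_Icc.mem_of_tendsto ((continuous_fst.tendsto z).comp hx)
      (Eventually.of_forall fun n => Ioo_subset_Icc_self (hc n))
  have hzc : z.1 ∈ Ioo (0 : ℝ) 1 :=
    ⟨lt_of_le_of_ne hz.1 (hM.mass_ne_zero hc₀ hm hinj).symm,
      lt_of_le_of_ne hz.2 (hM.mass_ne_one hc₀ hm hinj hg hA)⟩
  obtain ⟨π, hπ, hval, hsize⟩ := hM.exists_map (podeSize_pos (by norm_num) hm hzc)
    (podeSize_pos le_rfl hm hc₀) hinj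
  rcases merged_or_swapped hinj hπ hval with h01 | ⟨rfl, h01⟩
  · exact false_of_merged hm hinj hg hA hx hc hv hne hE hzc hπ hval hsize h01
  -- For m = 2 both groups are pairs, and exchanging them turns the merging of the second pair into
  -- that of the first.
  · refine false_of_merged (x := fun n => exchange (x n)) (z := exchange z) (π := π ∘ Sum.swap) hm
      hinj hg hA ((continuous_exchange.tendsto z).comp hx) (fun n => ?_) (fun n j => ?_)
      (hbp le_rfl) (fun n => ?_) ?_ (hπ.comp Sum.swap_leftInverse.surjective) (fun i k => ?_)
      (fun j => ?_) (h01 0 1)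
    · exact ⟨sub_pos.2 (hc n).2, sub_lt_self 1 (hc n).1⟩
    · fin_cases j
      exacts [hv n 3, hv n 4, hv n 2, hv n 0, hv n 1]
    · rw [edge_exchange, tri_exchange, ent_exchange]
      exact hE n
    · exact ⟨sub_pos.2 hzc.2, sub_lt_self 1 hzc.1⟩
    · rw [Function.comp_apply, Function.comp_apply, ← hval]
      rcases i with i | i <;> rcases k with k | k <;> rfl
    · rw [hsize, ← (Equiv.sumComm (Fin 2) (Fin 2)).sum_comp]
      refine Finset.sum_congr rfl fun i _ => ?_
      refine if_congr Iff.rfl ?_ rfl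
      rcases i with i | i <;> simp [podeSize, exchange]

theorem continuous_podeSize (r m : ℕ) (i : Fin r ⊕ Fin m) :
    Continuous fun c => podeSize r m c i := by
  rcases i with i | i <;> simp only [podeSize, div_eq_mul_inv] <;> fun_prop

theorem continuous_podeValue (r m : ℕ) (i k : Fin r ⊕ Fin m) :
    Continuous fun v : Fin 5 → ℝ => podeValue r m (v 0) (v 1) (v 2) (v 3) (v 4) i k := by
  rcases i with i | i <;> rcases k with k | k <;> simp only [podeValue] <;> (try split_ifs) <;>
    fun_prop

/-- No `C(m,2)` phase has optimizers converging to a `B(m,1)` graphon at a boundary point. -/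
theorem IsPhaseC.not_tendsto_isTypeB (hm : 1 ≤ m) {V : Set (ℝ × ℝ)} (hV : IsPhaseC m V)
    {g₀ : Graphon} (hg₀ : IsTypeB m g₀) {x₀ : ℝ × ℝ} (hx₀ : x₀ ∈ closure V)
    (hlim : ∀ η > 0, ∀ᶠ x in 𝓝[V] x₀, ∀ g, IsOptimizer g x → cutDist g g₀ < η) : False := by
  obtain ⟨c₀, a₁, a₂, d, b, p, hc0, hc1, hinj, hg, hA⟩ := hg₀
  set P₀ := podeValue 1 m a₁ a₂ d b p
  have hex : ∀ n : ℕ, ∃ (x : ℝ × (Fin 5 → ℝ)) (M : Fin 2 ⊕ Fin m → Fin 1 ⊕ Fin m → ℝ),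
      (x.1 ∈ Ioo (0 : ℝ) 1 ∧ (∀ j, x.2 j ∈ Ioo (0 : ℝ) 1) ∧ x.2 0 ≠ x.2 1 ∧
        (2 ≤ m → x.2 3 ≠ x.2 4) ∧
        Shape.Extremal m ((Shape.mk' x).edge m) ((Shape.mk' x).tri m) ((Shape.mk' x).ent m)) ∧
      (∀ i j, 0 ≤ M i j) ∧ (∀ i, ∑ j, M i j = podeSize 2 m x.1 i) ∧
      (∀ j, ∑ i, M i j = podeSize 1 m c₀ j) ∧
      ∀ i j k l, M i j * M k l *
        |podeValue 2 m (x.2 0) (x.2 1) (x.2 2) (x.2 3) (x.2 4) i k - P₀ j l| <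
          1 / ((n : ℝ) + 1) := by
    intro n
    obtain ⟨N, hN, hx₀N, hNV⟩ :=
      mem_nhdsWithin.1 (hlim (1 / ((n : ℝ) + 1)) Nat.one_div_pos_of_nat)
    obtain ⟨y, hy, g, hopt, θ, hθ, hs, hc, ha, hbp, hp, he, hE⟩ :=
      hV.exists_extremal hm (hN.inter hV.1.1) inter_subset_right
        (mem_closure_iff.1 hx₀ N hN hx₀N)
    obtain ⟨M, h1, h2, h3, h4⟩ := exists_coupling hs hg (hNV hy g hopt)
    refine ⟨(θ.c, θ.val), M, ⟨hc, fun j => ?_, ha, hbp, hE⟩, h1, h2, h3, h4⟩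
    by_cases hj : 0 < θ.wt m j
    · exact Shape.val_mem_Ioo hm hθ hE he j hj
    · have hc0 := hc.1
      have hc1 := sub_pos.2 hc.2
      have hm0 : (0 : ℝ) < m := by exact_mod_cast hm
      have h5 : j = 4 ∧ m = 1 := by
        by_contra hcon
        refine hj ?_
        fin_cases j
        · change 0 < θ.c ^ 2 / 2; positivity
        · change 0 < θ.c ^ 2 / 2; positivity
        · change 0 < 2 * θ.c * (1 - θ.c); positivity
        · change 0 < (1 - θ.c) ^ 2 / m; positivity
        · change 0 < (1 - θ.c) ^ 2 * (m - 1) / m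
          have hm1 : m ≠ 1 := fun h => hcon ⟨rfl, h⟩
          have : (1 : ℝ) < m := by exact_mod_cast (by omega : 1 < m)
          have := sub_pos.2 this
          positivity
      obtain ⟨rfl, hm1⟩ := h5
      change θ.p ∈ Ioo (0 : ℝ) 1
      rw [hp hm1]
      norm_num
  choose x M hx hM0 hrow hcol hval using hex
  have hK : ∀ n, (x n, M n) ∈ Icc (0 : ℝ × (Fin 5 → ℝ)) 1 ×ˢ
      Icc (0 : Fin 2 ⊕ Fin m → Fin 1 ⊕ Fin m → ℝ) fun _ j => podeSize 1 m c₀ j := by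
    refine fun n => ⟨⟨⟨(hx n).1.1.le, fun j => ((hx n).2.1 j).1.le⟩, (hx n).1.2.le,
      fun j => ((hx n).2.1 j).2.le⟩, hM0 n, fun i j => ?_⟩
    refine le_of_le_of_eq ?_ (hcol n j)
    exact Finset.single_le_sum (fun i _ => hM0 n i j) (Finset.mem_univ i)
  -- Parameters and couplings lie in compact boxes, so along a subsequence the coupling errors
  -- 1/(n+1) vanish and the limiting coupling matches values exactly.
  obtain ⟨⟨z, M₀⟩, -, φ, hφ, hlimφ⟩ := (isCompact_Icc.prod isCompact_Icc).tendsto_subseq hK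
  have hz : Tendsto (fun n => x (φ n)) atTop (𝓝 z) := (continuous_fst.tendsto _).comp hlimφ
  have hM : ∀ i j, Tendsto (fun n => M (φ n) i j) atTop (𝓝 (M₀ i j)) := fun i j =>
    ((by fun_prop : Continuous fun u : (ℝ × (Fin 5 → ℝ)) ×
      (Fin 2 ⊕ Fin m → Fin 1 ⊕ Fin m → ℝ) => u.2 i j).tendsto _).comp hlimφ
  refine false_of_coupling_limit (x := fun n => x (φ n)) (M := M₀) hm ⟨hc0, hc1⟩ hinj hg hA hz
    (fun n => (hx _).1) (fun n => (hx _).2.1) (fun n => (hx _).2.2.1)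
    (fun h n => (hx _).2.2.2.1 h) (fun n => (hx _).2.2.2.2) ⟨fun i j => ?_, fun i => ?_,
      fun j => ?_, fun i j k l => ?_⟩
  · exact ge_of_tendsto' (hM i j) fun n => hM0 _ i j
  · refine tendsto_nhds_unique (tendsto_finsetSum _ fun j _ => hM i j) ?_
    simp only [hrow]
    exact (((continuous_podeSize 2 m i).comp continuous_fst).tendsto z).comp hz
  · refine tendsto_nhds_unique (tendsto_finsetSum _ fun i _ => hM i j) ?_
    simp only [hcol]
    exact tendsto_const_nhds
  · have h1 : Tendsto (fun n => podeValue 2 m ((x (φ n)).2 0) ((x (φ n)).2 1) ((x (φ n)).2 2)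
        ((x (φ n)).2 3) ((x (φ n)).2 4) i k) atTop
        (𝓝 (podeValue 2 m (z.2 0) (z.2 1) (z.2 2) (z.2 3) (z.2 4) i k)) :=
      (((continuous_podeValue 2 m i k).comp continuous_snd).tendsto z).comp hz
    exact le_of_tendsto_of_tendsto'
      (((hM i j).mul (hM k l)).mul (h1.sub_const (P₀ j l)).abs)
      (tendsto_one_div_add_atTop_nhds_zero_nat.comp hφ.tendsto_atTop)
      fun n => (hval (φ n) i j k l).le

end Graphon

end

theorem mainTheorem2 (m : ℕ) (hm : 1 ≤ m) :
    ∃ F : Set ℝ, F.Finite ∧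
      ∀ ε₀ τ₀ : ℝ, ε₀ ∉ F →
        ¬ ∃ (U V : Set (ℝ × ℝ)) (g₀ : Graphon),
          Graphon.IsPhaseB m U ∧ Graphon.IsPhaseC m V ∧ Graphon.IsTypeB m g₀ ∧
          Graphon.IsContinuousTransition U V (ε₀, τ₀) g₀ := by
  -- No edge density needs to be excluded; the contradiction arises on the C(m,2) side alone.
  refine ⟨∅, finite_empty, fun ε₀ τ₀ _ => ?_⟩
  rintro ⟨U, V, g₀, -, hV, hg₀, -, hx₀, hlim⟩
  exact hV.not_tendsto_isTypeB hm hg₀ (frontier_subset_closure hx₀) fun η hη =>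
    (hlim η hη).filter_mono (nhdsWithin_mono _ subset_union_right)
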